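/- Let $p>2$ be a prime, $\mathbb F$ an arbitrary field of characteristic $p$, and $M=\begin{pmatrix}c_{11}&c_{12}\\ c_{21}&c_{22}\end{pmatrix}\in\mathbb F^{2\times 2}$. Put $$\sigma(c_1,c_2)=\begin{pmatrix}1&2c_1&c_1^2+c_2\\0&1&c_1\\0&0&1\end{pmatrix},$$ and let $V_M$ be the three dimensional representation of $G=(\mathbb Z/p)^2=\langle e_1,e_2\rangle$ given by $e_i\mapsto\sigma(c_{1i},c_{2i})$. Then $G$ acts on the right on $\mathbb F[V_M]=\mathbb F[x,y,z]$ by algebra automorphisms, where $x\sigma(c_1,c_2)=x$, $y\sigma(c_1,c_2)=y+c_1x$ and $z\sigma(c_1,c_2)=z+2c_1y+(c_1^2+c_2)x$. For $f\in\mathbb F[x,y,z]$ let $N_G(f)$ be the product of the distinct elements of the $G$-orbit of $f$. Use the graded reverse lexicographic order with $x<y<z$. A subset $\mathcal B$ of a subalgebra $A\subseteq\mathbb F[x,y,z]$ is a SAGBI basis for $A$ if the lead terms of the elements of $\mathcal B$ generate the algebra generated by the lead terms of all elements of $A$. Over $\mathbb F_p[x_{11},x_{12},x_{21},x_{22}]$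 let $\Gamma$ be the matrix with rows $(x_{11},x_{12})$, $(x_{21},x_{22})$, $(x_{11}^p,x_{12}^p)$, $(x_{21}^p,x_{22}^p)$, $(x_{11}^{p^2},x_{12}^{p^2})$, $(x_{21}^{p^2},x_{22}^{p^2})$, and let $\gamma_{ij}$ be its minor on rows $i<j$. Let $\delta=y^2-xz$, and let $\tilde f_{ijk}$ be the minor on rows $i<j<k$ of the matrix obtained by appending to $\Gamma$ the third column $$\bigl[\,y/x,\ -\delta/x^2,\ (y/x)^p,\ (-\delta/x^2)^p,\ (y/x)^{p^2},\ (-\delta/x^2)^{p^2}\,\bigr]^T .$$ Let $f_{ijk}$ be the polynomial $x^m\tilde f_{ijk}$ with $m\ge 0$ minimal. Define $f_1=f_{123}$ and $f_2=(\gamma_{12}f_{124}+f_1^2)/(2x^{p-2})$; both are polynomials in $x,y,z$ with coefficients in $\mathbb F_p[x_{ij}]$. Write $\overline{\gamma}_{ij}$, $\overline{f_1}$, $\overline{f_2}$ for the results of substituting $x_{ij}\mapsto c_{ij}$ in coefficients. If $\overline\gamma_{12}\neq0=\overline\gamma_{13}$, put $h=\overline{f_2}/(\overline\gamma_{12}x)$;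 if $\overline\gamma_{12}=0$, put $d=\overline{f_1}/x^{p-2}=\overline\gamma_{13}\delta+\overline\gamma_{23}xy$. These are polynomials. **Theorem.** If $V_M$ is faithful and $(c_{11},c_{12})\neq(0,0)$ (that is, $V_M$ is a faithful representation of type $(1,1,1)$), then $\overline\gamma_{12}\ne0$ or $\overline\gamma_{13}\neq0$, so that one of the following three cases applies. 1. If $\overline\gamma_{12}\neq0$ and $\overline\gamma_{13}\neq0$, then $\{x,\overline{f_1},\overline{f_2},N_G(z)\}$ is a SAGBI basis for $\mathbb F[V_M]^G$ and generates it, and there is a single relation among the generators, constructed by subducting $\overline\gamma_{13}^{\,p}\,\overline{f_1}^{\,p+2}-\overline\gamma_{12}^{\,2}\,\overline{f_2}^{\,p}$. 2. If $\overline\gamma_{12}\neq0$ and $\overline\gamma_{13}=0$, then $\{x,N_G(y),h,N_G(z)\}$ is a SAGBI basis for $\mathbb F[V_M]^G$ and generates it, and there is a single relation among the generators, constructed by subducting $\overline\gamma_{23}^{\,p}N_G(y)^{p+1}-h^p$. 3. If $\overline\gamma_{12}=0$ and $\overline\gamma_{13}\neq0$, then $\{x,d,N_G(y),N_G(z)\}$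 is a SAGBI basis for $\mathbb F[V_M]^G$ and generates it, and there is a single relation among the generators, constructed by subducting $d^{p^2}-\overline\gamma_{13}^{\,p^2}N_G(y)^2$. Here subducting a polynomial $g$ over $b_1,\dots,b_4$ means repeatedly subtracting from the current nonzero polynomial a term $c\,b_1^{k_1}\cdots b_4^{k_4}$, $c\in\mathbb F$, with the same lead term, until $0$ is reached. If $T(t_1,\dots,t_4)$ is the displayed expression written in variables for the generators, and $S(t_1,\dots,t_4)$ is the sum of the subtracted terms $c\,t_1^{k_1}\cdots t_4^{k_4}$, then the assertion is: such a subduction of $T(b_1,\dots,b_4)$ to $0$ exists, and for every such subduction $T-S$ is nonzero and generates the kernel of $\mathbb F[t_1,\dots,t_4]\to\mathbb F[V_M]^G$, $t_i\mapsto b_i$. In particular $\mathbb F[V_M]^G$ is a hypersurface. -/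

import Mathlib

open MvPolynomial

namespace RankTwo

/-! ### Graded reverse lexicographic order on monomials in `x < y < z`

Throughout, the variables of `MvPolynomial (Fin 3) R` are `x = X 0`, `y = X 1`, `z = X 2`. -/

/-- Exponent vectors of monomials in `x, y, z`, to be ordered by graded reverse lexicographic
order. -/
def GrevLex : Type := Fin 3 →₀ ℕ

namespace GrevLex

noncomputable instance : AddCommMonoid GrevLex := inferInstanceAs (AddCommMonoid (Fin 3 →₀ ℕ))

/-- The exponent vector of a monomial. -/
noncomputable def exps : GrevLex ≃+ (Fin 3 →₀ ℕ) where
  toFun a := a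
  invFun a := a
  left_inv _ := rfl
  right_inv _ := rfl
  map_add' _ _ := rfl

/-- Compare total degrees first; in equal degree the monomial with the smaller exponent of `x` is
larger; if these agree as well, the one with the smaller exponent of `y` is larger. -/
noncomputable def key (a : GrevLex) : ℕ ×ₗ (ℕᵒᵈ ×ₗ ℕᵒᵈ) :=
  toLex (exps a 0 + exps a 1 + exps a 2,
    toLex (OrderDual.toDual (exps a 0), OrderDual.toDual (exps a 1)))

theorem key_injective : Function.Injective key := by
  intro a b h
  simp only [key, EmbeddingLike.apply_eq_iff_eq, Prod.mk.injEq] at h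
  obtain ⟨h1, h2, h3⟩ := h
  apply exps.injective
  ext i
  fin_cases i
  · exact h2
  · exact h3
  · change exps a 2 = exps b 2
    omega

noncomputable instance : LinearOrder GrevLex := LinearOrder.lift' key key_injective

theorem lt_iff (a b : GrevLex) : a < b ↔
    exps a 0 + exps a 1 + exps a 2 < exps b 0 + exps b 1 + exps b 2 ∨
      (exps a 0 + exps a 1 + exps a 2 = exps b 0 + exps b 1 + exps b 2 ∧
        (exps b 0 < exps a 0 ∨ (exps a 0 = exps b 0 ∧ exps b 1 < exps a 1))) := by
  change key a < key b ↔ _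
  simp [key, Prod.Lex.toLex_lt_toLex]

instance : IsOrderedAddMonoid GrevLex where
  add_le_add_left a b h c := by
    rcases h.eq_or_lt with h | h
    · rw [h]
    · refine le_of_lt ?_
      rw [lt_iff] at h ⊢
      simp only [map_add, Finsupp.add_apply] at h ⊢
      omega

instance : WellFoundedLT GrevLex where
  wf := by
    have hw : WellFounded (fun a b : ℕ ×ₗ (ℕ ×ₗ ℕ) => a < b) := wellFounded_lt
    refine Subrelation.wf ?_ (InvImage.wf (fun a : GrevLex =>
      (toLex (exps a 0 + exps a 1 + exps a 2, toLex (exps a 1 + exps a 2, exps a 2)) :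
        ℕ ×ₗ (ℕ ×ₗ ℕ))) hw)
    intro a b h
    rw [lt_iff] at h
    simp only [InvImage, Prod.Lex.toLex_lt_toLex]
    omega

end GrevLex

/-- The graded reverse lexicographic order with `x < y < z`. -/
noncomputable def grevlex : MonomialOrder (Fin 3) where
  syn := GrevLex
  toSyn := GrevLex.exps.symm
  toSyn_monotone a b h := by
    by_cases hab : a = b
    · rw [hab]
    · refine le_of_lt ((GrevLex.lt_iff _ _).2 (Or.inl ?_))
      simp only [AddEquiv.apply_symm_apply]
      have h0 := h 0
      have h1 := h 1
      have h2 := h 2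
      by_contra hc
      apply hab
      ext i
      fin_cases i
      · change a 0 = b 0
        omega
      · change a 1 = b 1
        omega
      · change a 2 = b 2
        omega

/-! ### SAGBI bases and subduction -/

section Sagbi

variable {F : Type*} [Field F]

/-- `B` is a SAGBI basis of the subalgebra `A`: it is a subset of `A` and its lead terms generate
the lead term algebra of `A`. -/
def IsSagbiBasis (B : Set (MvPolynomial (Fin 3) F)) (A : Subalgebra F (MvPolynomial (Fin 3) F)) :
    Prop :=
  B ⊆ (A : Set (MvPolynomial (Fin 3) F)) ∧
    Algebra.adjoin F (grevlex.leadingTerm '' B) =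
      Algebra.adjoin F (grevlex.leadingTerm '' (A : Set (MvPolynomial (Fin 3) F)))

/-- `SubductsToZero b g S`: the polynomial `g` subducts to zero over the family `b`, and `S`
records the terms subtracted. In each step the lead term of the current nonzero polynomial `g` is
cancelled by subtracting a scalar multiple `c • b ^ K` of a product of members of `b`. -/
inductive SubductsToZero {ι : Type} (b : ι → MvPolynomial (Fin 3) F) :
    MvPolynomial (Fin 3) F → MvPolynomial ι F → Prop
  | zero : SubductsToZero b 0 0
  | step (g : MvPolynomial (Fin 3) F) (S : MvPolynomial ι F) (K : ι →₀ ℕ) (c : F) (hg : g ≠ 0)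
      (hlead : grevlex.leadingTerm g = grevlex.leadingTerm (aeval b (monomial K c)))
      (hrest : SubductsToZero b (g - aeval b (monomial K c)) S) :
      SubductsToZero b g (monomial K c + S)

/-- `A` is a hypersurface on the SAGBI basis `b`, with a single relation, obtained by subducting
the difference `T (b)`. The subduction exists, and whichever subduction `S` of `T (b)` is chosen,
the nonzero relation `T - S` generates the ideal of all relations among the generators. -/
structure IsSagbiHypersurface (A : Subalgebra F (MvPolynomial (Fin 3) F))
    (b : Fin 4 → MvPolynomial (Fin 3) F) (T : MvPolynomial (Fin 4) F) : Prop where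
  sagbi : IsSagbiBasis (Set.range b) A
  generates : Algebra.adjoin F (Set.range b) = A
  subducts : ∃ S, SubductsToZero b (aeval b T) S
  relation : ∀ S, SubductsToZero b (aeval b T) S →
    T - S ≠ 0 ∧ RingHom.ker (aeval b : MvPolynomial (Fin 4) F →ₐ[F] MvPolynomial (Fin 3) F) =
      Ideal.span {T - S}

end Sagbi

/-! ### The representation `V_M` of `(ℤ/p)²` and its ring of invariants -/

section Representation

variable {F : Type*} [Field F]

/-- The homomorphism `σ : (F², +) → GL₃(F)`. -/
noncomputable def sigma : Multiplicative (F × F) →* GL (Fin 3) F :=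
  MonoidHom.toHomUnits
    { toFun := fun c =>
        !![1, 2 * c.toAdd.1, c.toAdd.1 ^ 2 + c.toAdd.2; 0, 1, c.toAdd.1; 0, 0, 1]
      map_one' := by
        ext i j
        fin_cases i <;> fin_cases j <;> simp
      map_mul' := by
        intro a b
        ext i j
        fin_cases i <;> fin_cases j <;> simp [Matrix.mul_apply, Fin.sum_univ_three] <;> ring }

theorem coe_sigma (c₁ c₂ : F) : (sigma (Multiplicative.ofAdd (c₁, c₂)) : Matrix (Fin 3) (Fin 3) F) =
    !![1, 2 * c₁, c₁ ^ 2 + c₂; 0, 1, c₁; 0, 0, 1] := rfl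

/-- The group `G = (ℤ/p)²`, written multiplicatively. -/
abbrev G (p : ℕ) : Type := Multiplicative (Fin 2 → ZMod p)

/-- The additive map `(ℤ/p)² → F²` sending `eⱼ` to the `j`-th column of `M`. -/
def columnMap (p : ℕ) [CharP F p] (M : Matrix (Fin 2) (Fin 2) F) : (Fin 2 → ZMod p) →+ F × F where
  toFun g := (∑ j, ZMod.castHom dvd_rfl F (g j) * M 0 j, ∑ j, ZMod.castHom dvd_rfl F (g j) * M 1 j)
  map_zero' := by simp
  map_add' g h := by
    simp only [Pi.add_apply, map_add, add_mul, Finset.sum_add_distrib, Prod.mk_add_mk]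

/-- The representation `V_M` of `G = (ℤ/p)² = ⟨e₁, e₂⟩`, given by `eⱼ ↦ σ(c₁ⱼ, c₂ⱼ)`. -/
noncomputable def rep (p : ℕ) [CharP F p] (M : Matrix (Fin 2) (Fin 2) F) : G p →* GL (Fin 3) F :=
  sigma.comp (AddMonoidHom.toMultiplicative (columnMap p M))

theorem rep_single (p : ℕ) [CharP F p] (M : Matrix (Fin 2) (Fin 2) F) (j : Fin 2) :
    rep p M (Multiplicative.ofAdd (Pi.single j 1)) =
      sigma (Multiplicative.ofAdd (M 0 j, M 1 j)) := by
  have h : columnMap p M (Pi.single j 1) = (M 0 j, M 1 j) := by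
    fin_cases j <;> simp [columnMap]
  change sigma (Multiplicative.ofAdd (columnMap p M (Pi.single j 1))) = _
  rw [h]

/-- A row vector `v`, an element of the dual of the space of column vectors, as a linear form:
`[0 0 1] = x`, `[0 1 0] = y`, `[1 0 0] = z`. -/
noncomputable def linForm (v : Fin 3 → F) : MvPolynomial (Fin 3) F :=
  ∑ j, C (v j) * X (Fin.rev j)

/-- The right action `f ↦ f · A` of a matrix on polynomials by algebra endomorphisms, which extends
the action on row vectors by right multiplication: a variable, read as a unit row vector, goes
to the corresponding row of `A`. -/
noncomputable def act (A : GL (Fin 3) F) : MvPolynomial (Fin 3) F →ₐ[F] MvPolynomial (Fin 3) F :=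
  aeval fun i => linForm ((A : Matrix (Fin 3) (Fin 3) F) (Fin.rev i))

theorem act_sigma_x (c₁ c₂ : F) : act (sigma (Multiplicative.ofAdd (c₁, c₂))) (X 0) = X 0 := by
  simp [act, linForm, coe_sigma, Fin.sum_univ_three, show Fin.rev (0 : Fin 3) = 2 from rfl,
    show Fin.rev (2 : Fin 3) = 0 from rfl]

theorem act_sigma_y (c₁ c₂ : F) :
    act (sigma (Multiplicative.ofAdd (c₁, c₂))) (X 1) = X 1 + C c₁ * X 0 := by
  simp [act, linForm, coe_sigma, Fin.sum_univ_three, show Fin.rev (1 : Fin 3) = 1 from rfl,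
    show Fin.rev (2 : Fin 3) = 0 from rfl]

theorem act_sigma_z (c₁ c₂ : F) : act (sigma (Multiplicative.ofAdd (c₁, c₂))) (X 2) =
    X 2 + C (2 * c₁) * X 1 + C (c₁ ^ 2 + c₂) * X 0 := by
  simp [act, linForm, coe_sigma, Fin.sum_univ_three, show Fin.rev (0 : Fin 3) = 2 from rfl,
    show Fin.rev (1 : Fin 3) = 1 from rfl, show Fin.rev (2 : Fin 3) = 0 from rfl]

/-- The ring of invariants `F[V_M]^G`. -/
noncomputable def invariants (p : ℕ) [CharP F p] (M : Matrix (Fin 2) (Fin 2) F) :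
    Subalgebra F (MvPolynomial (Fin 3) F) where
  carrier := {f | ∀ g : G p, act (rep p M g) f = f}
  mul_mem' ha hb g := by rw [map_mul, ha g, hb g]
  add_mem' ha hb g := by rw [map_add, ha g, hb g]
  algebraMap_mem' r g := AlgHom.commutes _ r

open Classical in
/-- `N_G(f)`, the product of the elements of the `G`-orbit of `f`. -/
noncomputable def orbitProd (p : ℕ) [Fact p.Prime] [CharP F p] (M : Matrix (Fin 2) (Fin 2) F)
    (f : MvPolynomial (Fin 3) F) : MvPolynomial (Fin 3) F :=
  ∏ h ∈ Finset.univ.image (fun g : G p => act (rep p M g) f), h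

end Representation

/-! ### The generic invariants `f₁`, `f₂` -/

section Generic

variable (p : ℕ) [Fact p.Prime]

/-- `𝔽_p[x₁₁, x₁₂, x₂₁, x₂₂]`. -/
abbrev Coeff : Type := MvPolynomial (Fin 2 × Fin 2) (ZMod p)

/-- `𝔽_p[xᵢⱼ][x, y, z]`. -/
abbrev GenPoly : Type := MvPolynomial (Fin 3) (Coeff p)

/-- The field of fractions of `𝔽_p[xᵢⱼ][x, y, z]`. -/
abbrev GenFrac : Type := FractionRing (GenPoly p)

/-- The matrix `Γ`, with rows `i = 1, …, 6` and columns `j = 0, 1`. Its rows are, in this order,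
those of the generic `2 × 2` matrix `(xᵢⱼ)`, their entrywise `p`-th powers, and their entrywise
`p²`-th powers. -/
noncomputable def Gam (i : ℕ) (j : Fin 2) : Coeff p :=
  X (if Odd i then 0 else 1, j) ^ p ^ ((i - 1) / 2)

/-- The minor `γᵢⱼ` of `Γ` on rows `i, j` (numbered from `1`). -/
noncomputable def gamma (i j : ℕ) : Coeff p :=
  Matrix.det !![Gam p i 0, Gam p i 1; Gam p j 0, Gam p j 1]

/-- `δ = y² - xz`. -/
noncomputable def delta (R : Type*) [CommRing R] : MvPolynomial (Fin 3) R :=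
  X 1 ^ 2 - X 0 * X 2

/-- The column `v = [y/x, -δ/x², (y/x)^p, (-δ/x²)^p, …]`, rows numbered from `1`. -/
noncomputable def vCol (i : ℕ) : GenFrac p :=
  (if Odd i then algebraMap (GenPoly p) (GenFrac p) (X 1) / algebraMap (GenPoly p) (GenFrac p) (X 0)
    else -algebraMap (GenPoly p) (GenFrac p) (delta (Coeff p)) /
      algebraMap (GenPoly p) (GenFrac p) (X 0) ^ 2) ^ p ^ ((i - 1) / 2)

/-- The entries of `Γ` as elements of the field of fractions. -/
noncomputable def GamFrac (i : ℕ) (j : Fin 2) : GenFrac p :=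
  algebraMap (GenPoly p) (GenFrac p) (C (Gam p i j))

/-- The minor `f̃ᵢⱼₖ` on rows `i, j, k` of `Γ` augmented by the column `v`. -/
noncomputable def fTilde (i j k : ℕ) : GenFrac p :=
  Matrix.det !![GamFrac p i 0, GamFrac p i 1, vCol p i;
    GamFrac p j 0, GamFrac p j 1, vCol p j;
    GamFrac p k 0, GamFrac p k 1, vCol p k]

/-- Minimally clearing the denominator of an element `g` of `𝔽_p[xᵢⱼ][x, y, z][x⁻¹]`: the polynomial
`x ^ m * g` with the least possible `m`. -/
noncomputable def clearX (g : GenFrac p) : GenPoly p :=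
  Function.invFun (algebraMap (GenPoly p) (GenFrac p))
    (algebraMap (GenPoly p) (GenFrac p) (X 0) ^
      sInf {m : ℕ | ∃ f, algebraMap (GenPoly p) (GenFrac p) f =
        algebraMap (GenPoly p) (GenFrac p) (X 0) ^ m * g} * g)

/-- `f₁ = f₁₂₃`. -/
noncomputable def f1 : GenPoly p := clearX p (fTilde p 1 2 3)

/-- `f₁₂₄`. -/
noncomputable def f124 : GenPoly p := clearX p (fTilde p 1 2 4)

/-- `f₂ = (γ₁₂ f₁₂₄ + f₁²) / (2 x^(p-2))`. The division is exact for `p > 2`, see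
`two_mul_f2`. -/
noncomputable def f2 : GenPoly p :=
  C (C (2⁻¹ : ZMod p)) *
    divMonomial (C (gamma p 1 2) * f124 p + f1 p ^ 2) (Finsupp.single 0 (p - 2))

theorem clearX_eq {g : GenFrac p} {P : GenPoly p} (m : ℕ)
    (h : algebraMap (GenPoly p) (GenFrac p) P = algebraMap (GenPoly p) (GenFrac p) (X 0) ^ m * g)
    (hP : ¬ (X 0 ∣ P)) : clearX p g = P := by
  have hinj : Function.Injective (algebraMap (GenPoly p) (GenFrac p)) :=
    IsFractionRing.injective _ _
  have hm : sInf {m : ℕ | ∃ f, algebraMap (GenPoly p) (GenFrac p) f =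
        algebraMap (GenPoly p) (GenFrac p) (X 0) ^ m * g} = m := by
    refine le_antisymm (Nat.sInf_le ⟨P, h⟩) ?_
    refine le_csInf ⟨m, P, h⟩ ?_
    rintro k ⟨f, hf⟩
    by_contra! hk
    apply hP
    obtain ⟨d, rfl⟩ : ∃ d, m = k + (d + 1) := ⟨m - k - 1, by omega⟩
    refine ⟨X 0 ^ d * f, hinj ?_⟩
    rw [h, map_mul, map_mul, hf, map_pow]
    ring
  rw [clearX, hm, ← h]
  exact Function.leftInverse_invFun hinj P

theorem gamma12_eq : gamma p 1 2 = X (0, 0) * X (1, 1) - X (0, 1) * X (1, 0) := by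
  simp [gamma, Gam, Matrix.det_fin_two, show ¬ Odd 2 from by decide]

theorem gamma12_ne_zero : gamma p 1 2 ≠ 0 := by
  intro h
  have := congrArg (eval (fun ij : Fin 2 × Fin 2 => if ij.1 = ij.2 then (1 : ZMod p) else 0)) h
  simp [gamma12_eq] at this

theorem f1_eq (hp : 2 < p) : f1 p = C (gamma p 1 2) * X 1 ^ p +
    C (gamma p 1 3) * delta _ * X 0 ^ (p - 2) + C (gamma p 2 3) * X 1 * X 0 ^ (p - 1) := by
  have hx : algebraMap (GenPoly p) (GenFrac p) (X 0) ≠ 0 := by simp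
  refine clearX_eq p p ?_ ?_
  · have e1 : p - 1 = (p - 2) + 1 := by omega
    have e3 : algebraMap (GenPoly p) (GenFrac p) (X 0) ^ p =
        algebraMap (GenPoly p) (GenFrac p) (X 0) ^ (p - 2) *
          algebraMap (GenPoly p) (GenFrac p) (X 0) ^ 2 := by
      rw [← pow_add]
      congr 1
      omega
    simp only [fTilde, Matrix.det_fin_three, gamma, Matrix.det_fin_two, GamFrac, vCol, map_add,
      map_mul, map_sub, map_pow, Matrix.of_apply, Matrix.cons_val', Matrix.cons_val_zero,
      Matrix.cons_val_one, Matrix.cons_val, Matrix.empty_val', Matrix.cons_val_fin_one]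
    simp only [show Odd 1 from by decide, show ¬ Odd 2 from by decide, show Odd 3 from by decide,
      if_true, if_false, show (1 - 1) / 2 = 0 from rfl,
      show (3 - 1) / 2 = 1 from rfl, pow_zero, pow_one, div_pow, e1, e3]
    generalize algebraMap (GenPoly p) (GenFrac p) (X 1) ^ p = Y
    generalize p - 2 = n
    field_simp
    ring
  · rintro ⟨Q, hQ⟩
    have h := congrArg (eval (![0, 1, 0] : Fin 3 → Coeff p)) hQ
    have h1 : p - 2 ≠ 0 := by omega
    have h2 : p - 1 ≠ 0 := by omega
    simp [h1, h2] at h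
    exact gamma12_ne_zero p h

theorem f124_eq (hp : 2 < p) : f124 p = -C (gamma p 1 2) * delta _ ^ p +
    C (gamma p 1 4) * delta _ * X 0 ^ (2 * p - 2) +
    C (gamma p 2 4) * X 1 * X 0 ^ (2 * p - 1) := by
  have hx : algebraMap (GenPoly p) (GenFrac p) (X 0) ≠ 0 := by simp
  have hodd : Odd p := (Fact.out : p.Prime).odd_of_ne_two (by omega)
  refine clearX_eq p (2 * p) ?_ ?_
  · have e3 : 2 * p = (2 * p - 2) + 2 := by omega
    have e1 : 2 * p - 1 = (2 * p - 2) + 1 := by omega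
    simp only [fTilde, Matrix.det_fin_three, gamma, Matrix.det_fin_two, GamFrac, vCol, map_add,
      map_mul, map_sub, map_neg, map_pow, Matrix.of_apply, Matrix.cons_val', Matrix.cons_val_zero,
      Matrix.cons_val_one, Matrix.cons_val, Matrix.empty_val', Matrix.cons_val_fin_one]
    simp only [show Odd 1 from by decide, show ¬ Odd 2 from by decide, show ¬ Odd 4 from by decide,
      if_true, if_false, show (1 - 1) / 2 = 0 from rfl,
      show (4 - 1) / 2 = 1 from rfl, pow_zero, pow_one, div_pow, hodd.neg_pow, ← pow_mul]
    generalize algebraMap (GenPoly p) (GenFrac p) (delta (Coeff p)) ^ p = D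
    rw [e1, e3]
    simp only [Nat.add_sub_cancel]
    generalize 2 * p - 2 = n
    field_simp
    ring
  · rintro ⟨Q, hQ⟩
    have h := congrArg (eval (![0, 1, 0] : Fin 3 → Coeff p)) hQ
    have h1 : 2 * p - 2 ≠ 0 := by omega
    have h2 : 2 * p - 1 ≠ 0 := by omega
    simp [h1, h2, delta] at h
    exact gamma12_ne_zero p h

theorem C_half_two (hp : 2 < p) : (C (C (2⁻¹ : ZMod p)) : GenPoly p) * 2 = 1 := by
  have h2 : (2 : ZMod p) ≠ 0 := by
    intro h
    have h' : ((2 : ℕ) : ZMod p) = 0 := by exact_mod_cast h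
    rw [ZMod.natCast_eq_zero_iff] at h'
    exact absurd (Nat.le_of_dvd (by norm_num) h') (by omega)
  have h : (2 : GenPoly p) = C (C (2 : ZMod p)) := by
    rw [map_ofNat, map_ofNat]
  rw [h, ← map_mul, ← map_mul, inv_mul_cancel₀ h2, map_one, map_one]

theorem f2_eq (hp : 2 < p) : f2 p = C (gamma p 1 2 * gamma p 1 3) * delta _ * X 1 ^ p +
    C (gamma p 1 2 * gamma p 2 3) * X 0 * X 1 ^ (p + 1) +
    C (C (2⁻¹ : ZMod p)) * (C (gamma p 1 2 ^ 2) * X 0 ^ 2 * X 2 ^ p +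
      C (gamma p 1 3 ^ 2) * delta _ ^ 2 * X 0 ^ (p - 2) +
      2 * C (gamma p 1 3 * gamma p 2 3) * delta _ * X 1 * X 0 ^ (p - 1) +
      (C (gamma p 1 2 * gamma p 1 4) * delta _ + C (gamma p 2 3 ^ 2) * X 1 ^ 2) * X 0 ^ p +
      C (gamma p 1 2 * gamma p 2 4) * X 1 * X 0 ^ (p + 1)) := by
  have hhalf := C_half_two p hp
  have hd : delta (Coeff p) ^ p = X 1 ^ (2 * p) - X 0 ^ p * X 2 ^ p := by
    rw [delta, sub_pow_char, mul_pow, ← pow_mul]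
  have key : C (gamma p 1 2) * f124 p + f1 p ^ 2 = monomial (Finsupp.single 0 (p - 2)) 1 *
      (2 * (C (gamma p 1 2 * gamma p 1 3) * delta _ * X 1 ^ p +
        C (gamma p 1 2 * gamma p 2 3) * X 0 * X 1 ^ (p + 1)) +
      (C (gamma p 1 2 ^ 2) * X 0 ^ 2 * X 2 ^ p +
      C (gamma p 1 3 ^ 2) * delta _ ^ 2 * X 0 ^ (p - 2) +
      2 * C (gamma p 1 3 * gamma p 2 3) * delta _ * X 1 * X 0 ^ (p - 1) +
      (C (gamma p 1 2 * gamma p 1 4) * delta _ + C (gamma p 2 3 ^ 2) * X 1 ^ 2) * X 0 ^ p +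
      C (gamma p 1 2 * gamma p 2 4) * X 1 * X 0 ^ (p + 1))) := by
    rw [f1_eq p hp, f124_eq p hp, hd, ← X_pow_eq_monomial]
    simp only [map_mul, map_pow]
    generalize delta (Coeff p) = D
    obtain ⟨q, hq⟩ : ∃ q, p = q + 2 := ⟨p - 2, by omega⟩
    have e1 : p - 2 = q := by omega
    have e2 : p - 1 = q + 1 := by omega
    have e3 : 2 * p - 2 = q + q + 2 := by omega
    have e4 : 2 * p - 1 = q + q + 3 := by omega
    have e5 : (X 0 : GenPoly p) ^ p = X 0 ^ q * X 0 ^ 2 := by rw [← pow_add, ← hq]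
    rw [e1, e2, e3, e4, pow_succ (X 0 : GenPoly p) p, e5]
    ring
  rw [f2, key, divMonomial_monomial_mul]
  linear_combination (C (gamma p 1 2 * gamma p 1 3) * delta _ * X 1 ^ p +
        C (gamma p 1 2 * gamma p 2 3) * X 0 * X 1 ^ (p + 1)) * hhalf

/-- The division in the definition of `f₂` is exact. -/
theorem two_mul_f2 (hp : 2 < p) :
    2 * X 0 ^ (p - 2) * f2 p = C (gamma p 1 2) * f124 p + f1 p ^ 2 := by
  have hhalf := C_half_two p hp
  have hdvd : (monomial (Finsupp.single 0 (p - 2)) 1 : GenPoly p) ∣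
      C (gamma p 1 2) * f124 p + f1 p ^ 2 := by
    have hd : delta (Coeff p) ^ p = X 1 ^ (2 * p) - X 0 ^ p * X 2 ^ p := by
      rw [delta, sub_pow_char, mul_pow, ← pow_mul]
    rw [f1_eq p hp, f124_eq p hp, hd, ← X_pow_eq_monomial]
    obtain ⟨q, hq⟩ : ∃ q, p = q + 2 := ⟨p - 2, by omega⟩
    have e1 : p - 2 = q := by omega
    have e2 : p - 1 = q + 1 := by omega
    have e3 : 2 * p - 2 = q + q + 2 := by omega
    have e4 : 2 * p - 1 = q + q + 3 := by omega
    have e5 : (X 0 : GenPoly p) ^ p = X 0 ^ q * X 0 ^ 2 := by rw [← pow_add, ← hq]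
    rw [e1, e2, e3, e4, e5]
    refine ⟨C (gamma p 1 2) * (C (gamma p 1 2) * X 0 ^ 2 * X 2 ^ p +
      C (gamma p 1 4) * delta _ * X 0 ^ (q + 2) + C (gamma p 2 4) * X 1 * X 0 ^ (q + 3)) +
      2 * C (gamma p 1 2) * X 1 ^ p * (C (gamma p 1 3) * delta _ + C (gamma p 2 3) * X 1 * X 0) +
      X 0 ^ q * (C (gamma p 1 3) * delta _ + C (gamma p 2 3) * X 1 * X 0) ^ 2, ?_⟩
    ring
  obtain ⟨Q, hQ⟩ := hdvd
  rw [f2, hQ, divMonomial_monomial_mul, X_pow_eq_monomial]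
  linear_combination (monomial (Finsupp.single 0 (p - 2)) 1 * Q) * hhalf

end Generic

/-! ### Evaluation at a matrix `M` -/

section Evaluation

variable {F : Type*} [Field F] (p : ℕ) [Fact p.Prime] [CharP F p] (M : Matrix (Fin 2) (Fin 2) F)

/-- The evaluation map `ψ_M : 𝔽_p[xᵢⱼ] → F`, `xᵢⱼ ↦ cᵢⱼ`. -/
noncomputable def psi : Coeff p →+* F :=
  eval₂Hom (ZMod.castHom dvd_rfl F) fun ij => M ij.1 ij.2

/-- The value of `γᵢⱼ` at `M`. -/
noncomputable def gammaBar (i j : ℕ) : F := psi p M (gamma p i j)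

/-- `f̄₁`: apply `ψ_M` to the coefficients of `f₁`. -/
noncomputable def f1Bar : MvPolynomial (Fin 3) F := map (psi p M) (f1 p)

/-- `f̄₂`: apply `ψ_M` to the coefficients of `f₂`. -/
noncomputable def f2Bar : MvPolynomial (Fin 3) F := map (psi p M) (f2 p)

/-- `h = f̄₂ / (γ₁₂ x)`, used when `γ₁₃ = 0` and `γ₁₂ ≠ 0`; the division is then exact, see
`gammaBar_mul_hPoly`. -/
noncomputable def hPoly : MvPolynomial (Fin 3) F :=
  C (gammaBar p M 1 2)⁻¹ * divMonomial (f2Bar p M) (Finsupp.single 0 1)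

/-- `d = f̄₁ / x^(p-2)`, used when `γ₁₂ = 0`; the division is then exact, see `dPoly_eq`. -/
noncomputable def dPoly : MvPolynomial (Fin 3) F :=
  divMonomial (f1Bar p M) (Finsupp.single 0 (p - 2))

theorem map_delta {R S : Type*} [CommRing R] [CommRing S] (φ : R →+* S) :
    map φ (delta R) = delta S := by
  simp [delta]

theorem gammaBar_mul_hPoly (hp : 2 < p) (h13 : gammaBar p M 1 3 = 0)
    (h12 : gammaBar p M 1 2 ≠ 0) : C (gammaBar p M 1 2) * X 0 * hPoly p M = f2Bar p M := by
  have hdvd : (X 0 : MvPolynomial (Fin 3) F) ∣ f2Bar p M := by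
    have h13' : psi p M (gamma p 1 3) = 0 := h13
    have d1 : (X 0 : MvPolynomial (Fin 3) F) ∣ X 0 ^ p := dvd_pow_self _ (by omega)
    have d2 : (X 0 : MvPolynomial (Fin 3) F) ∣ X 0 ^ (p + 1) := dvd_pow_self _ (by omega)
    have d3 : (X 0 : MvPolynomial (Fin 3) F) ∣ X 0 ^ 2 := dvd_pow_self _ (by omega)
    rw [f2Bar, f2_eq p hp]
    simp only [map_add, map_mul, map_pow, map_C, map_X, map_delta, h13', map_zero, zero_mul,
      mul_zero, zero_add, add_zero, zero_pow, ne_eq, OfNat.ofNat_ne_zero, not_false_eq_true]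
    refine dvd_add (Dvd.dvd.mul_right (Dvd.intro_left _ rfl) _) (Dvd.dvd.mul_left ?_ _)
    exact dvd_add (dvd_add ((d3.mul_left _).mul_right _) (d1.mul_left _)) (d2.mul_left _)
  obtain ⟨Q, hQ⟩ := hdvd
  have hc : (C (gammaBar p M 1 2) * C (gammaBar p M 1 2)⁻¹ : MvPolynomial (Fin 3) F) = 1 := by
    rw [← map_mul, mul_inv_cancel₀ h12, map_one]
  rw [hPoly, hQ, X_mul_divMonomial]
  linear_combination X 0 * Q * hc

theorem dPoly_eq (hp : 2 < p) (h12 : gammaBar p M 1 2 = 0) :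
    dPoly p M = C (gammaBar p M 1 3) * delta F + C (gammaBar p M 2 3) * X 1 * X 0 := by
  have h12' : psi p M (gamma p 1 2) = 0 := h12
  have e2 : p - 1 = (p - 2) + 1 := by omega
  have h : f1Bar p M = monomial (Finsupp.single 0 (p - 2)) 1 *
      (C (gammaBar p M 1 3) * delta F + C (gammaBar p M 2 3) * X 1 * X 0) := by
    rw [f1Bar, f1_eq p hp, ← X_pow_eq_monomial, e2]
    simp only [map_add, map_mul, map_pow, map_C, map_X, map_delta, h12', gammaBar, map_zero]
    ring
  rw [dPoly, h, divMonomial_monomial_mul]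

end Evaluation

end RankTwo

open RankTwo

set_option linter.unusedSectionVars false

namespace RankTwo

/-! ### Lead monomials, reduced polynomials and subduction -/

section Core

variable {F : Type*} [Field F]

/-! In the three cases the generators `b 0, …, b 3` have lead monomials x, y^α, y^β, z^N with N =
p^2 and (α, β) = (p, p + 2), (p, p + 1), (2, p^2); since p is odd, α and β are coprime. So the lead
monomial of a product `b ^ K` determines K as long as K 2 < α. Call a polynomial in the generators
reduced if all its exponents satisfy K 2 < α. The lead terms of a reduced polynomial cannot cancel
after substituting `b`.

Suppose `b 2 ^ α` equals a reduced polynomial in the generators. Then every element of F[b] has a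
reduced expression, so its lead monomial is that of some `b ^ K`. Only `b 0 = x` contributes x to
lead monomials, so if x^k f lies in F[b], k can be subtracted from K 0 and the lead monomial of f is
of this form too. It therefore suffices that F[V]^G and F[b] agree after inverting x: subduction
then gives the SAGBI property and generation. In the subduction of T the two terms y^(αβ) cancel,
hence only reduced terms are subtracted, and T - S is a nonzero scalar times a polynomial monic of
degree α in the third generator. Division by it has reduced remainders, and no nonzero reduced
polynomial maps to 0, so T - S generates the kernel. This is `isSagbiHypersurface_of_relation`.

Inverting x amounts to setting x = 1 and homogenizing afterwards
(`isSagbiHypersurface_of_expansion`). There g moves y by c₁(g) and w = z - y^2 = -δ by c₂(g), where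
c₁ and c₂ are given by the rows of M. If γ₁₃ ≠ 0, then f₁ is linear in z, so (t, y) with t = f₁ are
coordinates; G fixes t and moves y by p^2 distinct translations. If γ₁₃ = 0 and γ₁₂ ≠ 0, a subgroup
of order p translates only w, and G moves y by p distinct translations. In both situations the
invariants come from one fact (`exists_eq_comp_of_translation_invariant`): over a domain,
polynomials invariant under n translations are polynomials in any invariant of degree n with unit
lead coefficient. Expanding N_G(z) in the other two generators, a degree count shows that it has
degree α in `b 2` with constant lead coefficient. Its homogenization, solved for `b 2 ^ α`, is the
relation needed above. -/

theorem grevlex_lt_iff (a b : Fin 3 →₀ ℕ) : grevlex.toSyn a < grevlex.toSyn b ↔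
    a 0 + a 1 + a 2 < b 0 + b 1 + b 2 ∨
      (a 0 + a 1 + a 2 = b 0 + b 1 + b 2 ∧ (b 0 < a 0 ∨ (a 0 = b 0 ∧ b 1 < a 1))) :=
  GrevLex.lt_iff _ _

/-- The exponent vector of the lead monomial of `b ^ K` if the lead monomials of `b` are
`x, y ^ α, y ^ β, z ^ N`. -/
noncomputable def weight (α β N : ℕ) (K : Fin 4 →₀ ℕ) : Fin 3 →₀ ℕ :=
  Finsupp.single 0 (K 0) + Finsupp.single 1 (α * K 1 + β * K 2) + Finsupp.single 2 (N * K 3)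

theorem weight_zero_apply (α β N : ℕ) (K : Fin 4 →₀ ℕ) : weight α β N K 0 = K 0 := by
  simp [weight]

theorem weight_one_apply (α β N : ℕ) (K : Fin 4 →₀ ℕ) :
    weight α β N K 1 = α * K 1 + β * K 2 := by
  simp [weight]

theorem weight_two_apply (α β N : ℕ) (K : Fin 4 →₀ ℕ) : weight α β N K 2 = N * K 3 := by
  simp [weight]

/-- Modulo α the equation reads β j ≡ β l, and β is invertible modulo α; the bounds on j and l turn
the congruence into equality. -/
theorem eq_of_weight_pair_eq {α β i j k l : ℕ} (hα : 0 < α) (hαβ : Nat.Coprime α β) (hj : j < α)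
    (hl : l < α) (h : α * i + β * j = α * k + β * l) : i = k ∧ j = l := by
  have hmod : β * j ≡ β * l [MOD α] := by
    have h1 : α * i + β * j ≡ α * k + β * l [MOD α] := by rw [h]
    simpa [Nat.ModEq, Nat.add_mod] using h1
  have hjl : j = l := (Nat.ModEq.cancel_left_of_coprime hαβ hmod).eq_of_lt_of_lt hj hl
  subst hjl
  exact ⟨Nat.eq_of_mul_eq_mul_left hα (by omega), rfl⟩

theorem weight_injOn {α β N : ℕ} (hα : 0 < α) (hN : 0 < N) (hαβ : Nat.Coprime α β) :
    Set.InjOn (weight α β N) {K | K 2 < α} := by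
  intro K hK L hL h
  have h0 := DFunLike.congr_fun h 0
  have h1 := DFunLike.congr_fun h 1
  have h2 := DFunLike.congr_fun h 2
  simp only [weight_zero_apply, weight_one_apply, weight_two_apply] at h0 h1 h2
  obtain ⟨h3, h4⟩ := eq_of_weight_pair_eq hα hαβ hK hL h1
  have h5 := Nat.eq_of_mul_eq_mul_left hN h2
  ext i
  fin_cases i <;> assumption

/-- The family `b` has lead monomials `x, y ^ α, y ^ β, z ^ N` with coprime `α`, `β`. -/
structure HasLeadExponents (b : Fin 4 → MvPolynomial (Fin 3) F) (α β N : ℕ) : Prop where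
  zero : b 0 = X 0
  one : grevlex.degree (b 1) = Finsupp.single 1 α
  two : grevlex.degree (b 2) = Finsupp.single 1 β
  three : grevlex.degree (b 3) = Finsupp.single 2 N
  ne_zero : ∀ i, b i ≠ 0
  pos : 0 < α
  pos' : 0 < N
  coprime : Nat.Coprime α β

variable {b : Fin 4 → MvPolynomial (Fin 3) F} {α β N : ℕ}

theorem aeval_monomial_fin_four (b : Fin 4 → MvPolynomial (Fin 3) F) (K : Fin 4 →₀ ℕ) (c : F) :
    aeval b (monomial K c) = C c * (b 0 ^ K 0 * b 1 ^ K 1 * b 2 ^ K 2 * b 3 ^ K 3) := by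
  rw [aeval_monomial, Finsupp.prod_fintype _ _ (by simp), Fin.prod_univ_four, algebraMap_eq]

namespace HasLeadExponents

theorem aeval_monomial_ne_zero (hb : HasLeadExponents b α β N) (K : Fin 4 →₀ ℕ) {c : F}
    (hc : c ≠ 0) : aeval b (monomial K c) ≠ 0 := by
  rw [aeval_monomial_fin_four]
  have := hb.ne_zero
  simp [hc, this]

theorem degree_aeval_monomial (hb : HasLeadExponents b α β N) (K : Fin 4 →₀ ℕ) {c : F}
    (hc : c ≠ 0) : grevlex.degree (aeval b (monomial K c)) = weight α β N K := by
  have h := hb.ne_zero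
  have hp : ∀ i, b i ^ K i ≠ 0 := fun i => pow_ne_zero _ (h i)
  rw [aeval_monomial_fin_four, MonomialOrder.degree_mul (by simpa using hc)
      (by simp [h]), MonomialOrder.degree_C, zero_add,
    MonomialOrder.degree_mul (by simp [h]) (hp 3), MonomialOrder.degree_mul (by simp [h]) (hp 2),
    MonomialOrder.degree_mul (hp 0) (hp 1)]
  simp only [MonomialOrder.degree_pow, hb.one, hb.two, hb.three, hb.zero, MonomialOrder.degree_X]
  ext i
  fin_cases i <;> simp [weight, mul_comm]

theorem degree_aeval_monomial_le (hb : HasLeadExponents b α β N) (K : Fin 4 →₀ ℕ) (c : F) :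
    grevlex.toSyn (grevlex.degree (aeval b (monomial K c))) ≤
      grevlex.toSyn (weight α β N K) := by
  by_cases hc : c = 0
  · simp only [hc, map_zero, MonomialOrder.degree_zero]
    exact bot_le
  · rw [hb.degree_aeval_monomial K hc]

/-- Distinct reduced exponents have distinct weights by `weight_injOn`. The term of largest weight
therefore cannot be cancelled. In particular `aeval b` is injective on reduced polynomials. -/
theorem degree_aeval (hb : HasLeadExponents b α β N) {q : MvPolynomial (Fin 4) F} (hq : q ≠ 0)
    (h : ∀ K ∈ q.support, K 2 < α) :
    aeval b q ≠ 0 ∧ ∃ K ∈ q.support, grevlex.degree (aeval b q) = weight α β N K := by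
  obtain ⟨K, hK, hmax⟩ := Finset.exists_max_image q.support
    (fun K => grevlex.toSyn (weight α β N K)) (support_nonempty.2 hq)
  have hsum : aeval b q = ∑ L ∈ q.support, aeval b (monomial L (coeff L q)) := by
    conv_lhs => rw [← support_sum_monomial_coeff q, map_sum]
  have hcoeff : coeff (weight α β N K) (aeval b q) ≠ 0 := by
    rw [hsum, coeff_sum, Finset.sum_eq_single K]
    · rw [← hb.degree_aeval_monomial K (mem_support_iff.1 hK)]
      exact MonomialOrder.coeff_degree_ne_zero_iff.2
        (hb.aeval_monomial_ne_zero K (mem_support_iff.1 hK))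
    · intro L hL hLK
      refine MonomialOrder.coeff_eq_zero_of_lt (m := grevlex) ?_
      rw [hb.degree_aeval_monomial L (mem_support_iff.1 hL)]
      refine lt_of_le_of_ne (hmax L hL) fun he => hLK ?_
      exact weight_injOn hb.pos hb.pos' hb.coprime (h L hL) (h K hK)
        (grevlex.toSyn.injective he)
    · exact fun hn => (hn hK).elim
  refine ⟨fun h0 => hcoeff (by rw [h0, coeff_zero]), K, hK, grevlex.toSyn.injective ?_⟩
  refine le_antisymm ?_ (MonomialOrder.le_degree (mem_support_iff.2 hcoeff))
  rw [hsum]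
  refine MonomialOrder.degree_sum_le.trans (Finset.sup_le fun L hL => ?_)
  exact (hb.degree_aeval_monomial_le L _).trans (hmax L hL)

end HasLeadExponents

/-- Division with remainder by a polynomial that is monic of degree `α` in the variable `X 2`. -/
theorem exists_reduced (α : ℕ) (r : MvPolynomial (Fin 4) F) (hr : ∀ K ∈ r.support, K 2 < α)
    (q : MvPolynomial (Fin 4) F) :
    ∃ s, (∀ K ∈ s.support, K 2 < α) ∧ (X 2 ^ α - r) ∣ q - s := by
  classical
  have hmon : ∀ n, ∀ K : Fin 4 →₀ ℕ, K 2 = n → ∀ c : F,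
      ∃ s, (∀ K ∈ s.support, K 2 < α) ∧ (X 2 ^ α - r) ∣ monomial K c - s := by
    intro n
    induction n using Nat.strong_induction_on with
    | _ n ih =>
    intro K hK c
    by_cases hn : K 2 < α
    · refine ⟨monomial K c, fun L hL => ?_, by simp⟩
      rw [Finset.mem_singleton.1 (support_monomial_subset hL)]
      exact hn
    -- Split off X 2 ^ α and replace it by r. Each term of r has exponent of X 2 below α, so the new
    -- terms have smaller exponent of X 2 and the induction applies.
    · obtain ⟨L, rfl⟩ : ∃ L, K = L + Finsupp.single 2 α :=
        ⟨K - Finsupp.single 2 α, by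
          ext i
          by_cases hi : i = 2
          · subst hi; simp; omega
          · simp [Ne.symm hi]⟩
      have hL : L 2 + α = n := by simpa using hK
      have key : ∀ J ∈ r.support, ∃ s, (∀ K ∈ s.support, K 2 < α) ∧
          (X 2 ^ α - r) ∣ monomial (L + J) (c * coeff J r) - s := by
        intro J hJ
        have := hr J hJ
        exact ih ((L + J) 2) (by simp; omega) _ rfl _
      choose! s hs1 hs2 using key
      refine ⟨∑ J ∈ r.support, s J, ?_, ?_⟩
      · intro J hJ
        obtain ⟨I, hI, hJI⟩ := Finset.mem_biUnion.1 (support_sum hJ)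
        exact hs1 I hI J hJI
      · have hsplit : monomial (L + Finsupp.single 2 α) c - ∑ J ∈ r.support, s J =
            monomial L c * (X 2 ^ α - r) +
              ∑ J ∈ r.support, (monomial (L + J) (c * coeff J r) - s J) := by
          have h1 : monomial L c * r = ∑ J ∈ r.support, monomial (L + J) (c * coeff J r) := by
            conv_lhs => rw [← support_sum_monomial_coeff r, Finset.mul_sum]
            simp [monomial_mul]
          rw [Finset.sum_sub_distrib, ← h1, X_pow_eq_monomial, mul_sub, monomial_mul, mul_one]
          ring
        rw [hsplit]
        exact dvd_add (dvd_mul_left _ _) (Finset.dvd_sum hs2)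
  choose s hs1 hs2 using fun K : Fin 4 →₀ ℕ => hmon (K 2) K rfl (coeff K q)
  refine ⟨∑ K ∈ q.support, s K, ?_, ?_⟩
  · intro J hJ
    obtain ⟨I, hI, hJI⟩ := Finset.mem_biUnion.1 (support_sum hJ)
    exact hs1 I J hJI
  · have : q - ∑ K ∈ q.support, s K = ∑ K ∈ q.support, (monomial K (coeff K q) - s K) := by
      rw [Finset.sum_sub_distrib, support_sum_monomial_coeff]
    rw [this]
    exact Finset.dvd_sum fun K _ => hs2 K

namespace SubductsToZero

theorem aeval_eq {ι : Type} {b : ι → MvPolynomial (Fin 3) F} {g : MvPolynomial (Fin 3) F}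
    {S : MvPolynomial ι F} (h : SubductsToZero b g S) : aeval b S = g := by
  induction h with
  | zero => simp
  | step g S K c hg hlead hrest ih => rw [map_add, ih]; ring

theorem degree_sub_lt {g q : MvPolynomial (Fin 3) F} (hgq : g - q ≠ 0)
    (h : grevlex.leadingTerm g = grevlex.leadingTerm q) :
    grevlex.toSyn (grevlex.degree (g - q)) < grevlex.toSyn (grevlex.degree g) := by
  rw [MonomialOrder.leadingTerm_eq_leadingTerm_iff] at h
  refine lt_of_le_of_ne ?_ fun he => ?_
  · refine MonomialOrder.degree_sub_le.trans ?_
    rw [h.2, sup_idem]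
  · have h1 := grevlex.toSyn.injective he
    have h2 : grevlex.leadingCoeff (g - q) ≠ 0 := MonomialOrder.leadingCoeff_ne_zero_iff.2 hgq
    apply h2
    rw [MonomialOrder.leadingCoeff, h1, coeff_sub]
    have h3 := h.1
    rw [MonomialOrder.leadingCoeff, MonomialOrder.leadingCoeff, ← h.2] at h3
    rw [h3, sub_self]

/-- Degrees drop strictly at each subduction step, so every subtracted term is bounded by the degree
of the initial polynomial. This later forces the subtracted terms to be reduced. -/
theorem weight_le (hb : HasLeadExponents b α β N) {g : MvPolynomial (Fin 3) F}
    {S : MvPolynomial (Fin 4) F} (h : SubductsToZero b g S) (K : Fin 4 →₀ ℕ)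
    (hK : K ∈ S.support) :
    g ≠ 0 ∧ grevlex.toSyn (weight α β N K) ≤ grevlex.toSyn (grevlex.degree g) := by
  classical
  induction h with
  | zero => simp at hK
  | step g S L c hg hlead hrest ih =>
    refine ⟨hg, ?_⟩
    have hc : c ≠ 0 := by
      rintro rfl
      rw [map_zero, map_zero, MonomialOrder.leadingTerm_zero,
        MonomialOrder.leadingTerm_eq_zero_iff] at hlead
      exact hg hlead
    rcases Finset.mem_union.1 (support_add hK) with h1 | h1
    · rw [Finset.mem_singleton.1 (support_monomial_subset h1)]
      rw [MonomialOrder.leadingTerm_eq_leadingTerm_iff, hb.degree_aeval_monomial L hc] at hlead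
      rw [hlead.2]
    · obtain ⟨h2, h3⟩ := ih h1
      exact h3.trans (degree_sub_lt h2 hlead).le

end SubductsToZero

/-- If the lead monomials of the elements of `A` are products of lead monomials of `b`, every
element of `A` subducts to zero. -/
theorem exists_subductsToZero {A : Subalgebra F (MvPolynomial (Fin 3) F)}
    (hb : HasLeadExponents b α β N) (hbA : ∀ i, b i ∈ A)
    (hA : ∀ f ∈ A, f ≠ 0 → ∃ K, grevlex.degree f = weight α β N K)
    (f : MvPolynomial (Fin 3) F) (hf : f ∈ A) : ∃ S, SubductsToZero b f S := by
  by_cases h0 : f = 0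
  · exact ⟨0, h0 ▸ SubductsToZero.zero⟩
  · obtain ⟨d, hd⟩ : ∃ d, d = grevlex.toSyn (grevlex.degree f) := ⟨_, rfl⟩
    induction d using WellFoundedLT.induction generalizing f with
    | _ d ih =>
    obtain ⟨K, hK⟩ := hA f hf h0
    set m := aeval b (monomial K (1 : F)) with hm
    have hmA : ∀ c : F, aeval b (monomial K c) ∈ A := by
      intro c
      rw [aeval_monomial_fin_four]
      exact A.mul_mem (A.algebraMap_mem c) (A.mul_mem (A.mul_mem (A.mul_mem
        (A.pow_mem (hbA 0) _) (A.pow_mem (hbA 1) _)) (A.pow_mem (hbA 2) _)) (A.pow_mem (hbA 3) _))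
    have hlm : grevlex.leadingCoeff m ≠ 0 :=
      MonomialOrder.leadingCoeff_ne_zero_iff.2 (hb.aeval_monomial_ne_zero K one_ne_zero)
    -- The scalar that makes the lead coefficients of f and c m agree.
    set c := grevlex.leadingCoeff f / grevlex.leadingCoeff m with hc
    have hc0 : c ≠ 0 := div_ne_zero (MonomialOrder.leadingCoeff_ne_zero_iff.2 h0) hlm
    have hcm : aeval b (monomial K c) = C c * m := by
      rw [hm, aeval_monomial_fin_four, aeval_monomial_fin_four, C_1, one_mul]
    have hlead : grevlex.leadingTerm f = grevlex.leadingTerm (aeval b (monomial K c)) := by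
      rw [MonomialOrder.leadingTerm_eq_leadingTerm_iff, hb.degree_aeval_monomial K hc0]
      refine ⟨?_, hK⟩
      have h1 := MonomialOrder.leadingTerm_mul (m := grevlex) (C c) m
      rw [← hcm, MonomialOrder.leadingTerm_C, MonomialOrder.leadingTerm, MonomialOrder.leadingTerm,
        C_mul_monomial] at h1
      have h2 := congrArg grevlex.leadingCoeff h1
      rw [MonomialOrder.leadingCoeff_monomial, MonomialOrder.leadingCoeff_monomial] at h2
      rw [h2, hc, div_mul_cancel₀ _ hlm]
    by_cases hg : f - aeval b (monomial K c) = 0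
    · exact ⟨_, SubductsToZero.step f 0 K c h0 hlead (hg ▸ SubductsToZero.zero)⟩
    · obtain ⟨S, hS⟩ := ih _ (hd ▸ SubductsToZero.degree_sub_lt hg hlead) _
        (A.sub_mem hf (hmA c)) hg rfl
      exact ⟨_, SubductsToZero.step f S K c h0 hlead hS⟩

/-- Rewriting x^k f in reduced form exhibits its lead monomial as the weight of some K. The other
lead monomials do not involve x, so K 0 is the full exponent of x and is at least k. -/
theorem degree_eq_weight_of_pow_mul_mem (hb : HasLeadExponents b α β N)
    {r : MvPolynomial (Fin 4) F} (hr : ∀ K ∈ r.support, K 2 < α) (hrel : b 2 ^ α = aeval b r)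
    {f : MvPolynomial (Fin 3) F} (h0 : f ≠ 0) {k : ℕ}
    (hf : X 0 ^ k * f ∈ Algebra.adjoin F (Set.range b)) :
    ∃ K, grevlex.degree f = weight α β N K := by
  rw [Algebra.adjoin_range_eq_range_aeval] at hf
  obtain ⟨q, hq⟩ := hf
  obtain ⟨s, hs, t, ht⟩ := exists_reduced α r hr q
  have hqs : aeval b s = X 0 ^ k * f := by
    have h1 := congrArg (aeval b) ht
    rw [map_sub, map_mul, map_sub, map_pow, aeval_X, hrel, sub_self, zero_mul, sub_eq_zero] at h1
    rw [← h1]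
    exact hq
  have hX : (X 0 : MvPolynomial (Fin 3) F) ^ k ≠ 0 := pow_ne_zero _ (X_ne_zero 0)
  have hs0 : s ≠ 0 := by
    rintro rfl
    rw [map_zero] at hqs
    exact mul_ne_zero hX h0 hqs.symm
  obtain ⟨-, K, -, hK⟩ := hb.degree_aeval hs0 hs
  rw [hqs, MonomialOrder.degree_mul hX h0, MonomialOrder.degree_pow, MonomialOrder.degree_X] at hK
  have e0 := DFunLike.congr_fun hK 0
  have e1 := DFunLike.congr_fun hK 1
  have e2 := DFunLike.congr_fun hK 2
  simp only [weight_zero_apply, weight_one_apply, weight_two_apply, Finsupp.add_apply,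
    Finsupp.smul_apply, Finsupp.single_apply] at e0 e1 e2
  refine ⟨K - Finsupp.single 0 k, ?_⟩
  ext i
  fin_cases i
  · simp [weight_zero_apply] at e0 ⊢
    omega
  · simpa [weight_one_apply] using e1
  · simpa [weight_two_apply] using e2

/-- A criterion for `b` to be a SAGBI basis and to generate a hypersurface: lead monomials
`x, y ^ α, y ^ β, z ^ N`, a relation that is monic of degree `α` in `b 2`, and equality with the
algebra generated by `b` after inverting `x`. -/
theorem isSagbiHypersurface_of_relation {A : Subalgebra F (MvPolynomial (Fin 3) F)}
    (hb : HasLeadExponents b α β N) (hbA : ∀ i, b i ∈ A)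
    {r : MvPolynomial (Fin 4) F} (hr : ∀ K ∈ r.support, K 2 < α) (hrel : b 2 ^ α = aeval b r)
    (hA : ∀ f ∈ A, ∃ k, X 0 ^ k * f ∈ Algebra.adjoin F (Set.range b)) {c d : F} (hd : d ≠ 0)
    (hcd : c * grevlex.leadingCoeff (b 1) ^ β = d * grevlex.leadingCoeff (b 2) ^ α) :
    IsSagbiHypersurface A b (C c * X 1 ^ β - C d * X 2 ^ α) := by
  classical
  have hdeg : ∀ f ∈ A, f ≠ 0 → ∃ K, grevlex.degree f = weight α β N K := fun f hf h0 =>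
    let ⟨_, hk⟩ := hA f hf
    degree_eq_weight_of_pow_mul_mem hb hr hrel h0 hk
  have hsub := exists_subductsToZero hb hbA hdeg
  have hadj : Algebra.adjoin F (Set.range b) ≤ A :=
    Algebra.adjoin_le (by rintro _ ⟨i, rfl⟩; exact hbA i)
  have hmem : ∀ S, aeval b S ∈ Algebra.adjoin F (Set.range b) := fun S => by
    rw [Algebra.adjoin_range_eq_range_aeval]
    exact ⟨S, rfl⟩
  refine ⟨⟨by rintro _ ⟨i, rfl⟩; exact hbA i, le_antisymm ?_ ?_⟩, le_antisymm hadj ?_,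
    hsub _ (hadj (hmem _)), ?_⟩
  · exact Algebra.adjoin_mono (Set.image_mono (by rintro _ ⟨i, rfl⟩; exact hbA i))
  · refine Algebra.adjoin_le ?_
    rintro _ ⟨f, hf, rfl⟩
    by_cases h0 : f = 0
    · rw [h0, MonomialOrder.leadingTerm_zero]
      exact Subalgebra.zero_mem _
    obtain ⟨K, hK⟩ := hdeg f hf h0
    set L := Algebra.adjoin F (grevlex.leadingTerm '' Set.range b)
    have hi : ∀ i, grevlex.leadingTerm (b i) ∈ L := fun i =>
      Algebra.subset_adjoin ⟨b i, ⟨i, rfl⟩, rfl⟩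
    have hprod : grevlex.leadingTerm (aeval b (monomial K (1 : F))) ∈ L := by
      have hpow : ∀ (g : MvPolynomial (Fin 3) F) (n : ℕ), grevlex.leadingTerm g ∈ L →
          grevlex.leadingTerm (g ^ n) ∈ L := by
        intro g n hg
        induction n with
        | zero =>
          rw [pow_zero, ← C_1, MonomialOrder.leadingTerm_C]
          exact L.algebraMap_mem 1
        | succ n ih =>
          rw [pow_succ, MonomialOrder.leadingTerm_mul]
          exact L.mul_mem ih hg
      rw [aeval_monomial_fin_four]
      simp only [MonomialOrder.leadingTerm_mul]
      rw [MonomialOrder.leadingTerm_C]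
      exact L.mul_mem (L.algebraMap_mem 1) (L.mul_mem (L.mul_mem (L.mul_mem
        (hpow _ _ (hi 0)) (hpow _ _ (hi 1))) (hpow _ _ (hi 2))) (hpow _ _ (hi 3)))
    rw [MonomialOrder.leadingTerm, hb.degree_aeval_monomial K one_ne_zero, ← hK] at hprod
    have hl : grevlex.leadingCoeff (aeval b (monomial K (1 : F))) ≠ 0 :=
      MonomialOrder.leadingCoeff_ne_zero_iff.2 (hb.aeval_monomial_ne_zero K one_ne_zero)
    have := L.smul_mem hprod
      (grevlex.leadingCoeff f / grevlex.leadingCoeff (aeval b (monomial K (1 : F))))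
    rwa [smul_monomial, smul_eq_mul, div_mul_cancel₀ _ hl] at this
  · intro f hf
    obtain ⟨S, hS⟩ := hsub f hf
    rw [← hS.aeval_eq]
    exact hmem S
  · intro S hS
    have hW1 : weight α β N (Finsupp.single 1 β) = Finsupp.single 1 (α * β) := by
      simp [weight]
    have hW2 : weight α β N (Finsupp.single 2 α) = Finsupp.single 1 (α * β) := by
      simp [weight, mul_comm]
    have hd1 : grevlex.degree (b 1 ^ β) = Finsupp.single 1 (α * β) := by
      rw [MonomialOrder.degree_pow, hb.one]
      simp [mul_comm]
    have hd2 : grevlex.degree (b 2 ^ α) = Finsupp.single 1 (α * β) := by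
      rw [MonomialOrder.degree_pow, hb.two]
      simp
    set T : MvPolynomial (Fin 4) F := C c * X 1 ^ β - C d * X 2 ^ α with hT
    have hTb : aeval b T = c • b 1 ^ β - d • b 2 ^ α := by
      simp [hT, algebraMap_eq, smul_eq_C_mul]
    -- The condition on c and d says exactly that the two contributions to y^(αβ) cancel, so the
    -- subduction starts strictly below that monomial.
    have hcoeff : coeff (Finsupp.single 1 (α * β)) (aeval b T) = 0 := by
      have h1 : coeff (Finsupp.single 1 (α * β)) (b 1 ^ β) = grevlex.leadingCoeff (b 1) ^ β := by
        rw [← hd1, ← MonomialOrder.leadingCoeff_pow, MonomialOrder.leadingCoeff]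
      have h2 : coeff (Finsupp.single 1 (α * β)) (b 2 ^ α) = grevlex.leadingCoeff (b 2) ^ α := by
        rw [← hd2, ← MonomialOrder.leadingCoeff_pow, MonomialOrder.leadingCoeff]
      rw [hTb, coeff_sub, coeff_smul, coeff_smul, h1, h2, smul_eq_mul, smul_eq_mul, hcd, sub_self]
    have hTlt : aeval b T ≠ 0 → grevlex.toSyn (grevlex.degree (aeval b T)) <
        grevlex.toSyn (Finsupp.single 1 (α * β)) := by
      intro hne
      refine lt_of_le_of_ne ?_ fun he => ?_
      · rw [hTb]
        refine MonomialOrder.degree_sub_le.trans (sup_le ?_ ?_)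
        · exact MonomialOrder.degree_smul_le.trans_eq (by rw [hd1])
        · exact MonomialOrder.degree_smul_le.trans_eq (by rw [hd2])
      · apply MonomialOrder.coeff_degree_ne_zero_iff.2 hne
        rw [grevlex.toSyn.injective he, hcoeff]
    -- If K 2 ≥ α, the weight of K is divisible by y^(αβ), which exceeds the degree of T(b).
    have hSlt : ∀ K ∈ S.support, K 2 < α := by
      intro K hK
      obtain ⟨h1, h2⟩ := hS.weight_le hb K hK
      have h3 := h2.trans_lt (hTlt h1)
      by_contra! hle
      refine absurd h3 (not_lt.2 ?_)
      rw [← hW2]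
      refine grevlex.toSyn_monotone ?_
      intro i
      fin_cases i
      · simp [weight]
      · have := Nat.mul_le_mul_left β hle
        simp [weight]
        omega
      · simp [weight]
    -- Solving T - S = 0 for X 2 ^ α. The relation r of the hypothesis was needed only to find lead
    -- monomials; each subduction S yields its own reduced r'.
    set r' : MvPolynomial (Fin 4) F := C (d⁻¹ * c) * X 1 ^ β - C d⁻¹ * S with hr'
    have hTS : T - S = C (-d) * (X 2 ^ α - r') := by
      have hdd : (C d * C d⁻¹ : MvPolynomial (Fin 4) F) = 1 := by
        rw [← C_mul, mul_inv_cancel₀ hd, C_1]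
      rw [hT, hr', C_mul, C_neg]
      linear_combination (-(C c * X 1 ^ β) + S) * hdd
    have hr'lt : ∀ K ∈ r'.support, K 2 < α := by
      intro K hK
      rcases Finset.mem_union.1 (support_sub _ _ _ hK) with h1 | h1
      · rw [X_pow_eq_monomial, C_mul_monomial] at h1
        rw [Finset.mem_singleton.1 (support_monomial_subset h1)]
        simpa using hb.pos
      · refine hSlt K ?_
        rw [mem_support_iff, coeff_C_mul] at h1
        exact mem_support_iff.2 (right_ne_zero_of_mul h1)
    have hCd : IsUnit (C (-d) : MvPolynomial (Fin 4) F) := (neg_ne_zero.2 hd).isUnit.map C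
    have hker : aeval b (T - S) = 0 := by rw [map_sub, hS.aeval_eq, sub_self]
    constructor
    · rw [hTS]
      refine mul_ne_zero hCd.ne_zero fun h0 => ?_
      have h1 : Finsupp.single 2 α ∈ r'.support := by
        rw [← sub_eq_zero.1 h0, X_pow_eq_monomial, mem_support_iff]
        simp
      simpa using hr'lt _ h1
    · refine le_antisymm (fun q hq => ?_) ?_
      · obtain ⟨s, hs, hdvd⟩ := exists_reduced α r' hr'lt q
        have hqs : T - S ∣ q - s := by
          rw [hTS]
          exact hCd.mul_left_dvd.2 hdvd
        -- The remainder is a reduced polynomial in the kernel, so it vanishes by `degree_aeval`.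
        have hs0 : s = 0 := by
          by_contra hs0
          refine (hb.degree_aeval hs0 hs).1 ?_
          obtain ⟨t, ht⟩ := hqs
          have h1 := congrArg (aeval b) ht
          rw [map_mul, hker, zero_mul, map_sub, (RingHom.mem_ker).1 hq, zero_sub, neg_eq_zero] at h1
          exact h1
        rw [Ideal.mem_span_singleton]
        simpa [hs0] using hqs
      · rw [Ideal.span_singleton_le_iff_mem, RingHom.mem_ker]
        exact hker

end Core

/-! ### From expansions at x = 1 to homogeneous relations -/

section Homogenization

variable {F : Type*} [Field F]

/-- Of the monomials of degree m, only y^m survives at the point (0, 1, 0). The evaluation thus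
detects lead monomials that are powers of y. -/
theorem eval_zero_one_zero {f : MvPolynomial (Fin 3) F} {m : ℕ} (hf : f.IsHomogeneous m) :
    eval (![0, 1, 0] : Fin 3 → F) f = coeff (Finsupp.single 1 m) f := by
  rw [eval_eq', Finset.sum_eq_single (Finsupp.single 1 m)]
  · simp [Fin.prod_univ_three]
  · intro d hd hne
    have hdeg := hf.degree_eq_sum_deg_support hd
    rw [← Finsupp.degree_apply, Finsupp.degree_eq_sum, Fin.sum_univ_three] at hdeg
    have : d 0 ≠ 0 ∨ d 2 ≠ 0 := by
      by_contra! h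
      apply hne
      ext i
      fin_cases i
      · simpa using h.1
      · simp
        omega
      · simpa using h.2
    rcases this with h | h <;> simp [Fin.prod_univ_three, h]
  · intro h
    rw [notMem_support_iff.1 h, zero_mul]

/-- Clearing denominators in an expansion in `b₁ / x ^ α` and `b₂ / x ^ β`. -/
theorem pow_mul_eq_sum {f b₁ b₂ : MvPolynomial (Fin 3) F} {m M α β : ℕ} {s : Finset (ℕ × ℕ)}
    {a : ℕ × ℕ → F} {K : Type*} [Field K] [Algebra (MvPolynomial (Fin 3) F) K]
    [IsFractionRing (MvPolynomial (Fin 3) F) K]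
    (h : algebraMap (MvPolynomial (Fin 3) F) K f = algebraMap (MvPolynomial (Fin 3) F) K (X 0) ^ m *
      ∑ e ∈ s, algebraMap (MvPolynomial (Fin 3) F) K (C (a e)) *
      (algebraMap _ K b₁ / algebraMap (MvPolynomial (Fin 3) F) K (X 0) ^ α) ^ e.1 *
      (algebraMap _ K b₂ / algebraMap (MvPolynomial (Fin 3) F) K (X 0) ^ β) ^ e.2)
    (hm : m ≤ M) (hM : ∀ e ∈ s, α * e.1 + β * e.2 ≤ M) :
    X 0 ^ (M - m) * f =
      ∑ e ∈ s, C (a e) * X 0 ^ (M - (α * e.1 + β * e.2)) * b₁ ^ e.1 * b₂ ^ e.2 := by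
  have hinj : Function.Injective (algebraMap (MvPolynomial (Fin 3) F) K) :=
    IsFractionRing.injective _ _
  have hx : algebraMap (MvPolynomial (Fin 3) F) K (X 0) ≠ 0 := fun h0 =>
    X_ne_zero (R := F) (0 : Fin 3) (hinj (by rw [h0, map_zero]))
  apply hinj
  rw [map_mul, map_pow, h, ← mul_assoc, ← pow_add, Nat.sub_add_cancel hm, map_sum, Finset.mul_sum]
  refine Finset.sum_congr rfl fun e he => ?_
  obtain ⟨k, hk⟩ : ∃ k, M = k + (α * e.1 + β * e.2) := ⟨_, (Nat.sub_add_cancel (hM e he)).symm⟩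
  simp only [map_mul, map_pow, hk, Nat.add_sub_cancel, pow_add, pow_mul, div_pow]
  field_simp

open Classical in
/-- The exponents of a polynomial in two variables. -/
noncomputable def biSupport (r : Polynomial (Polynomial F)) : Finset (ℕ × ℕ) :=
  r.support.biUnion fun j => (r.coeff j).support.image fun i => (i, j)

theorem mem_biSupport {r : Polynomial (Polynomial F)} {e : ℕ × ℕ} :
    e ∈ biSupport r ↔ (r.coeff e.2).coeff e.1 ≠ 0 := by
  obtain ⟨i, j⟩ := e
  simp only [biSupport, Finset.mem_biUnion, Finset.mem_image, Prod.mk.injEq,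
    Polynomial.mem_support_iff]
  constructor
  · rintro ⟨j', -, i', hi, rfl, rfl⟩
    exact hi
  · exact fun h => ⟨j, fun h0 => h (by rw [h0, Polynomial.coeff_zero]), i, h, rfl, rfl⟩

theorem eval₂_aeval_eq_sum {E : Type*} [CommRing E] [Algebra F E] (r : Polynomial (Polynomial F))
    (u w : E) : Polynomial.eval₂ (Polynomial.aeval u).toRingHom w r =
      ∑ e ∈ biSupport r, algebraMap F E ((r.coeff e.2).coeff e.1) * u ^ e.1 * w ^ e.2 := by
  classical
  rw [biSupport, Finset.sum_biUnion, Polynomial.eval₂_eq_sum, Polynomial.sum]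
  · refine Finset.sum_congr rfl fun j _ => ?_
    rw [Finset.sum_image (by simp)]
    dsimp only
    rw [← Finset.sum_mul]
    congr 1
    change Polynomial.aeval u (r.coeff j) = _
    rw [Polynomial.aeval_def, Polynomial.eval₂_eq_sum, Polynomial.sum]
  · intro j _ k _ hjk
    simp only [Function.onFun, Finset.disjoint_left, Finset.mem_image]
    rintro _ ⟨i, -, rfl⟩ ⟨i', -, h⟩
    exact hjk (Prod.mk.inj h).2.symm

variable {b : Fin 4 → MvPolynomial (Fin 3) F} {α β N : ℕ}

/-- Homogenizing an expansion that is monic of degree `α` in `b₂ / x ^ β` gives a relation. -/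
theorem exists_relation (hb : HasLeadExponents b α β N) (h1 : (b 1).IsHomogeneous α)
    (h2 : (b 2).IsHomogeneous β) (hN : N ≤ α * β) {s : Finset (ℕ × ℕ)} {a : ℕ × ℕ → F}
    (ha : ∀ e ∈ s, a e ≠ 0) (hs : (0, α) ∈ s) (hlt : ∀ e ∈ s, e ≠ (0, α) → e.2 < α)
    {K : Type*} [Field K] [Algebra (MvPolynomial (Fin 3) F) K]
    [IsFractionRing (MvPolynomial (Fin 3) F) K]
    (h : algebraMap (MvPolynomial (Fin 3) F) K (b 3) =
      algebraMap (MvPolynomial (Fin 3) F) K (X 0) ^ N *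
      ∑ e ∈ s, algebraMap (MvPolynomial (Fin 3) F) K (C (a e)) *
      (algebraMap _ K (b 1) / algebraMap (MvPolynomial (Fin 3) F) K (X 0) ^ α) ^ e.1 *
      (algebraMap _ K (b 2) / algebraMap (MvPolynomial (Fin 3) F) K (X 0) ^ β) ^ e.2) :
    ∃ r : MvPolynomial (Fin 4) F, (∀ K ∈ r.support, K 2 < α) ∧ b 2 ^ α = aeval b r := by
  classical
  have hb1 : eval (![0, 1, 0] : Fin 3 → F) (b 1) ≠ 0 := by
    rw [eval_zero_one_zero h1, ← hb.one]
    exact MonomialOrder.coeff_degree_ne_zero_iff.2 (hb.ne_zero 1)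
  have hb2 : eval (![0, 1, 0] : Fin 3 → F) (b 2) ≠ 0 := by
    rw [eval_zero_one_zero h2, ← hb.two]
    exact MonomialOrder.coeff_degree_ne_zero_iff.2 (hb.ne_zero 2)
  obtain ⟨e₀, he₀, hmax⟩ := Finset.exists_max_image s (fun e => α * e.1 + β * e.2) ⟨_, hs⟩
  -- No term has weighted degree above αβ. Otherwise clear denominators with the largest weighted
  -- degree and evaluate at (0, 1, 0). The left side vanishes because a power of x remains. On the
  -- right only `e₀` survives, since terms of maximal weight have second exponent below α and are
  -- then determined by their weight. Its value is nonzero, a contradiction.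
  have hM : ∀ e ∈ s, α * e.1 + β * e.2 ≤ α * β := by
    by_contra! hcon
    obtain ⟨e₁, he₁, hgt⟩ := hcon
    have hgt₀ := hgt.trans_le (hmax e₁ he₁)
    have hne : ∀ e ∈ s, α * β < α * e.1 + β * e.2 → e.2 < α := by
      intro e he hlt'
      refine hlt e he ?_
      rintro rfl
      simp [mul_comm] at hlt'
    have key := congrArg (eval (![0, 1, 0] : Fin 3 → F))
      (pow_mul_eq_sum h (hN.trans hgt₀.le) hmax)
    rw [map_mul, map_pow, eval_X, Matrix.cons_val_zero, zero_pow (by omega), zero_mul, map_sum,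
      Finset.sum_eq_single e₀] at key
    · simp [ha e₀ he₀, hb1, hb2] at key
    · intro e he hee
      have hlt' : α * e.1 + β * e.2 < α * e₀.1 + β * e₀.2 := by
        refine lt_of_le_of_ne (hmax e he) fun heq => hee ?_
        obtain ⟨h3, h4⟩ := eq_of_weight_pair_eq hb.pos hb.coprime
          (hne e he (heq ▸ hgt₀)) (hne e₀ he₀ hgt₀) heq
        exact Prod.ext h3 h4
      simp [Nat.sub_ne_zero_of_lt hlt']
    · exact fun hn => (hn he₀).elim
  have key := pow_mul_eq_sum h hN hM
  rw [← Finset.add_sum_erase _ _ hs] at key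
  have hc : (C (a (0, α))⁻¹ * C (a (0, α)) : MvPolynomial (Fin 3) F) = 1 := by
    rw [← C_mul, inv_mul_cancel₀ (ha _ hs), C_1]
  -- At common denominator x^(αβ) the term with exponent (0, α) carries no power of x, so the
  -- identity can be solved for `b 2 ^ α`.
  refine ⟨C (a (0, α))⁻¹ * (X 0 ^ (α * β - N) * X 3 - ∑ e ∈ s.erase (0, α),
    C (a e) * X 0 ^ (α * β - (α * e.1 + β * e.2)) * X 1 ^ e.1 * X 2 ^ e.2), ?_, ?_⟩
  · intro J hJ
    rw [mem_support_iff, coeff_C_mul] at hJ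
    have hJ' := mem_support_iff.2 (right_ne_zero_of_mul hJ)
    rcases Finset.mem_union.1 (support_sub _ _ _ hJ') with h3 | h3
    · rw [X_pow_eq_monomial, X, monomial_mul] at h3
      rw [Finset.mem_singleton.1 (support_monomial_subset h3)]
      simpa using hb.pos
    · obtain ⟨e, he, hJe⟩ := Finset.mem_biUnion.1 (support_sum h3)
      rw [X_pow_eq_monomial, X_pow_eq_monomial, X_pow_eq_monomial, C_mul_monomial, monomial_mul,
        monomial_mul] at hJe
      rw [Finset.mem_singleton.1 (support_monomial_subset hJe)]
      simpa using hlt e (Finset.mem_of_mem_erase he) (Finset.ne_of_mem_erase he)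
  · simp only [map_mul, map_sub, map_sum, map_pow, aeval_X, aeval_C, algebraMap_eq, hb.zero]
    rw [key, add_sub_cancel_right]
    simp only [mul_zero, zero_add, pow_zero, mul_one, mul_comm β α, Nat.sub_self]
    rw [← mul_assoc, hc, one_mul]

/-- A homogeneous polynomial of degree `m` is `x ^ m` times its value at `(1, y / x, z / x)`. -/
theorem algebraMap_eq_pow_mul {E : Type*} [CommRing E] [Algebra F E]
    (D : MvPolynomial (Fin 3) F →ₐ[F] E) (Ψ : E →ₐ[F] FractionRing (MvPolynomial (Fin 3) F))
    (hΨ : ∀ i, Ψ (D (X i)) =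
      algebraMap (MvPolynomial (Fin 3) F) (FractionRing (MvPolynomial (Fin 3) F)) (X i) /
        algebraMap (MvPolynomial (Fin 3) F) (FractionRing (MvPolynomial (Fin 3) F)) (X 0))
    {f : MvPolynomial (Fin 3) F} {m : ℕ} (hf : f.IsHomogeneous m) :
    algebraMap _ (FractionRing (MvPolynomial (Fin 3) F)) f =
      algebraMap (MvPolynomial (Fin 3) F) _ (X 0) ^ m * Ψ (D f) := by
  set x := algebraMap (MvPolynomial (Fin 3) F) (FractionRing (MvPolynomial (Fin 3) F)) (X 0)
    with hx
  have hx0 : x ≠ 0 := by simp [hx]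
  have h1 : ∀ f : MvPolynomial (Fin 3) F,
      algebraMap _ (FractionRing (MvPolynomial (Fin 3) F)) f =
      aeval (fun i => x * Ψ (D (X i))) f := by
    intro f
    have : (IsScalarTower.toAlgHom F (MvPolynomial (Fin 3) F)
        (FractionRing (MvPolynomial (Fin 3) F))) = aeval (fun i => x * Ψ (D (X i))) := by
      ext i
      simp only [IsScalarTower.coe_toAlgHom', aeval_X, hΨ]
      rw [mul_div_cancel₀ _ hx0]
    exact DFunLike.congr_fun this f
  have h2 : Ψ (D f) = aeval (fun i => Ψ (D (X i))) f := by
    have : Ψ.comp D = aeval (fun i => Ψ (D (X i))) := by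
      ext i
      simp
    exact DFunLike.congr_fun this f
  rw [h1, h2, aeval_def, aeval_def, eval₂_eq', eval₂_eq', Finset.mul_sum]
  refine Finset.sum_congr rfl fun d hd => ?_
  have hdeg := hf.degree_eq_sum_deg_support hd
  rw [← Finsupp.degree_apply, Finsupp.degree_eq_sum] at hdeg
  simp only [mul_pow, Finset.prod_mul_distrib]
  rw [Finset.prod_pow_eq_pow_sum, ← hdeg]
  ring

/-- A version of `isSagbiHypersurface_of_relation` with hypotheses on the images of `A` and of the
last generator after setting `x = 1`. -/
theorem isSagbiHypersurface_of_expansion {A : Subalgebra F (MvPolynomial (Fin 3) F)}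
    (hb : HasLeadExponents b α β N) (hbA : ∀ i, b i ∈ A) (h1 : (b 1).IsHomogeneous α)
    (h2 : (b 2).IsHomogeneous β) (h3 : (b 3).IsHomogeneous N) (hN : N ≤ α * β)
    (hA : ∀ f ∈ A, ∀ m, homogeneousComponent m f ∈ A)
    {E : Type*} [CommRing E] [Algebra F E]
    (D : MvPolynomial (Fin 3) F →ₐ[F] E) (Ψ : E →ₐ[F] FractionRing (MvPolynomial (Fin 3) F))
    (hΨ : ∀ i, Ψ (D (X i)) =
      algebraMap (MvPolynomial (Fin 3) F) (FractionRing (MvPolynomial (Fin 3) F)) (X i) /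
        algebraMap (MvPolynomial (Fin 3) F) (FractionRing (MvPolynomial (Fin 3) F)) (X 0))
    (hD : ∀ f ∈ A, ∃ r : Polynomial (Polynomial F),
      D f = Polynomial.eval₂ (Polynomial.aeval (D (b 1))).toRingHom (D (b 2)) r)
    (hD3 : ∃ r : Polynomial (Polynomial F), ∃ c : F, c ≠ 0 ∧ r.natDegree = α ∧
      r.leadingCoeff = Polynomial.C c ∧
      D (b 3) = Polynomial.eval₂ (Polynomial.aeval (D (b 1))).toRingHom (D (b 2)) r)
    {c d : F} (hd : d ≠ 0)
    (hcd : c * grevlex.leadingCoeff (b 1) ^ β = d * grevlex.leadingCoeff (b 2) ^ α) :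
    IsSagbiHypersurface A b (C c * X 1 ^ β - C d * X 2 ^ α) := by
  have hx : algebraMap (MvPolynomial (Fin 3) F) (FractionRing (MvPolynomial (Fin 3) F)) (X 0) ≠ 0 :=
    by simp
  have hdiv : ∀ {f : MvPolynomial (Fin 3) F} {m : ℕ}, f.IsHomogeneous m →
      Ψ (D f) = algebraMap _ (FractionRing (MvPolynomial (Fin 3) F)) f /
        algebraMap (MvPolynomial (Fin 3) F) _ (X 0) ^ m := fun hf => by
    rw [algebraMap_eq_pow_mul D Ψ hΨ hf, mul_div_cancel_left₀ _ (pow_ne_zero _ hx)]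
  have hexp : ∀ {f : MvPolynomial (Fin 3) F} {m : ℕ}, f.IsHomogeneous m →
      ∀ r : Polynomial (Polynomial F),
      D f = Polynomial.eval₂ (Polynomial.aeval (D (b 1))).toRingHom (D (b 2)) r →
      algebraMap _ (FractionRing (MvPolynomial (Fin 3) F)) f =
        algebraMap (MvPolynomial (Fin 3) F) _ (X 0) ^ m * ∑ e ∈ biSupport r,
        algebraMap (MvPolynomial (Fin 3) F) (FractionRing (MvPolynomial (Fin 3) F))
          (C ((r.coeff e.2).coeff e.1)) *
        (algebraMap _ (FractionRing (MvPolynomial (Fin 3) F)) (b 1) /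
          algebraMap (MvPolynomial (Fin 3) F) _ (X 0) ^ α) ^ e.1 *
        (algebraMap _ (FractionRing (MvPolynomial (Fin 3) F)) (b 2) /
          algebraMap (MvPolynomial (Fin 3) F) _ (X 0) ^ β) ^ e.2 := by
    intro f m hf r hr
    rw [algebraMap_eq_pow_mul D Ψ hΨ hf, hr, eval₂_aeval_eq_sum, map_sum]
    congr 1
    refine Finset.sum_congr rfl fun e _ => ?_
    rw [map_mul, map_mul, map_pow, map_pow, hdiv h1, hdiv h2, AlgHom.commutes,
      IsScalarTower.algebraMap_apply F (MvPolynomial (Fin 3) F), algebraMap_eq]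
  obtain ⟨r, c₀, hc₀, hdeg, hlead, hr⟩ := hD3
  -- As the lead coefficient of r is the constant `c₀`, the pair (0, α) is the only exponent whose
  -- second entry is α; all others have smaller second entry.
  obtain ⟨R, hR, hrel⟩ := exists_relation hb h1 h2 hN (s := biSupport r)
    (fun e he => mem_biSupport.1 he)
    (mem_biSupport.2 (by
      rw [← hdeg]
      change (r.leadingCoeff).coeff 0 ≠ 0
      rw [hlead, Polynomial.coeff_C_zero]
      exact hc₀))
    (fun e he hne => by
      have he' := mem_biSupport.1 he
      have hle : e.2 ≤ α := by
        rw [← hdeg]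
        refine Polynomial.le_natDegree_of_ne_zero fun h0 => he' ?_
        rw [h0, Polynomial.coeff_zero]
      refine lt_of_le_of_ne hle fun heq => hne (Prod.ext ?_ heq)
      rw [heq, ← hdeg] at he'
      change (r.leadingCoeff).coeff e.1 ≠ 0 at he'
      rw [hlead, Polynomial.coeff_C] at he'
      by_contra h0
      exact he' (if_neg h0))
    (hexp h3 r hr)
  refine isSagbiHypersurface_of_relation hb hbA hR hrel ?_ hd hcd
  have hi : ∀ i, b i ∈ Algebra.adjoin F (Set.range b) := fun i => Algebra.subset_adjoin ⟨i, rfl⟩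
  have hX : (X 0 : MvPolynomial (Fin 3) F) ∈ Algebra.adjoin F (Set.range b) := hb.zero ▸ hi 0
  -- Homogeneous components are treated separately, because only for them does setting x = 1 reverse
  -- by multiplying with a power of x.
  have hcomp : ∀ f ∈ A, ∀ m, ∃ k, X 0 ^ k * homogeneousComponent m f ∈
      Algebra.adjoin F (Set.range b) := by
    intro f hf m
    obtain ⟨q, hq⟩ := hD _ (hA f hf m)
    have hle : ∀ e ∈ biSupport q, α * e.1 + β * e.2 ≤
        m + ∑ e ∈ biSupport q, (α * e.1 + β * e.2) := fun e he =>
      (Finset.single_le_sum (f := fun e : ℕ × ℕ => α * e.1 + β * e.2)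
        (fun _ _ => Nat.zero_le _) he).trans (Nat.le_add_left _ _)
    refine ⟨m + ∑ e ∈ biSupport q, (α * e.1 + β * e.2) - m, ?_⟩
    rw [pow_mul_eq_sum (hexp (homogeneousComponent_isHomogeneous m f) q hq)
      (Nat.le_add_right _ _) hle]
    · refine Subalgebra.sum_mem _ fun e _ => ?_
      exact Subalgebra.mul_mem _ (Subalgebra.mul_mem _ (Subalgebra.mul_mem _
        (Subalgebra.algebraMap_mem _ _) (Subalgebra.pow_mem _ hX _))
        (Subalgebra.pow_mem _ (hi 1) _)) (Subalgebra.pow_mem _ (hi 2) _)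
  intro f hf
  choose k hk using hcomp f hf
  -- The sum of the exponents is at least each of them, so one power of x serves all components.
  refine ⟨∑ m ∈ Finset.range (f.totalDegree + 1), k m, ?_⟩
  rw [← sum_homogeneousComponent f, Finset.mul_sum, sum_homogeneousComponent f]
  refine Subalgebra.sum_mem _ fun m hm => ?_
  obtain ⟨n, hn⟩ := Nat.exists_eq_add_of_le
    (Finset.single_le_sum (f := k) (fun _ _ => Nat.zero_le _) hm)
  rw [hn, add_comm, pow_add, mul_assoc]
  exact Subalgebra.mul_mem _ (Subalgebra.pow_mem _ hX _) (hk m)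

end Homogenization

/-! ### Polynomials invariant under translations -/

section Translation

/-- Over a domain, a polynomial invariant under finitely many translations is a polynomial in any
invariant whose degree is the number of translations and whose lead coefficient is a unit. -/
theorem exists_eq_comp_of_translation_invariant {R : Type*} [CommRing R] [IsDomain R]
    {C : Finset R} {B : Polynomial R} (hdeg : B.natDegree = C.card) (hC : C.Nonempty)
    (hlead : IsUnit B.leadingCoeff)
    (hB : ∀ c ∈ C, B.comp (Polynomial.X + Polynomial.C c) = B) (f : Polynomial R)
    (hf : ∀ c ∈ C, f.comp (Polynomial.X + Polynomial.C c) = f) :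
    ∃ q : Polynomial R, f = q.comp B := by
  classical
  -- Invariance gives g(c) = g(0), so every c in C is a root of g - g(0).
  have hvan : ∀ g : Polynomial R, (∀ c ∈ C, g.comp (Polynomial.X + Polynomial.C c) = g) →
      (C.val.map fun c => Polynomial.X - Polynomial.C c).prod ∣ g - Polynomial.C (g.eval 0) := by
    intro g hg
    by_cases h0 : g - Polynomial.C (g.eval 0) = 0
    · rw [h0]; exact dvd_zero _
    rw [Multiset.prod_X_sub_C_dvd_iff_le_roots h0, Multiset.le_iff_subset C.nodup]
    intro c hc
    rw [Polynomial.mem_roots h0, Polynomial.IsRoot, Polynomial.eval_sub, Polynomial.eval_C]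
    conv in (g.eval 0) => rw [← hg c hc]
    simp
  set P := (C.val.map fun c => Polynomial.X - Polynomial.C c).prod with hP
  have hPmonic : P.Monic := Polynomial.monic_multiset_prod_of_monic _ _
    fun c _ => Polynomial.monic_X_sub_C c
  have hPdeg : P.natDegree = C.card := by
    rw [hP, Polynomial.natDegree_multiset_prod_X_sub_C_eq_card, Finset.card_val]
  have hcard : 0 < C.card := hC.card_pos
  obtain ⟨Q, hQ⟩ := hvan B hB
  have hBdeg : (B - Polynomial.C (B.eval 0)).natDegree = C.card := by
    rw [Polynomial.natDegree_sub_C, hdeg]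
  have hQ0 : Q ≠ 0 := by
    rintro rfl
    rw [hQ, mul_zero, Polynomial.natDegree_zero] at hBdeg
    omega
  -- By degree Q is a constant, and it equals the lead coefficient of B. Hence B - B(0) itself
  -- divides f - f(0) for every invariant f, and the quotient is again invariant, of smaller degree.
  have hQu : IsUnit Q := by
    have h1 : Q.natDegree = 0 := by
      rw [hQ, hPmonic.natDegree_mul' hQ0, hPdeg] at hBdeg
      omega
    have h2 : (B - Polynomial.C (B.eval 0)).leadingCoeff = Q.leadingCoeff := by
      rw [hQ, Polynomial.leadingCoeff_mul, hPmonic.leadingCoeff, one_mul]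
    have h3 : (B - Polynomial.C (B.eval 0)).leadingCoeff = B.leadingCoeff := by
      rw [Polynomial.leadingCoeff, Polynomial.natDegree_sub_C, Polynomial.coeff_sub,
        Polynomial.coeff_C, if_neg (by omega), sub_zero]
      rfl
    rw [Polynomial.eq_C_of_natDegree_eq_zero h1] at h2 ⊢
    rw [h3, Polynomial.leadingCoeff_C] at h2
    rw [← h2]
    exact hlead.map Polynomial.C
  obtain ⟨n, hn⟩ : ∃ n, n = f.natDegree := ⟨_, rfl⟩
  induction n using Nat.strong_induction_on generalizing f with
  | _ n ih =>
  by_cases h0 : f - Polynomial.C (f.eval 0) = 0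
  · exact ⟨Polynomial.C (f.eval 0), by rw [Polynomial.C_comp, ← sub_eq_zero, h0]⟩
  obtain ⟨g, hg⟩ : B - Polynomial.C (B.eval 0) ∣ f - Polynomial.C (f.eval 0) := by
    rw [hQ]
    exact hQu.mul_right_dvd.2 (hvan f hf)
  have hB0 : B - Polynomial.C (B.eval 0) ≠ 0 := fun h => by
    rw [h, Polynomial.natDegree_zero] at hBdeg
    omega
  have hg0 : g ≠ 0 := right_ne_zero_of_mul (hg ▸ h0)
  have hginv : ∀ c ∈ C, g.comp (Polynomial.X + Polynomial.C c) = g := by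
    intro c hc
    have h1 := congrArg (fun h => Polynomial.comp h (Polynomial.X + Polynomial.C c)) hg
    simp only [Polynomial.sub_comp, Polynomial.mul_comp, Polynomial.C_comp, hf c hc, hB c hc] at h1
    rw [hg] at h1
    exact (mul_left_cancel₀ hB0 h1).symm
  have hgdeg : g.natDegree < n := by
    have h1 := congrArg Polynomial.natDegree hg
    rw [Polynomial.natDegree_sub_C, Polynomial.natDegree_mul hB0 hg0, hBdeg] at h1
    omega
  obtain ⟨q, hq⟩ := ih _ hgdeg g hginv rfl
  refine ⟨(Polynomial.X - Polynomial.C (B.eval 0)) * q + Polynomial.C (f.eval 0), ?_⟩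
  rw [Polynomial.add_comp, Polynomial.mul_comp, Polynomial.sub_comp, Polynomial.X_comp,
    Polynomial.C_comp, Polynomial.C_comp, ← hq, ← hg, sub_add_cancel]

/-- Used to read off the degree in the third generator and the lead coefficient of the expansion of
N_G(z). -/
theorem natDegree_and_leadingCoeff_of_comp {R : Type*} [CommRing R] [IsDomain R]
    {q B : Polynomial R} {m n : ℕ} (hm : 0 < m) (hB : B.natDegree = m)
    (hq : (q.comp B).natDegree = n * m) :
    q.natDegree = n ∧ (q.comp B).leadingCoeff = q.leadingCoeff * B.leadingCoeff ^ n := by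
  rw [Polynomial.natDegree_comp, hB] at hq
  have h := Nat.eq_of_mul_eq_mul_right hm hq
  exact ⟨h, by rw [Polynomial.leadingCoeff_comp (by omega), h]⟩

end Translation

/-! ### The group action, the rows of M and their minors -/

section Action

variable {F : Type*} [Field F] (p : ℕ) [Fact p.Prime] [CharP F p] (M : Matrix (Fin 2) (Fin 2) F)

/-- The homomorphism `(ℤ/p)² → F` given by a row of `M`. -/
noncomputable def rowMap (i : Fin 2) (g : G p) : F :=
  ∑ j, ZMod.castHom dvd_rfl F (Multiplicative.toAdd g j) * M i j

theorem rowMap_eq (i : Fin 2) (g : G p) : rowMap p M i g =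
    ZMod.castHom dvd_rfl F (Multiplicative.toAdd g 0) * M i 0 +
      ZMod.castHom dvd_rfl F (Multiplicative.toAdd g 1) * M i 1 :=
  Fin.sum_univ_two _

theorem rep_eq_sigma (g : G p) :
    rep p M g = sigma (Multiplicative.ofAdd (rowMap p M 0 g, rowMap p M 1 g)) := rfl

theorem rowMap_mul (i : Fin 2) (g h : G p) :
    rowMap p M i (g * h) = rowMap p M i g + rowMap p M i h := by
  simp only [rowMap_eq, toAdd_mul, Pi.add_apply, map_add]
  ring

theorem rowMap_one (i : Fin 2) : rowMap p M i 1 = 0 := by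
  simp [rowMap_eq]

theorem act_rep_X_zero (g : G p) : act (rep p M g) (X 0) = X 0 := act_sigma_x _ _

theorem act_rep_X_one (g : G p) : act (rep p M g) (X 1) = X 1 + C (rowMap p M 0 g) * X 0 :=
  act_sigma_y _ _

theorem act_rep_X_two (g : G p) : act (rep p M g) (X 2) =
    X 2 + C (2 * rowMap p M 0 g) * X 1 + C (rowMap p M 0 g ^ 2 + rowMap p M 1 g) * X 0 :=
  act_sigma_z _ _

theorem act_C (A : GL (Fin 3) F) (a : F) : act A (C a) = C a := AlgHom.commutes _ a

theorem act_rep_mul (g h : G p) (f : MvPolynomial (Fin 3) F) :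
    act (rep p M (g * h)) f = act (rep p M g) (act (rep p M h) f) := by
  have : act (rep p M (g * h)) = (act (rep p M g)).comp (act (rep p M h)) := by
    ext1 i
    fin_cases i
    · change act (rep p M (g * h)) (X 0) = act (rep p M g) (act (rep p M h) (X 0))
      simp only [act_rep_X_zero]
    · change act (rep p M (g * h)) (X 1) = act (rep p M g) (act (rep p M h) (X 1))
      rw [act_rep_X_one p M (g * h), rowMap_mul]
      simp only [act_rep_X_one, act_rep_X_zero, map_add, map_mul, act_C]
      ring
    · change act (rep p M (g * h)) (X 2) = act (rep p M g) (act (rep p M h) (X 2))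
      rw [act_rep_X_two p M (g * h), rowMap_mul, rowMap_mul]
      simp only [act_rep_X_two, act_rep_X_one, act_rep_X_zero, map_add, map_mul, act_C, map_pow,
        map_ofNat]
      ring
  rw [this, AlgHom.comp_apply]

theorem X_zero_mem_invariants : (X 0 : MvPolynomial (Fin 3) F) ∈ invariants p M :=
  act_rep_X_zero p M

-- Invariance passes to quotients by invariants; this handles the exact divisions by x in the
-- definitions of f₂, h and d.
variable {p M} in
theorem mem_invariants_of_mul {f h : MvPolynomial (Fin 3) F} (hh : h ∈ invariants p M)
    (h0 : h ≠ 0) (hf : h * f ∈ invariants p M) : f ∈ invariants p M := by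
  intro g
  have h1 := hf g
  rw [map_mul, hh g] at h1
  exact mul_left_cancel₀ h0 h1

/-- G acts by linear substitutions, which preserve degree. -/
theorem homogeneousComponent_act (g : G p) (f : MvPolynomial (Fin 3) F) (m : ℕ) :
    homogeneousComponent m (act (rep p M g) f) = act (rep p M g) (homogeneousComponent m f) := by
  have hX : ∀ i, (act (rep p M g) (X i)).IsHomogeneous 1 := by
    intro i
    have hx : ∀ (a : F) j, (C a * X j : MvPolynomial (Fin 3) F).IsHomogeneous 1 :=
      fun a j => (isHomogeneous_X F j).C_mul a
    fin_cases i
    · exact (act_rep_X_zero p M g).symm ▸ isHomogeneous_X F 0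
    · exact (act_rep_X_one p M g).symm ▸ (isHomogeneous_X F 1).add (hx _ _)
    · exact (act_rep_X_two p M g).symm ▸ ((isHomogeneous_X F 2).add (hx _ _)).add (hx _ _)
  have hhom : ∀ {h : MvPolynomial (Fin 3) F} {n : ℕ}, h.IsHomogeneous n →
      (act (rep p M g) h).IsHomogeneous n := by
    intro h n hh
    have h1 := hh.aeval (fun i => act (rep p M g) (X i)) hX
    rw [one_mul] at h1
    have h2 : aeval (fun i => act (rep p M g) (X i)) h = act (rep p M g) h := by
      simp only [act, aeval_X]
    rwa [h2] at h1
  have hsum := sum_homogeneousComponent f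
  conv_lhs => rw [← hsum, map_sum, map_sum]
  have hterm : ∀ n, homogeneousComponent m (act (rep p M g) (homogeneousComponent n f)) =
      if n = m then act (rep p M g) (homogeneousComponent m f) else 0 := by
    intro n
    have h1 := hhom (homogeneousComponent_isHomogeneous n f)
    rw [homogeneousComponent_of_mem ((mem_homogeneousSubmodule _ _).2 h1)]
    split_ifs with h2 h3 h3
    · rw [h2]
    · exact absurd h2.symm h3
    · exact absurd h3.symm h2
    · rfl
  simp only [hterm, Finset.sum_ite_eq', Finset.mem_range]
  split_ifs with h
  · rfl
  · rw [homogeneousComponent_eq_zero _ _ (by omega), map_zero]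

theorem homogeneousComponent_mem_invariants {f : MvPolynomial (Fin 3) F}
    (hf : f ∈ invariants p M) (m : ℕ) : homogeneousComponent m f ∈ invariants p M := by
  intro g
  rw [← homogeneousComponent_act, hf g]

theorem orbitProd_mem_invariants (f : MvPolynomial (Fin 3) F) :
    orbitProd p M f ∈ invariants p M := by
  classical
  intro g
  have hinj : Function.Injective (act (rep p M g)) := by
    refine Function.LeftInverse.injective (g := act (rep p M g⁻¹)) fun h => ?_
    rw [← act_rep_mul, inv_mul_cancel]
    have h1 : act (rep p M 1) = AlgHom.id F (MvPolynomial (Fin 3) F) := by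
      ext1 i
      fin_cases i
      · exact act_rep_X_zero p M 1
      · refine (act_rep_X_one p M 1).trans ?_
        simp [rowMap_one]
      · refine (act_rep_X_two p M 1).trans ?_
        simp [rowMap_one]
    rw [h1, AlgHom.id_apply]
  rw [orbitProd, map_prod, ← Finset.prod_image (g := act (rep p M g)) (f := fun h => h)
    hinj.injOn, Finset.image_image]
  refine Finset.prod_congr ?_ fun _ _ => rfl
  ext h
  simp only [Finset.mem_image, Finset.mem_univ, true_and, Function.comp_apply, ← act_rep_mul]
  constructor
  · rintro ⟨k, hk⟩
    exact ⟨g * k, hk⟩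
  · rintro ⟨k, hk⟩
    exact ⟨g⁻¹ * k, by rw [mul_inv_cancel_left, hk]⟩

theorem gammaBar_eq :
    gammaBar p M 1 2 = M 0 0 * M 1 1 - M 0 1 * M 1 0 ∧
    gammaBar p M 1 3 = M 0 0 * M 0 1 ^ p - M 0 1 * M 0 0 ^ p ∧
    gammaBar p M 2 3 = M 1 0 * M 0 1 ^ p - M 1 1 * M 0 0 ^ p ∧
    gammaBar p M 1 4 = M 0 0 * M 1 1 ^ p - M 0 1 * M 1 0 ^ p ∧
    gammaBar p M 2 4 = M 1 0 * M 1 1 ^ p - M 1 1 * M 1 0 ^ p := by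
  simp [gammaBar, gamma, Gam, Matrix.det_fin_two, psi, show ¬ Odd 2 from by decide,
    show Odd 3 from by decide, show ¬ Odd 4 from by decide]

theorem rowMap_pow (i : Fin 2) (g : G p) : rowMap p M i g ^ p =
    ZMod.castHom dvd_rfl F (Multiplicative.toAdd g 0) * M i 0 ^ p +
      ZMod.castHom dvd_rfl F (Multiplicative.toAdd g 1) * M i 1 ^ p := by
  rw [rowMap_eq, add_pow_char, mul_pow, mul_pow, ← map_pow, ← map_pow, ZMod.pow_card, ZMod.pow_card]

/-- This is the expansion of a vanishing 3 × 3 determinant. Append to rows 1, 2, 3 of Γ the column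
of values c₁(g), c₂(g), c₁(g)^p. It is a combination of the first two columns with coefficients in
the prime field, which Frobenius fixes. -/
theorem rowMap_relation_one (g : G p) : gammaBar p M 1 2 * rowMap p M 0 g ^ p -
    gammaBar p M 1 3 * rowMap p M 1 g + gammaBar p M 2 3 * rowMap p M 0 g = 0 := by
  obtain ⟨h12, h13, h23, -, -⟩ := gammaBar_eq p M
  rw [h12, h13, h23, rowMap_pow, rowMap_eq, rowMap_eq]
  ring

/-- The same determinant argument for rows 1, 2, 4. -/
theorem rowMap_relation_two (g : G p) : gammaBar p M 1 2 * rowMap p M 1 g ^ p -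
    gammaBar p M 1 4 * rowMap p M 1 g + gammaBar p M 2 4 * rowMap p M 0 g = 0 := by
  obtain ⟨h12, -, -, h14, h24⟩ := gammaBar_eq p M
  rw [h12, h14, h24, rowMap_pow, rowMap_eq, rowMap_eq]
  ring

/-- If c₁ vanishes at an element, so does c₁^p. These are two linear equations for its coordinates,
with determinant γ₁₃. -/
theorem rowMap_zero_injective (h : gammaBar p M 1 3 ≠ 0) : Function.Injective (rowMap p M 0) := by
  intro g k hgk
  have h0 : rowMap p M 0 (g / k) = 0 := by
    have := rowMap_mul p M 0 (g / k) k
    rw [div_mul_cancel, hgk] at this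
    linear_combination -this
  have h1 := rowMap_pow p M 0 (g / k)
  rw [h0, zero_pow (Fact.out : p.Prime).ne_zero] at h1
  rw [rowMap_eq] at h0
  rw [(gammaBar_eq p M).2.1] at h
  have ha : ZMod.castHom dvd_rfl F (Multiplicative.toAdd (g / k) 0) = 0 := by
    refine (mul_eq_zero.1 ?_).resolve_right h
    linear_combination M 0 1 ^ p * h0 + M 0 1 * h1
  have hb : ZMod.castHom dvd_rfl F (Multiplicative.toAdd (g / k) 1) = 0 := by
    refine (mul_eq_zero.1 ?_).resolve_right h
    linear_combination -M 0 0 ^ p * h0 - M 0 0 * h1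
  rw [map_eq_zero] at ha hb
  rw [← div_eq_one]
  refine Multiplicative.toAdd.injective (funext fun i => ?_)
  fin_cases i
  · exact ha
  · exact hb

theorem rowMap_injective (h : gammaBar p M 1 2 ≠ 0) {g k : G p}
    (h0 : rowMap p M 0 g = rowMap p M 0 k) (h1 : rowMap p M 1 g = rowMap p M 1 k) : g = k := by
  rw [rowMap_eq, rowMap_eq] at h0 h1
  rw [(gammaBar_eq p M).1] at h
  have hinj : Function.Injective (ZMod.castHom (dvd_refl p) F) := RingHom.injective _
  refine Multiplicative.toAdd.injective (funext fun i => hinj ?_)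
  rw [← sub_eq_zero]
  refine (mul_eq_zero.1 ?_).resolve_right h
  fin_cases i
  · change (ZMod.castHom (dvd_refl p) F (Multiplicative.toAdd g 0) -
      ZMod.castHom (dvd_refl p) F (Multiplicative.toAdd k 0)) * _ = 0
    linear_combination M 1 1 * h0 - M 0 1 * h1
  · change (ZMod.castHom (dvd_refl p) F (Multiplicative.toAdd g 1) -
      ZMod.castHom (dvd_refl p) F (Multiplicative.toAdd k 1)) * _ = 0
    linear_combination -M 1 0 * h0 + M 0 0 * h1

theorem exists_castHom_eq {r : F} (hr : r ^ p = r) : ∃ a : ZMod p, ZMod.castHom dvd_rfl F a = r := by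
  have h1 : r ∈ (⊥ : Subfield F) := (Subfield.mem_bot_iff_pow_eq_self F p).2 hr
  rw [← ZMod.fieldRange_castHom_eq_bot p] at h1
  exact h1

/-- When `M 0 0` is nonzero, γ₁₃ = 0 says that the ratio of the entries in the first row is fixed by
Frobenius, hence lies in the prime field and gives a linear dependence. -/
theorem exists_rowMap_zero_eq_zero (h : gammaBar p M 1 3 = 0) :
    ∃ g : G p, g ≠ 1 ∧ rowMap p M 0 g = 0 := by
  rw [(gammaBar_eq p M).2.1] at h
  have hne : ∀ g : G p, (∃ i, Multiplicative.toAdd g i ≠ 0) → g ≠ 1 := by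
    rintro g ⟨i, hi⟩ rfl
    exact hi rfl
  by_cases h0 : M 0 0 = 0
  · refine ⟨Multiplicative.ofAdd ![1, 0], hne _ ⟨0, by simp⟩, ?_⟩
    simp [rowMap_eq, h0]
  · obtain ⟨a, ha⟩ := exists_castHom_eq p (r := M 0 1 / M 0 0) (by
      rw [div_pow, div_eq_div_iff (pow_ne_zero _ h0) h0]
      linear_combination h)
    refine ⟨Multiplicative.ofAdd ![-a, 1], hne _ ⟨1, by simp⟩, ?_⟩
    rw [rowMap_eq]
    simp only [toAdd_ofAdd, Matrix.cons_val_zero, Matrix.cons_val_one, map_neg, map_one, ha]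
    field_simp
    ring

/-- A faithful representation of type `(1, 1, 1)` has `γ₁₂ ≠ 0` or `γ₁₃ ≠ 0`. -/
theorem gammaBar_ne_zero_of_injective (h : Function.Injective (rep p M)) (h0 : M 0 ≠ 0) :
    gammaBar p M 1 2 ≠ 0 ∨ gammaBar p M 1 3 ≠ 0 := by
  by_contra! hc
  obtain ⟨g, hg, hg0⟩ := exists_rowMap_zero_eq_zero p M hc.2
  have h12 := hc.1
  rw [(gammaBar_eq p M).1] at h12
  have hg1 : rowMap p M 1 g = 0 := by
    rw [rowMap_eq] at hg0 ⊢
    -- Since γ₁₂ = 0 the rows are dependent, so c₂(g) is killed by both entries of the nonzero first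
    -- row.
    have e0 : M 0 0 * (ZMod.castHom (dvd_refl p) F (Multiplicative.toAdd g 0) * M 1 0 +
        ZMod.castHom (dvd_refl p) F (Multiplicative.toAdd g 1) * M 1 1) = 0 := by
      linear_combination M 1 0 * hg0 +
        ZMod.castHom (dvd_refl p) F (Multiplicative.toAdd g 1) * h12
    have e1 : M 0 1 * (ZMod.castHom (dvd_refl p) F (Multiplicative.toAdd g 0) * M 1 0 +
        ZMod.castHom (dvd_refl p) F (Multiplicative.toAdd g 1) * M 1 1) = 0 := by
      linear_combination M 1 1 * hg0 -
        ZMod.castHom (dvd_refl p) F (Multiplicative.toAdd g 0) * h12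
    by_contra hne
    apply h0
    ext j
    fin_cases j
    · exact (mul_eq_zero.1 e0).resolve_right hne
    · exact (mul_eq_zero.1 e1).resolve_right hne
  apply hg
  apply h
  rw [rep_eq_sigma, rep_eq_sigma, hg0, hg1, rowMap_one, rowMap_one]

/-- If both γ₁₃ and γ₂₃ vanish, the p-th powers of the first row solve a homogeneous linear system
of determinant ±γ₁₂, so the first row is zero and γ₁₂ = 0. -/
theorem gammaBar_two_three_ne_zero (h12 : gammaBar p M 1 2 ≠ 0) (h13 : gammaBar p M 1 3 = 0) :
    gammaBar p M 2 3 ≠ 0 := by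
  intro h23
  have hp := (Fact.out : p.Prime).ne_zero
  obtain ⟨e12, e13, e23, -, -⟩ := gammaBar_eq p M
  rw [e12] at h12
  rw [e13] at h13
  rw [e23] at h23
  have h1 : M 0 1 ^ p = 0 := by
    refine (mul_eq_zero.1 ?_).resolve_right h12
    linear_combination M 1 1 * h13 - M 0 1 * h23
  have h2 : M 0 0 ^ p = 0 := by
    refine (mul_eq_zero.1 ?_).resolve_right h12
    linear_combination M 1 0 * h13 - M 0 0 * h23
  rw [pow_eq_zero_iff hp] at h1 h2
  exact h12 (by rw [h1, h2]; ring)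

theorem card_group : Fintype.card (G p) = p ^ 2 := by
  rw [Fintype.card_multiplicative, Fintype.card_pi, Finset.prod_const, ZMod.card,
    Finset.card_univ, Fintype.card_fin]

open Classical in
/-- If the rank is two and `γ₁₃ = 0`, the first row of `M` takes `p` values on `G`. -/
theorem card_image_rowMap (h12 : gammaBar p M 1 2 ≠ 0) (h13 : gammaBar p M 1 3 = 0) :
    (Finset.univ.image (rowMap p M 0)).card = p := by
  let φ : G p →* Multiplicative F :=
    { toFun := fun g => Multiplicative.ofAdd (rowMap p M 0 g)
      map_one' := by rw [rowMap_one]; rfl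
      map_mul' := fun g h => by rw [rowMap_mul]; rfl }
  have hp := (Fact.out : p.Prime)
  have hφ : ∀ g, φ g = 1 ↔ rowMap p M 0 g = 0 := fun g => Iff.rfl
  have hcard : Nat.card φ.range = (Finset.univ.image (rowMap p M 0)).card := by
    rw [← Set.ncard_coe_finset, Finset.coe_image, Finset.coe_univ, Set.image_univ]
    rfl
  have hmul := φ.ker.card_mul_index
  rw [Subgroup.index_ker, hcard, Nat.card_eq_fintype_card (α := G p), card_group] at hmul
  -- The kernel has order p^k. It is nontrivial since γ₁₃ = 0, and not all of G since the first row
  -- is nonzero; hence k = 1.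
  obtain ⟨k, hk, hker⟩ := (Nat.dvd_prime_pow hp).1 (Dvd.intro _ hmul)
  have hk0 : k ≠ 0 := by
    rintro rfl
    obtain ⟨g, hg, hg0⟩ := exists_rowMap_zero_eq_zero p M h13
    rw [pow_zero, Subgroup.card_eq_one] at hker
    have : g ∈ φ.ker := hg0
    rw [hker] at this
    exact hg (Subgroup.mem_bot.1 this)
  have hk2 : k ≠ 2 := by
    rintro rfl
    have htop : φ.ker = ⊤ := by
      apply Subgroup.eq_top_of_card_eq
      rw [hker, Nat.card_eq_fintype_card, card_group]
    have hrow : ∀ j, M 0 j = 0 := by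
      intro j
      have : (Multiplicative.ofAdd (Pi.single j 1) : G p) ∈ φ.ker := by
        rw [htop]; trivial
      have h1 : rowMap p M 0 (Multiplicative.ofAdd (Pi.single j 1)) = 0 := this
      rw [rowMap_eq] at h1
      fin_cases j <;> simpa using h1
    apply h12
    rw [(gammaBar_eq p M).1, hrow, hrow]
    ring
  have hk1 : k = 1 := by omega
  rw [hker, hk1, pow_one, sq] at hmul
  exact Nat.eq_of_mul_eq_mul_left hp.pos hmul

end Action

/-! ### Lead monomials that are powers of y -/

section LeadTerms

variable {F : Type*} [Field F]

/-- Among monomials of equal degree, those divisible by x are smaller than y^m. -/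
theorem degree_and_leadingCoeff_of_eq {f q : MvPolynomial (Fin 3) F} {m : ℕ} {c : F}
    (hf : f.IsHomogeneous m) (hc : c ≠ 0) (h : f = C c * X 1 ^ m + X 0 * q) :
    grevlex.degree f = Finsupp.single 1 m ∧ grevlex.leadingCoeff f = c := by
  classical
  have hcoeff : ∀ d : Fin 3 →₀ ℕ, d 0 = 0 →
      coeff d f = if Finsupp.single 1 m = d then c else 0 := by
    intro d hd
    rw [h, coeff_add, X_pow_eq_monomial, C_mul_monomial, coeff_monomial, coeff_X_mul']
    simp [hd]
  have h1 : coeff (Finsupp.single 1 m) f = c := by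
    rw [hcoeff _ (by simp), if_pos rfl]
  have hdeg : grevlex.degree f = Finsupp.single 1 m := by
    refine grevlex.toSyn.injective (le_antisymm ?_
      (MonomialOrder.le_degree (mem_support_iff.2 (h1 ▸ hc))))
    rw [MonomialOrder.degree_le_iff]
    intro d hd
    have hsum := hf.degree_eq_sum_deg_support hd
    rw [← Finsupp.degree_apply, Finsupp.degree_eq_sum, Fin.sum_univ_three] at hsum
    by_cases hd0 : d 0 = 0
    · rw [mem_support_iff, hcoeff d hd0] at hd
      by_cases he : Finsupp.single 1 m = d
      · rw [he]
      · exact (hd (if_neg he)).elim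
    · refine le_of_lt ((grevlex_lt_iff _ _).2 (Or.inr ⟨?_, Or.inl ?_⟩))
      · simp [← hsum]
      · simpa using Nat.pos_of_ne_zero hd0
  exact ⟨hdeg, by rw [MonomialOrder.leadingCoeff, hdeg, h1]⟩

theorem isHomogeneous_of_X_pow_mul {f : MvPolynomial (Fin 3) F} {k m : ℕ}
    (h : (X 0 ^ k * f).IsHomogeneous (k + m)) : f.IsHomogeneous m := by
  intro d hd
  have h1 : coeff (Finsupp.single 0 k + d) (X 0 ^ k * f) ≠ 0 := by
    rwa [X_pow_eq_monomial, coeff_monomial_mul, one_mul]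
  have h2 := h h1
  rw [map_add] at h2
  have h3 : Finsupp.weight (1 : Fin 3 → ℕ) (Finsupp.single 0 k) = k := by
    simp [Finsupp.weight_single]
  omega

theorem isHomogeneous_delta : (delta F).IsHomogeneous 2 :=
  (isHomogeneous_X_pow 1 2).sub ((isHomogeneous_X F 0).mul (isHomogeneous_X F 2))

end LeadTerms

/-! ### Invariance, degrees and lead terms of f₁, f₂, h and d -/

section Formulas

variable {F : Type*} [Field F] (p : ℕ) [Fact p.Prime] [CharP F p] (M : Matrix (Fin 2) (Fin 2) F)

theorem f1Bar_eq (hp : 2 < p) : f1Bar p M = C (gammaBar p M 1 2) * X 1 ^ p +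
    C (gammaBar p M 1 3) * delta F * X 0 ^ (p - 2) +
    C (gammaBar p M 2 3) * X 1 * X 0 ^ (p - 1) := by
  simp only [f1Bar, f1_eq p hp, map_add, map_mul, map_pow, map_C, map_X, map_delta, gammaBar]

/-- The value of `f₁₂₄` at `M`. -/
noncomputable def f124Bar : MvPolynomial (Fin 3) F := map (psi p M) (f124 p)

theorem f124Bar_eq (hp : 2 < p) : f124Bar p M = -C (gammaBar p M 1 2) * delta F ^ p +
    C (gammaBar p M 1 4) * delta F * X 0 ^ (2 * p - 2) +
    C (gammaBar p M 2 4) * X 1 * X 0 ^ (2 * p - 1) := by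
  simp only [f124Bar, f124_eq p hp, map_add, map_mul, map_neg, map_pow, map_C, map_X, map_delta,
    gammaBar]

theorem two_mul_f2Bar (hp : 2 < p) : 2 * X 0 ^ (p - 2) * f2Bar p M =
    C (gammaBar p M 1 2) * f124Bar p M + f1Bar p M ^ 2 := by
  have := congrArg (map (psi p M)) (two_mul_f2 p hp)
  simp only [map_mul, map_add, map_pow, map_C, map_X, map_ofNat] at this
  exact this

theorem two_ne_zero_of_charP (hp : 2 < p) : (2 : F) ≠ 0 :=
  Ring.two_ne_zero (by rw [ringChar.eq F p]; omega)

theorem two_mul_half (hp : 2 < p) : (C (2⁻¹ : F) * 2 : MvPolynomial (Fin 3) F) = 1 := by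
  rw [← map_ofNat C 2, ← C_mul, inv_mul_cancel₀ (two_ne_zero_of_charP p hp), C_1]

theorem X_pow_mul_f2Bar (hp : 2 < p) : X 0 ^ (p - 2) * f2Bar p M =
    C (2⁻¹ : F) * (C (gammaBar p M 1 2) * f124Bar p M + f1Bar p M ^ 2) := by
  rw [← two_mul_f2Bar p M hp]
  linear_combination -X 0 ^ (p - 2) * f2Bar p M * two_mul_half (F := F) p hp

/-- The quadratic part c₁^2 in σ cancels against the square of y + c₁ x, so -δ/x^2 is simply
translated by c₂. -/
theorem act_delta (g : G p) :
    act (rep p M g) (delta F) = delta F - C (rowMap p M 1 g) * X 0 ^ 2 := by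
  simp only [delta, map_sub, map_mul, map_pow, act_rep_X_zero, act_rep_X_one, act_rep_X_two,
    map_add, map_ofNat]
  ring

/-- The action adds c₁(g), c₂(g), c₁(g)^p to the last column of the defining minor, and the
resulting change vanishes by `rowMap_relation_one`. -/
theorem f1Bar_mem_invariants (hp : 2 < p) : f1Bar p M ∈ invariants p M := by
  intro g
  have e1 : p - 1 = (p - 2) + 1 := by omega
  have e2 : (X 0 : MvPolynomial (Fin 3) F) ^ p = X 0 ^ (p - 2) * X 0 ^ 2 := by
    rw [← pow_add]
    congr 1
    omega
  have h := congrArg (C : F → MvPolynomial (Fin 3) F) (rowMap_relation_one p M g)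
  simp only [map_add, map_sub, map_mul, map_pow, map_zero] at h
  simp only [f1Bar_eq p M hp, map_add, map_mul, map_pow, act_C, act_rep_X_zero, act_rep_X_one,
    act_delta, add_pow_char, mul_pow, e1, e2]
  linear_combination X 0 ^ (p - 2) * X 0 ^ 2 * h

theorem f124Bar_mem_invariants (hp : 2 < p) : f124Bar p M ∈ invariants p M := by
  intro g
  have e1 : 2 * p - 1 = (2 * p - 2) + 1 := by omega
  have e2 : ((X 0 : MvPolynomial (Fin 3) F) ^ 2) ^ p = X 0 ^ (2 * p - 2) * X 0 ^ 2 := by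
    rw [← pow_add, ← pow_mul]
    congr 1
    omega
  have h := congrArg (C : F → MvPolynomial (Fin 3) F) (rowMap_relation_two p M g)
  simp only [map_add, map_sub, map_mul, map_pow, map_zero] at h
  simp only [f124Bar_eq p M hp, map_add, map_mul, map_neg, map_pow, act_C, act_rep_X_zero,
    act_rep_X_one, act_delta, sub_pow_char, mul_pow, e1, e2]
  linear_combination X 0 ^ (2 * p - 2) * X 0 ^ 2 * h

theorem f2Bar_mem_invariants (hp : 2 < p) : f2Bar p M ∈ invariants p M := by
  refine mem_invariants_of_mul (Subalgebra.pow_mem _ (X_zero_mem_invariants p M) (p - 2))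
    (pow_ne_zero _ (X_ne_zero 0)) ?_
  rw [X_pow_mul_f2Bar p M hp]
  exact Subalgebra.mul_mem _ (Subalgebra.algebraMap_mem _ _) (Subalgebra.add_mem _
    (Subalgebra.mul_mem _ (Subalgebra.algebraMap_mem _ _) (f124Bar_mem_invariants p M hp))
    (Subalgebra.pow_mem _ (f1Bar_mem_invariants p M hp) 2))

theorem hPoly_mem_invariants (hp : 2 < p) (h13 : gammaBar p M 1 3 = 0)
    (h12 : gammaBar p M 1 2 ≠ 0) : hPoly p M ∈ invariants p M := by
  have h := f2Bar_mem_invariants p M hp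
  rw [← gammaBar_mul_hPoly p M hp h13 h12] at h
  refine mem_invariants_of_mul (Subalgebra.mul_mem _ (Subalgebra.algebraMap_mem _ _)
    (X_zero_mem_invariants p M)) (mul_ne_zero ?_ (X_ne_zero 0)) h
  simpa [algebraMap_eq] using h12

theorem X_pow_mul_dPoly (hp : 2 < p) (h12 : gammaBar p M 1 2 = 0) :
    X 0 ^ (p - 2) * dPoly p M = f1Bar p M := by
  have e1 : p - 1 = (p - 2) + 1 := by omega
  rw [dPoly_eq p M hp h12, f1Bar_eq p M hp, h12, e1, map_zero]
  ring

theorem dPoly_mem_invariants (hp : 2 < p) (h12 : gammaBar p M 1 2 = 0) :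
    dPoly p M ∈ invariants p M := by
  refine mem_invariants_of_mul (Subalgebra.pow_mem _ (X_zero_mem_invariants p M) (p - 2))
    (pow_ne_zero _ (X_ne_zero 0)) ?_
  rw [X_pow_mul_dPoly p M hp h12]
  exact f1Bar_mem_invariants p M hp

theorem isHomogeneous_f1Bar (hp : 2 < p) : (f1Bar p M).IsHomogeneous p := by
  have h1 : (C (gammaBar p M 1 3) * delta F * X 0 ^ (p - 2)).IsHomogeneous (2 + (p - 2)) :=
    (isHomogeneous_delta.C_mul _).mul (isHomogeneous_X_pow 0 _)
  have h2 : (C (gammaBar p M 2 3) * X 1 * X 0 ^ (p - 1) : MvPolynomial (Fin 3) F).IsHomogeneous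
      (1 + (p - 1)) :=
    ((isHomogeneous_X F 1).C_mul _).mul (isHomogeneous_X_pow 0 _)
  have e1 : 2 + (p - 2) = p := by omega
  have e2 : 1 + (p - 1) = p := by omega
  rw [e1] at h1
  rw [e2] at h2
  rw [f1Bar_eq p M hp]
  exact (((isHomogeneous_X_pow 1 p).C_mul _).add h1).add h2

theorem isHomogeneous_f124Bar (hp : 2 < p) : (f124Bar p M).IsHomogeneous (2 * p) := by
  have h1 : (C (gammaBar p M 1 4) * delta F * X 0 ^ (2 * p - 2)).IsHomogeneous
      (2 + (2 * p - 2)) := (isHomogeneous_delta.C_mul _).mul (isHomogeneous_X_pow 0 _)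
  have h2 : (C (gammaBar p M 2 4) * X 1 * X 0 ^ (2 * p - 1) : MvPolynomial (Fin 3) F).IsHomogeneous
      (1 + (2 * p - 1)) := ((isHomogeneous_X F 1).C_mul _).mul (isHomogeneous_X_pow 0 _)
  have e1 : 2 + (2 * p - 2) = 2 * p := by omega
  have e2 : 1 + (2 * p - 1) = 2 * p := by omega
  rw [e1] at h1
  rw [e2] at h2
  rw [f124Bar_eq p M hp, ← C_neg]
  exact (((isHomogeneous_delta.pow p).C_mul _).add h1).add h2

theorem isHomogeneous_f2Bar (hp : 2 < p) : (f2Bar p M).IsHomogeneous (p + 2) := by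
  refine isHomogeneous_of_X_pow_mul (k := p - 2) ?_
  rw [X_pow_mul_f2Bar p M hp, show p - 2 + (p + 2) = 2 * p by omega]
  refine (((isHomogeneous_f124Bar p M hp).C_mul _).add ?_).C_mul _
  rw [mul_comm 2 p]
  exact (isHomogeneous_f1Bar p M hp).pow 2

theorem isHomogeneous_hPoly (hp : 2 < p) (h13 : gammaBar p M 1 3 = 0)
    (h12 : gammaBar p M 1 2 ≠ 0) : (hPoly p M).IsHomogeneous (p + 1) := by
  refine isHomogeneous_of_X_pow_mul (k := 1) ?_
  have h := (isHomogeneous_f2Bar p M hp).C_mul (gammaBar p M 1 2)⁻¹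
  rw [← gammaBar_mul_hPoly p M hp h13 h12, ← mul_assoc, ← mul_assoc, ← C_mul,
    inv_mul_cancel₀ h12, C_1, one_mul] at h
  rwa [pow_one, show 1 + (p + 1) = p + 2 by omega]

theorem isHomogeneous_dPoly (hp : 2 < p) (h12 : gammaBar p M 1 2 = 0) :
    (dPoly p M).IsHomogeneous 2 := by
  refine isHomogeneous_of_X_pow_mul (k := p - 2) ?_
  rw [X_pow_mul_dPoly p M hp h12, Nat.sub_add_cancel hp.le]
  exact isHomogeneous_f1Bar p M hp

theorem f1Bar_lead (hp : 2 < p) (h12 : gammaBar p M 1 2 ≠ 0) :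
    grevlex.degree (f1Bar p M) = Finsupp.single 1 p ∧
      grevlex.leadingCoeff (f1Bar p M) = gammaBar p M 1 2 := by
  obtain ⟨k, rfl⟩ : ∃ k, p = k + 3 := ⟨p - 3, by omega⟩
  refine degree_and_leadingCoeff_of_eq (isHomogeneous_f1Bar _ M hp) h12
    (q := C (gammaBar _ M 1 3) * delta F * X 0 ^ k + C (gammaBar _ M 2 3) * X 1 * X 0 ^ (k + 1)) ?_
  rw [f1Bar_eq _ M hp, show k + 3 - 2 = k + 1 by omega, show k + 3 - 1 = k + 2 by omega]
  ring

theorem f2Bar_eq (hp : 2 < p) : f2Bar p M =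
    C (gammaBar p M 1 2 * gammaBar p M 1 3) * delta F * X 1 ^ p +
    C (gammaBar p M 1 2 * gammaBar p M 2 3) * X 0 * X 1 ^ (p + 1) +
    C (2⁻¹ : F) * (C (gammaBar p M 1 2 ^ 2) * X 0 ^ 2 * X 2 ^ p +
      C (gammaBar p M 1 3 ^ 2) * delta F ^ 2 * X 0 ^ (p - 2) +
      2 * C (gammaBar p M 1 3 * gammaBar p M 2 3) * delta F * X 1 * X 0 ^ (p - 1) +
      (C (gammaBar p M 1 2 * gammaBar p M 1 4) * delta F + C (gammaBar p M 2 3 ^ 2) * X 1 ^ 2) *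
        X 0 ^ p +
      C (gammaBar p M 1 2 * gammaBar p M 2 4) * X 1 * X 0 ^ (p + 1)) := by
  have h2 : psi p M (C (2⁻¹ : ZMod p)) = 2⁻¹ := by
    have h := congrArg (psi p M) (show (C (2⁻¹ : ZMod p) : Coeff p) * 2 = 1 by
      have h3 := C_half_two p hp
      rw [← map_ofNat C 2, ← C_mul, ← C_1] at h3
      exact C_injective _ _ h3)
    rw [map_mul, map_ofNat, map_one] at h
    exact eq_inv_of_mul_eq_one_left h
  simp only [f2Bar, f2_eq p hp, map_add, map_mul, map_pow, map_C, map_X, map_delta, gammaBar,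
    map_ofNat, h2]

theorem f2Bar_lead (hp : 2 < p) (h12 : gammaBar p M 1 2 ≠ 0) (h13 : gammaBar p M 1 3 ≠ 0) :
    grevlex.degree (f2Bar p M) = Finsupp.single 1 (p + 2) ∧
      grevlex.leadingCoeff (f2Bar p M) = gammaBar p M 1 2 * gammaBar p M 1 3 := by
  obtain ⟨k, rfl⟩ : ∃ k, p = k + 3 := ⟨p - 3, by omega⟩
  refine degree_and_leadingCoeff_of_eq (isHomogeneous_f2Bar _ M hp) (mul_ne_zero h12 h13)
    -- Only the part y^2 of δ contributes to y^(p + 2); the part -xz goes into the multiple of x.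
    (q := -C (gammaBar _ M 1 2 * gammaBar _ M 1 3) * X 2 * X 1 ^ (k + 3) +
    C (gammaBar _ M 1 2 * gammaBar _ M 2 3) * X 1 ^ (k + 4) +
    C (2⁻¹ : F) * (C (gammaBar _ M 1 2 ^ 2) * X 0 * X 2 ^ (k + 3) +
      C (gammaBar _ M 1 3 ^ 2) * delta F ^ 2 * X 0 ^ k +
      2 * C (gammaBar _ M 1 3 * gammaBar _ M 2 3) * delta F * X 1 * X 0 ^ (k + 1) +
      (C (gammaBar _ M 1 2 * gammaBar _ M 1 4) * delta F + C (gammaBar _ M 2 3 ^ 2) * X 1 ^ 2) *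
        X 0 ^ (k + 2) +
      C (gammaBar _ M 1 2 * gammaBar _ M 2 4) * X 1 * X 0 ^ (k + 3))) ?_
  rw [f2Bar_eq _ M hp, show k + 3 - 2 = k + 1 by omega, show k + 3 - 1 = k + 2 by omega, delta]
  ring

theorem hPoly_lead (hp : 2 < p) (h13 : gammaBar p M 1 3 = 0) (h12 : gammaBar p M 1 2 ≠ 0) :
    grevlex.degree (hPoly p M) = Finsupp.single 1 (p + 1) ∧
      grevlex.leadingCoeff (hPoly p M) = gammaBar p M 2 3 := by
  have hmul := gammaBar_mul_hPoly p M hp h13 h12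
  have h23 := gammaBar_two_three_ne_zero p M h12 h13
  have hhom := isHomogeneous_hPoly p M hp h13 h12
  obtain ⟨k, rfl⟩ : ∃ k, p = k + 3 := ⟨p - 3, by omega⟩
  have hcc : (C (gammaBar (k + 3) M 1 2) * C (gammaBar (k + 3) M 1 2)⁻¹ :
      MvPolynomial (Fin 3) F) = 1 := by
    rw [← C_mul, mul_inv_cancel₀ h12, C_1]
  refine degree_and_leadingCoeff_of_eq hhom h23
    (q := C (2⁻¹ : F) * (C (gammaBar _ M 1 2) * X 2 ^ (k + 3) +
      (C (gammaBar _ M 1 4) * delta F +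
        C (gammaBar _ M 1 2)⁻¹ * C (gammaBar _ M 2 3 ^ 2) * X 1 ^ 2) * X 0 ^ (k + 1) +
      C (gammaBar _ M 2 4) * X 1 * X 0 ^ (k + 2))) ?_
  -- The formula for h is checked after multiplication by γ₁₂ x, where the explicit expression for
  -- f₂ is available.
  refine mul_left_cancel₀ (mul_ne_zero (C_ne_zero.2 h12) (X_ne_zero (R := F) (0 : Fin 3))) ?_
  rw [hmul, f2Bar_eq _ M hp, h13]
  simp only [map_mul, map_pow, map_zero, mul_zero, zero_mul, zero_add, ne_eq, OfNat.ofNat_ne_zero,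
    not_false_eq_true, zero_pow, add_zero]
  linear_combination -C (2⁻¹ : F) * C (gammaBar (k + 3) M 2 3) ^ 2 * X 1 ^ 2 * X 0 ^ (k + 3) * hcc

theorem dPoly_lead (hp : 2 < p) (h12 : gammaBar p M 1 2 = 0) (h13 : gammaBar p M 1 3 ≠ 0) :
    grevlex.degree (dPoly p M) = Finsupp.single 1 2 ∧
      grevlex.leadingCoeff (dPoly p M) = gammaBar p M 1 3 := by
  refine degree_and_leadingCoeff_of_eq (isHomogeneous_dPoly p M hp h12) h13
    (q := -C (gammaBar p M 1 3) * X 2 + C (gammaBar p M 2 3) * X 1) ?_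
  rw [dPoly_eq p M hp h12, delta]
  ring

end Formulas

/-! ### Orbits and norms of y and z -/

section Orbits

variable {F : Type*} [Field F] (p : ℕ) [Fact p.Prime] [CharP F p] (M : Matrix (Fin 2) (Fin 2) F)

/-- A group element changes a variable only by a combination of smaller variables. -/
theorem act_X_homogeneous_lead (g : G p) {i : Fin 3} (hi : i ≠ 0) :
    (act (rep p M g) (X i)).IsHomogeneous 1 ∧
    grevlex.degree (act (rep p M g) (X i)) = Finsupp.single i 1 ∧
    grevlex.leadingCoeff (act (rep p M g) (X i)) = 1 := by
  have hx : ∀ (a : F) j, (C a * X j : MvPolynomial (Fin 3) F).IsHomogeneous 1 :=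
    fun a j => (isHomogeneous_X F j).C_mul a
  have hdeg : ∀ (a : F) (j : Fin 3), grevlex.toSyn (grevlex.degree (C a * X j)) ≤
      grevlex.toSyn (Finsupp.single j 1) := fun a j => by
    rw [X, C_mul_monomial]
    exact MonomialOrder.degree_monomial_le _
  have hlt : ∀ {j k : Fin 3}, j < k →
      grevlex.toSyn (Finsupp.single j 1) < grevlex.toSyn (Finsupp.single k 1) := by
    intro j k hjk
    rw [grevlex_lt_iff]
    fin_cases j <;> fin_cases k <;> simp_all
  have hadd : ∀ (f : MvPolynomial (Fin 3) F) (a : F) (j : Fin 3), j < i →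
      grevlex.degree f = Finsupp.single i 1 → grevlex.leadingCoeff f = 1 →
      grevlex.degree (f + C a * X j) = Finsupp.single i 1 ∧
        grevlex.leadingCoeff (f + C a * X j) = 1 := by
    intro f a j hj hf hf'
    have h := (hdeg a j).trans_lt (hlt hj)
    rw [← hf] at h
    exact ⟨by rw [MonomialOrder.degree_add_of_lt h, hf],
      by rw [MonomialOrder.leadingCoeff_add_of_lt h, hf']⟩
  have hX : grevlex.degree (X i : MvPolynomial (Fin 3) F) = Finsupp.single i 1 :=
    MonomialOrder.degree_X
  have hX' : grevlex.leadingCoeff (X i : MvPolynomial (Fin 3) F) = 1 :=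
    MonomialOrder.leadingCoeff_X
  obtain rfl | rfl : i = 1 ∨ i = 2 := by
    fin_cases i <;> simp_all
  · rw [act_rep_X_one]
    exact ⟨(isHomogeneous_X F 1).add (hx _ _), hadd _ _ _ (by decide) hX hX'⟩
  · rw [act_rep_X_two]
    obtain ⟨h1, h2⟩ := hadd _ (2 * rowMap p M 0 g) 1 (by decide) hX hX'
    exact ⟨((isHomogeneous_X F 2).add (hx _ _)).add (hx _ _), hadd _ _ _ (by decide) h1 h2⟩

open Classical in
/-- The orbit of `f`. -/
noncomputable def orbitFinset (f : MvPolynomial (Fin 3) F) : Finset (MvPolynomial (Fin 3) F) :=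
  Finset.univ.image fun g : G p => act (rep p M g) f

theorem orbitProd_eq (f : MvPolynomial (Fin 3) F) :
    orbitProd p M f = ∏ h ∈ orbitFinset p M f, h := rfl

variable {p M} in
theorem mem_orbitFinset {f h : MvPolynomial (Fin 3) F} :
    h ∈ orbitFinset p M f ↔ ∃ g : G p, act (rep p M g) f = h := by
  simp [orbitFinset]

theorem orbitProd_X_lead {i : Fin 3} (hi : i ≠ 0) :
    (orbitProd p M (X i)).IsHomogeneous (orbitFinset p M (X i)).card ∧
    grevlex.degree (orbitProd p M (X i)) = Finsupp.single i (orbitFinset p M (X i)).card ∧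
    grevlex.leadingCoeff (orbitProd p M (X i)) = 1 := by
  have key : ∀ h ∈ orbitFinset p M (X i), h.IsHomogeneous 1 ∧
      grevlex.degree h = Finsupp.single i 1 ∧ grevlex.leadingCoeff h = 1 := by
    intro h hh
    obtain ⟨g, rfl⟩ := mem_orbitFinset.1 hh
    exact act_X_homogeneous_lead p M g hi
  rw [orbitProd_eq]
  refine ⟨?_, ?_, ?_⟩
  · have := IsHomogeneous.prod (orbitFinset p M (X i)) (fun h => h) (fun _ => 1)
      fun h hh => (key h hh).1
    simpa using this
  · rw [MonomialOrder.degree_prod fun h hh => ?_, Finset.sum_congr rfl fun h hh => (key h hh).2.1]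
    · simp
    · rw [← MonomialOrder.leadingCoeff_ne_zero_iff (m := grevlex), (key h hh).2.2]
      exact one_ne_zero
  · rw [MonomialOrder.leadingCoeff_prod_of_regular fun h hh => ?_,
      Finset.prod_congr rfl fun h hh => (key h hh).2.2]
    · simp
    · rw [(key h hh).2.2]
      exact isRegular_one

theorem act_X_one_eq_iff {g k : G p} : act (rep p M g) (X 1) = act (rep p M k) (X 1) ↔
    rowMap p M 0 g = rowMap p M 0 k := by
  rw [act_rep_X_one, act_rep_X_one, add_right_inj, mul_left_inj' (X_ne_zero 0)]
  exact C_inj _ _ _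

/-- The coefficients of y and x in the image of z are 2 c₁ and c₁^2 + c₂; as 2 is invertible they
determine both c₁ and c₂. -/
theorem card_orbitFinset_X_two (hp : 2 < p)
    (h : ∀ g k : G p, rowMap p M 0 g = rowMap p M 0 k → rowMap p M 1 g = rowMap p M 1 k → g = k) :
    (orbitFinset p M (X 2)).card = p ^ 2 := by
  classical
  rw [orbitFinset, Finset.card_image_of_injective, Finset.card_univ, card_group]
  intro g k hgk
  dsimp only at hgk
  rw [act_rep_X_two, act_rep_X_two] at hgk
  have h1 := congrArg (coeff (Finsupp.single 1 1)) hgk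
  have h0 := congrArg (coeff (Finsupp.single 0 1)) hgk
  simp only [coeff_add, coeff_C_mul, coeff_X, Finsupp.single_left_inj one_ne_zero] at h1 h0
  norm_num at h1 h0
  have h2 := h1.resolve_right (two_ne_zero_of_charP p hp)
  exact h g k h2 (by simpa [h2] using h0)

theorem card_orbitFinset_X_one (h : gammaBar p M 1 3 ≠ 0) :
    (orbitFinset p M (X 1)).card = p ^ 2 := by
  classical
  rw [orbitFinset, Finset.card_image_of_injective, Finset.card_univ, card_group]
  intro g k hgk
  exact rowMap_zero_injective p M h ((act_X_one_eq_iff p M).1 hgk)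

open Classical in
theorem prod_orbitFinset_X_one {E : Type*} [CommMonoid E] (φ : MvPolynomial (Fin 3) F → E) :
    ∏ h ∈ orbitFinset p M (X 1), φ h =
      ∏ c ∈ Finset.univ.image (rowMap p M 0), φ (X 1 + C c * X 0) := by
  have : orbitFinset p M (X 1) =
      (Finset.univ.image (rowMap p M 0)).image fun c => X 1 + C c * X 0 := by
    rw [orbitFinset, Finset.image_image]
    exact Finset.image_congr fun g _ => act_rep_X_one p M g
  rw [this, Finset.prod_image]
  · intro a _ b _ hab
    exact C_injective _ _ (mul_left_injective₀ (X_ne_zero (0 : Fin 3)) (add_left_cancel hab))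

end Orbits

/-! ### The cases γ₁₃ ≠ 0 -/

section NonzeroMinor

variable {F : Type*} [Field F] (p : ℕ) [Fact p.Prime] [CharP F p] (M : Matrix (Fin 2) (Fin 2) F)

theorem natDegree_and_leadingCoeff_add {R : Type*} [Semiring R] {P Q : Polynomial R}
    (h : Q.natDegree < P.natDegree) :
    (P + Q).natDegree = P.natDegree ∧ (P + Q).leadingCoeff = P.leadingCoeff :=
  ⟨Polynomial.natDegree_add_eq_left_of_natDegree_lt h,
    Polynomial.leadingCoeff_add_of_degree_lt' (Polynomial.degree_lt_degree h)⟩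

/-- The expression of `-δ / x ^ 2` in `Y = y / x` and `t = f₁ / x ^ p`, if `γ₁₃ ≠ 0`. -/
noncomputable def slopeNonzero : Polynomial (Polynomial F) :=
  Polynomial.C (Polynomial.C (gammaBar p M 1 3)⁻¹) *
    (Polynomial.C (Polynomial.C (gammaBar p M 1 2)) * Polynomial.X ^ p +
      Polynomial.C (Polynomial.C (gammaBar p M 2 3)) * Polynomial.X - Polynomial.C Polynomial.X)

/-- Setting `x = 1` and taking `y` and the value `t` of `f₁` as coordinates. -/
noncomputable def evalNonzero : MvPolynomial (Fin 3) F →ₐ[F] Polynomial (Polynomial F) :=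
  aeval ![1, Polynomial.X, Polynomial.X ^ 2 + slopeNonzero p M]

theorem evalNonzero_X_zero : evalNonzero p M (X 0) = 1 := by simp [evalNonzero]

theorem evalNonzero_X_one : evalNonzero p M (X 1) = Polynomial.X := by simp [evalNonzero]

theorem evalNonzero_X_two :
    evalNonzero p M (X 2) = Polynomial.X ^ 2 + slopeNonzero p M := by simp [evalNonzero]

theorem evalNonzero_C (a : F) : evalNonzero p M (C a) = Polynomial.C (Polynomial.C a) :=
  AlgHom.commutes _ a

theorem evalNonzero_delta : evalNonzero p M (delta F) = -slopeNonzero p M := by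
  simp only [delta, map_sub, map_mul, map_pow, evalNonzero_X_zero, evalNonzero_X_one,
    evalNonzero_X_two]
  ring

theorem gammaBar_mul_slopeNonzero (h13 : gammaBar p M 1 3 ≠ 0) :
    Polynomial.C (Polynomial.C (gammaBar p M 1 3)) * slopeNonzero p M =
      Polynomial.C (Polynomial.C (gammaBar p M 1 2)) * Polynomial.X ^ p +
      Polynomial.C (Polynomial.C (gammaBar p M 2 3)) * Polynomial.X -
        Polynomial.C Polynomial.X := by
  rw [slopeNonzero, ← mul_assoc, ← Polynomial.C_mul, ← Polynomial.C_mul, mul_inv_cancel₀ h13]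
  simp

theorem evalNonzero_f1Bar (hp : 2 < p) (h13 : gammaBar p M 1 3 ≠ 0) :
    evalNonzero p M (f1Bar p M) = Polynomial.C Polynomial.X := by
  simp only [f1Bar_eq p M hp, map_add, map_mul, map_pow, evalNonzero_X_zero, evalNonzero_X_one,
    evalNonzero_C, evalNonzero_delta, one_pow, mul_one]
  linear_combination -gammaBar_mul_slopeNonzero p M h13

theorem evalNonzero_f124Bar (hp : 2 < p) : evalNonzero p M (f124Bar p M) =
    Polynomial.C (Polynomial.C (gammaBar p M 1 2)) * slopeNonzero p M ^ p -
      Polynomial.C (Polynomial.C (gammaBar p M 1 4)) * slopeNonzero p M +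
      Polynomial.C (Polynomial.C (gammaBar p M 2 4)) * Polynomial.X := by
  have hodd : Odd p := (Fact.out : p.Prime).odd_of_ne_two (by omega)
  simp only [f124Bar_eq p M hp, map_add, map_mul, map_neg, map_pow, evalNonzero_X_zero,
    evalNonzero_X_one, evalNonzero_C, evalNonzero_delta, one_pow, mul_one]
  rw [hodd.neg_pow (slopeNonzero p M)]
  ring

/-- In the coordinates t and Y the group fixes t and translates Y by c₁(g). That the slope -δ/x^2
then moves by c₂(g) is `rowMap_relation_one` divided by γ₁₃. -/
theorem evalNonzero_act (h13 : gammaBar p M 1 3 ≠ 0) (g : G p) (f : MvPolynomial (Fin 3) F) :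
    evalNonzero p M (act (rep p M g) f) = (evalNonzero p M f).comp
      (Polynomial.X + Polynomial.C (Polynomial.C (rowMap p M 0 g))) := by
  have hslope : (slopeNonzero p M).comp
      (Polynomial.X + Polynomial.C (Polynomial.C (rowMap p M 0 g))) =
      slopeNonzero p M + Polynomial.C (Polynomial.C (rowMap p M 1 g)) := by
    have h := congrArg (fun a : F => Polynomial.C (Polynomial.C a)) (rowMap_relation_one p M g)
    simp only [map_add, map_sub, map_mul, map_pow, map_zero] at h
    have hC : Polynomial.C (Polynomial.C (gammaBar p M 1 3)) *
        Polynomial.C (Polynomial.C (gammaBar p M 1 3)⁻¹) = 1 := by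
      rw [← Polynomial.C_mul, ← Polynomial.C_mul, mul_inv_cancel₀ h13]
      simp
    simp only [slopeNonzero, Polynomial.mul_comp, Polynomial.add_comp, Polynomial.sub_comp,
      Polynomial.C_comp, Polynomial.X_comp, Polynomial.pow_comp, add_pow_char]
    linear_combination Polynomial.C (Polynomial.C (gammaBar p M 1 3)⁻¹) * h +
      Polynomial.C (Polynomial.C (rowMap p M 1 g)) * hC
  have : ((evalNonzero p M).comp (act (rep p M g))).toRingHom =
      (Polynomial.compRingHom (Polynomial.X + Polynomial.C (Polynomial.C (rowMap p M 0 g)))).comp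
        (evalNonzero p M).toRingHom := by
    refine MvPolynomial.ringHom_ext (fun a => ?_) fun i => ?_
    · change evalNonzero p M (act (rep p M g) (C a)) = (evalNonzero p M (C a)).comp _
      rw [act_C, evalNonzero_C, Polynomial.C_comp]
    · change evalNonzero p M (act (rep p M g) (X i)) = (evalNonzero p M (X i)).comp _
      fin_cases i
      · change evalNonzero p M (act (rep p M g) (X 0)) = (evalNonzero p M (X 0)).comp _
        rw [act_rep_X_zero, evalNonzero_X_zero, Polynomial.one_comp]
      · change evalNonzero p M (act (rep p M g) (X 1)) = (evalNonzero p M (X 1)).comp _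
        rw [act_rep_X_one, map_add, map_mul, evalNonzero_X_zero, evalNonzero_X_one, evalNonzero_C,
          Polynomial.X_comp, mul_one]
      · change evalNonzero p M (act (rep p M g) (X 2)) = (evalNonzero p M (X 2)).comp _
        rw [act_rep_X_two, map_add, map_add, map_mul _ _ (X 1), map_mul _ _ (X 0), evalNonzero_X_zero,
          evalNonzero_X_one, evalNonzero_X_two, evalNonzero_C, evalNonzero_C, Polynomial.add_comp,
          Polynomial.pow_comp, Polynomial.X_comp, hslope]
        simp only [map_add, map_mul, map_pow, map_ofNat]
        ring
  exact DFunLike.congr_fun this f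

/-- Writes f₁ / x^p in terms of y/x and z/x, with f₁ given through a generator that differs from it
by a power of x. -/
theorem div_pow_eq_of_pow_mul_eq {K : Type*} [Field K] {x y z f a b c : K} {n m : ℕ} (hn : 2 ≤ n)
    (hx : x ≠ 0) (h : x ^ n * f =
      x ^ m * (a * y ^ n + b * (y ^ 2 - x * z) * x ^ (n - 2) + c * y * x ^ (n - 1))) :
    f / x ^ m = a * (y / x) ^ n + b * ((y / x) ^ 2 - z / x) + c * (y / x) := by
  obtain ⟨k, rfl⟩ : ∃ k, n = k + 2 := ⟨n - 2, by omega⟩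
  rw [show k + 2 - 2 = k by omega, show k + 2 - 1 = k + 1 by omega] at h
  have hf : f / x ^ m = (a * y ^ (k + 2) + b * (y ^ 2 - x * z) * x ^ k + c * y * x ^ (k + 1)) /
      x ^ (k + 2) := by
    rw [div_eq_div_iff (pow_ne_zero _ hx) (pow_ne_zero _ hx)]
    linear_combination h
  rw [hf, div_pow]
  field_simp
  ring

/-- Serves both `b 1 = f₁` (α = p) and `b 1 = d` (α = 2), which agree at x = 1. There the p^2
distinct translations of Y make every invariant a polynomial over F[t] in `b 2`, whose Y-degree is
p^2. -/
theorem isSagbiHypersurface_of_gammaBar_one_three_ne_zero (hp : 2 < p)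
    (h13 : gammaBar p M 1 3 ≠ 0) {b : Fin 4 → MvPolynomial (Fin 3) F} {α β : ℕ}
    (hb : HasLeadExponents b α β (p ^ 2)) (hbA : ∀ i, b i ∈ invariants p M)
    (h1 : (b 1).IsHomogeneous α) (h2 : (b 2).IsHomogeneous β) (hN : p ^ 2 ≤ α * β)
    (hb3 : b 3 = orbitProd p M (X 2)) (hb1 : X 0 ^ p * b 1 = X 0 ^ α * f1Bar p M)
    (hz : ∃ c : F, c ≠ 0 ∧ (evalNonzero p M (X 2)).natDegree = α ∧
      (evalNonzero p M (X 2)).leadingCoeff = Polynomial.C c)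
    (hB : ∃ c : F, c ≠ 0 ∧ (evalNonzero p M (b 2)).natDegree = p ^ 2 ∧
      (evalNonzero p M (b 2)).leadingCoeff = Polynomial.C c)
    {c d : F} (hd : d ≠ 0)
    (hcd : c * grevlex.leadingCoeff (b 1) ^ β = d * grevlex.leadingCoeff (b 2) ^ α) :
    IsSagbiHypersurface (invariants p M) b (C c * X 1 ^ β - C d * X 2 ^ α) := by
  classical
  have hp0 : 0 < p ^ 2 := pow_pos (Fact.out : p.Prime).pos 2
  have hrow := rowMap_zero_injective p M h13
  have hcard2 : (orbitFinset p M (X 2)).card = p ^ 2 :=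
    card_orbitFinset_X_two p M hp fun g k hgk _ => hrow hgk
  have hD1 : evalNonzero p M (b 1) = Polynomial.C Polynomial.X := by
    have := congrArg (evalNonzero p M) hb1
    simpa only [map_mul, map_pow, evalNonzero_X_zero, one_pow, one_mul,
      evalNonzero_f1Bar p M hp h13] using this
  have hx : algebraMap (MvPolynomial (Fin 3) F) (FractionRing (MvPolynomial (Fin 3) F)) (X 0) ≠ 0 :=
    by simp
  obtain ⟨cB, hcB, hBdeg, hBlead⟩ := hB
  obtain ⟨cz, hcz, hzdeg, hzlead⟩ := hz
  have hexp : ∀ f ∈ invariants p M, ∃ r : Polynomial (Polynomial F),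
      evalNonzero p M f = r.comp (evalNonzero p M (b 2)) := by
    intro f hf
    have hinv : ∀ h ∈ invariants p M, ∀ c ∈ Finset.univ.image
        (fun g : G p => Polynomial.C (rowMap p M 0 g)),
        (evalNonzero p M h).comp (Polynomial.X + Polynomial.C c) = evalNonzero p M h := by
      intro h hh c hc
      obtain ⟨g, -, rfl⟩ := Finset.mem_image.1 hc
      rw [← evalNonzero_act p M h13, hh g]
    refine exists_eq_comp_of_translation_invariant ?_ (Finset.univ_nonempty.image _) ?_
      (hinv _ (hbA 2)) _ (hinv f hf)
    · rw [hBdeg, Finset.card_image_of_injective, Finset.card_univ, card_group]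
      exact fun g k hgk => hrow (Polynomial.C_injective hgk)
    · rw [hBlead]
      exact hcB.isUnit.map Polynomial.C
  have hcomp : ∀ r : Polynomial (Polynomial F), r.comp (evalNonzero p M (b 2)) =
      Polynomial.eval₂ (Polynomial.aeval (evalNonzero p M (b 1))).toRingHom
        (evalNonzero p M (b 2)) r := by
    intro r
    have hC : (Polynomial.aeval (evalNonzero p M (b 1))).toRingHom =
        (Polynomial.C : Polynomial F →+* Polynomial (Polynomial F)) := by
      rw [hD1]
      refine Polynomial.ringHom_ext (fun a => ?_) ?_
      · exact Polynomial.aeval_C _ a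
      · exact Polynomial.aeval_X _
    rw [hC, Polynomial.comp]
  -- The map back to fractions sends t to `b 1 / x ^ α` and Y to y/x.
  refine isSagbiHypersurface_of_expansion hb hbA h1 h2 ?_ hN
    (fun f hf m => homogeneousComponent_mem_invariants p M hf m) (evalNonzero p M)
    (Polynomial.aevalTower (Polynomial.aeval
      (algebraMap (MvPolynomial (Fin 3) F) (FractionRing (MvPolynomial (Fin 3) F)) (b 1) /
        algebraMap (MvPolynomial (Fin 3) F) _ (X 0) ^ α))
      (algebraMap (MvPolynomial (Fin 3) F) (FractionRing (MvPolynomial (Fin 3) F)) (X 1) /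
        algebraMap (MvPolynomial (Fin 3) F) _ (X 0))) ?_ ?_ ?_ hd hcd
  · rw [hb3, ← hcard2]
    exact (orbitProd_X_lead p M (by decide)).1
  · intro i
    have hCC : ∀ a : F, Polynomial.aeval (algebraMap _ (FractionRing (MvPolynomial (Fin 3) F)) (b 1)
        / algebraMap (MvPolynomial (Fin 3) F) _ (X 0) ^ α) (Polynomial.C a) =
        algebraMap (MvPolynomial (Fin 3) F) (FractionRing (MvPolynomial (Fin 3) F)) (C a) := by
      intro a
      rw [Polynomial.aeval_C, IsScalarTower.algebraMap_apply F (MvPolynomial (Fin 3) F),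
        algebraMap_eq]
    fin_cases i
    · change _ = algebraMap (MvPolynomial (Fin 3) F) _ (X 0) / _
      rw [div_self hx]
      change Polynomial.aevalTower _ _ (evalNonzero p M (X 0)) = _
      rw [evalNonzero_X_zero, map_one]
    · change Polynomial.aevalTower _ _ (evalNonzero p M (X 1)) = _
      rw [evalNonzero_X_one]
      exact Polynomial.aevalTower_X _ _
    · change Polynomial.aevalTower _ _ (evalNonzero p M (X 2)) =
        algebraMap (MvPolynomial (Fin 3) F) _ (X 2) / _
      rw [evalNonzero_X_two, slopeNonzero]
      simp only [map_add, map_sub, map_mul, map_pow, Polynomial.aevalTower_X,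
        Polynomial.aevalTower_C, hCC, Polynomial.aeval_X]
      have hk := congrArg (algebraMap (MvPolynomial (Fin 3) F)
        (FractionRing (MvPolynomial (Fin 3) F))) hb1
      rw [f1Bar_eq p M hp, delta] at hk
      have hu := congrArg (algebraMap (MvPolynomial (Fin 3) F)
        (FractionRing (MvPolynomial (Fin 3) F))) (show C (gammaBar p M 1 3) *
          C (gammaBar p M 1 3)⁻¹ = (1 : MvPolynomial (Fin 3) F) by
            rw [← C_mul, mul_inv_cancel₀ h13, C_1])
      simp only [map_mul, map_add, map_sub, map_pow, map_one] at hk hu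
      rw [div_pow_eq_of_pow_mul_eq hp.le hx hk]
      linear_combination (-(algebraMap (MvPolynomial (Fin 3) F)
        (FractionRing (MvPolynomial (Fin 3) F)) (X 1) / algebraMap (MvPolynomial (Fin 3) F) _ (X 0))
          ^ 2 + algebraMap (MvPolynomial (Fin 3) F) _ (X 2) /
            algebraMap (MvPolynomial (Fin 3) F) _ (X 0)) * hu
  · intro f hf
    obtain ⟨r, hr⟩ := hexp f hf
    exact ⟨r, by rw [hr, hcomp]⟩
  · obtain ⟨r, hr⟩ := hexp _ (hbA 3)
    -- Translates keep degree and lead coefficient in Y, so N_G(z) has Y-degree α p^2, hence degree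
    -- α in `b 2`.
    have hfac : ∀ h ∈ orbitFinset p M (X 2), (evalNonzero p M h).natDegree = α ∧
        (evalNonzero p M h).leadingCoeff = Polynomial.C cz := by
      intro h hh
      obtain ⟨g, rfl⟩ := mem_orbitFinset.1 hh
      rw [evalNonzero_act p M h13]
      refine ⟨by rw [Polynomial.natDegree_comp, Polynomial.natDegree_X_add_C, mul_one, hzdeg], ?_⟩
      rw [Polynomial.leadingCoeff_comp (by rw [Polynomial.natDegree_X_add_C]; exact one_ne_zero),
        Polynomial.leadingCoeff_X_add_C, one_pow, mul_one, hzlead]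
    have h3deg : (evalNonzero p M (b 3)).natDegree = α * p ^ 2 := by
      rw [hb3, orbitProd_eq, map_prod, Polynomial.natDegree_prod _ _ fun h hh => ?_,
        Finset.sum_congr rfl fun h hh => (hfac h hh).1, Finset.sum_const, hcard2, smul_eq_mul,
        mul_comm]
      rw [← Polynomial.leadingCoeff_ne_zero, (hfac h hh).2]
      exact Polynomial.C_ne_zero.2 hcz
    have h3lead : (evalNonzero p M (b 3)).leadingCoeff = Polynomial.C (cz ^ p ^ 2) := by
      rw [hb3, orbitProd_eq, map_prod, Polynomial.leadingCoeff_prod,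
        Finset.prod_congr rfl fun h hh => (hfac h hh).2, Finset.prod_const, hcard2,
        Polynomial.C_pow]
    rw [hr] at h3deg h3lead
    obtain ⟨hrdeg, hrlead⟩ := natDegree_and_leadingCoeff_of_comp hp0 hBdeg h3deg
    refine ⟨r, cz ^ p ^ 2 / cB ^ α, div_ne_zero (pow_ne_zero _ hcz) (pow_ne_zero _ hcB), hrdeg, ?_,
      by rw [hr, hcomp]⟩
    rw [h3lead, hBlead, ← Polynomial.C_pow] at hrlead
    rw [div_eq_mul_inv, Polynomial.C_mul, hrlead, mul_assoc, ← Polynomial.C_mul,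
      mul_inv_cancel₀ (pow_ne_zero _ hcB), Polynomial.C_1, mul_one]

theorem hasLeadExponents_vec {f h k : MvPolynomial (Fin 3) F} {α β N : ℕ}
    (hf : grevlex.degree f = Finsupp.single 1 α) (hh : grevlex.degree h = Finsupp.single 1 β)
    (hk : grevlex.degree k = Finsupp.single 2 N) (hf0 : grevlex.leadingCoeff f ≠ 0)
    (hh0 : grevlex.leadingCoeff h ≠ 0) (hk0 : grevlex.leadingCoeff k ≠ 0) (hα : 0 < α)
    (hN : 0 < N) (hαβ : Nat.Coprime α β) : HasLeadExponents ![X 0, f, h, k] α β N := by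
  refine ⟨rfl, hf, hh, hk, fun i => ?_, hα, hN, hαβ⟩
  rw [MonomialOrder.leadingCoeff_ne_zero_iff] at hf0 hh0 hk0
  fin_cases i
  · exact X_ne_zero 0
  · exact hf0
  · exact hh0
  · exact hk0

theorem vec_mem {A : Subalgebra F (MvPolynomial (Fin 3) F)} {e f h k : MvPolynomial (Fin 3) F}
    (he : e ∈ A) (hf : f ∈ A) (hh : h ∈ A) (hk : k ∈ A) (i : Fin 4) : ![e, f, h, k] i ∈ A := by
  fin_cases i
  · exact he
  · exact hf
  · exact hh
  · exact hk

theorem isSagbiHypersurface_vec_of_gammaBar_one_three_ne_zero (hp : 2 < p)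
    (h13 : gammaBar p M 1 3 ≠ 0) {f h : MvPolynomial (Fin 3) F} {α β : ℕ}
    (hf : f ∈ invariants p M) (hh : h ∈ invariants p M)
    (h1 : f.IsHomogeneous α) (h2 : h.IsHomogeneous β)
    (hfd : grevlex.degree f = Finsupp.single 1 α) (hhd : grevlex.degree h = Finsupp.single 1 β)
    (hf0 : grevlex.leadingCoeff f ≠ 0) (hh0 : grevlex.leadingCoeff h ≠ 0) (hα : 0 < α)
    (hαβ : Nat.Coprime α β) (hN : p ^ 2 ≤ α * β) (hf1 : X 0 ^ p * f = X 0 ^ α * f1Bar p M)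
    (hz : ∃ c : F, c ≠ 0 ∧ (evalNonzero p M (X 2)).natDegree = α ∧
      (evalNonzero p M (X 2)).leadingCoeff = Polynomial.C c)
    (hB : ∃ c : F, c ≠ 0 ∧ (evalNonzero p M h).natDegree = p ^ 2 ∧
      (evalNonzero p M h).leadingCoeff = Polynomial.C c)
    {c d : F} (hd : d ≠ 0)
    (hcd : c * grevlex.leadingCoeff f ^ β = d * grevlex.leadingCoeff h ^ α) :
    IsSagbiHypersurface (invariants p M) ![X 0, f, h, orbitProd p M (X 2)]
      (C c * X 1 ^ β - C d * X 2 ^ α) := by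
  obtain ⟨hz0, hz1, hz2⟩ := orbitProd_X_lead p M (i := 2) (by decide)
  have hrow := rowMap_zero_injective p M h13
  rw [card_orbitFinset_X_two p M hp fun g k hgk _ => hrow hgk] at hz1
  generalize hk : orbitProd p M (X 2) = k at *
  exact isSagbiHypersurface_of_gammaBar_one_three_ne_zero p M hp h13
    (hasLeadExponents_vec hfd hhd hz1 hf0 hh0 (hz2 ▸ one_ne_zero) hα
      (pow_pos (Fact.out : p.Prime).pos 2) hαβ)
    (vec_mem (X_zero_mem_invariants p M) hf hh (hk ▸ orbitProd_mem_invariants p M _))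
    h1 h2 hN hk.symm hf1 hz hB hd hcd

theorem natDegree_slopeNonzero (hp : 2 < p) (h13 : gammaBar p M 1 3 ≠ 0)
    (h12 : gammaBar p M 1 2 ≠ 0) : (slopeNonzero p M).natDegree = p ∧
      (slopeNonzero p M).leadingCoeff =
        Polynomial.C ((gammaBar p M 1 3)⁻¹ * gammaBar p M 1 2) := by
  have h : slopeNonzero p M =
      Polynomial.C (Polynomial.C ((gammaBar p M 1 3)⁻¹ * gammaBar p M 1 2)) * Polynomial.X ^ p +
      (Polynomial.C (Polynomial.C ((gammaBar p M 1 3)⁻¹ * gammaBar p M 2 3)) * Polynomial.X +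
        Polynomial.C (Polynomial.C (-(gammaBar p M 1 3)⁻¹) * Polynomial.X)) := by
    simp only [slopeNonzero, Polynomial.C_mul, Polynomial.C_neg]
    ring
  have hc : (Polynomial.C ((gammaBar p M 1 3)⁻¹ * gammaBar p M 1 2) : Polynomial F) ≠ 0 :=
    Polynomial.C_ne_zero.2 (mul_ne_zero (inv_ne_zero h13) h12)
  have hdeg := Polynomial.natDegree_C_mul_X_pow p _ hc
  obtain ⟨h1, h2⟩ := natDegree_and_leadingCoeff_add (P := Polynomial.C (Polynomial.C
    ((gammaBar p M 1 3)⁻¹ * gammaBar p M 1 2)) * Polynomial.X ^ p)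
    (Q := Polynomial.C (Polynomial.C ((gammaBar p M 1 3)⁻¹ * gammaBar p M 2 3)) * Polynomial.X +
        Polynomial.C (Polynomial.C (-(gammaBar p M 1 3)⁻¹) * Polynomial.X)) (by
      rw [hdeg]
      exact lt_of_le_of_lt Polynomial.natDegree_linear_le (by omega))
  rw [h]
  exact ⟨h1.trans hdeg, h2.trans (Polynomial.leadingCoeff_C_mul_X_pow _ _)⟩

theorem isSagbiHypersurface_f1Bar_f2Bar (hp : 2 < p) (h12 : gammaBar p M 1 2 ≠ 0)
    (h13 : gammaBar p M 1 3 ≠ 0) :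
    IsSagbiHypersurface (invariants p M)
      ![X 0, f1Bar p M, f2Bar p M, orbitProd p M (X 2)]
      (C (gammaBar p M 1 3 ^ p) * X 1 ^ (p + 2) - C (gammaBar p M 1 2 ^ 2) * X 2 ^ p) := by
  have hpp : 0 < p := by omega
  obtain ⟨hl1, hc1⟩ := f1Bar_lead p M hp h12
  obtain ⟨hl2, hc2⟩ := f2Bar_lead p M hp h12 h13
  obtain ⟨hs1, hs2⟩ := natDegree_slopeNonzero p M hp h13 h12
  have hu : (gammaBar p M 1 3)⁻¹ * gammaBar p M 1 2 ≠ 0 := mul_ne_zero (inv_ne_zero h13) h12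
  have hodd : Odd p := (Fact.out : p.Prime).odd_of_ne_two (by omega)
  refine isSagbiHypersurface_vec_of_gammaBar_one_three_ne_zero p M hp h13
    (f1Bar_mem_invariants p M hp) (f2Bar_mem_invariants p M hp) (isHomogeneous_f1Bar p M hp)
    (isHomogeneous_f2Bar p M hp) hl1 hl2 (hc1 ▸ h12) (hc2 ▸ mul_ne_zero h12 h13) hpp ?_
    (by nlinarith) rfl ?_ ?_ (pow_ne_zero _ h12) ?_
  · rw [Nat.coprime_self_add_right]
    exact hodd.coprime_two_right
  · have h := natDegree_and_leadingCoeff_add (P := slopeNonzero p M) (Q := Polynomial.X ^ 2) (by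
      rw [hs1, Polynomial.natDegree_X_pow]
      exact hp)
    refine ⟨_, hu, ?_⟩
    rw [evalNonzero_X_two, add_comm, h.1, h.2]
    exact ⟨hs1, hs2⟩
  · have h2 := two_ne_zero_of_charP (F := F) p hp
    have hne : 2⁻¹ * gammaBar p M 1 2 ^ 2 ≠ 0 := mul_ne_zero (inv_ne_zero h2) (pow_ne_zero _ h12)
    -- At x = 1, f₂ is half of γ₁₂ f₁₂₄ + t^2. Its Y-degree p^2 comes from the p-th power of the
    -- slope, which has degree p; the rest has degree at most p.
    have heq : evalNonzero p M (f2Bar p M) =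
        Polynomial.C (Polynomial.C (2⁻¹ * gammaBar p M 1 2 ^ 2)) * slopeNonzero p M ^ p +
        (Polynomial.C (Polynomial.C (2⁻¹ * gammaBar p M 1 2)) *
          (Polynomial.C (Polynomial.C (gammaBar p M 2 4)) * Polynomial.X -
            Polynomial.C (Polynomial.C (gammaBar p M 1 4)) * slopeNonzero p M) +
          Polynomial.C (Polynomial.C 2⁻¹ * Polynomial.X ^ 2)) := by
      have := congrArg (evalNonzero p M) (X_pow_mul_f2Bar p M hp)
      simp only [map_mul, map_add, map_pow, evalNonzero_X_zero, one_pow, one_mul, evalNonzero_C,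
        evalNonzero_f1Bar p M hp h13, evalNonzero_f124Bar p M hp] at this
      rw [this]
      simp only [map_mul, map_pow]
      ring
    have hPdeg : (Polynomial.C (Polynomial.C (2⁻¹ * gammaBar p M 1 2 ^ 2)) *
        slopeNonzero p M ^ p).natDegree = p ^ 2 := by
      rw [Polynomial.natDegree_C_mul (Polynomial.C_ne_zero.2 hne), Polynomial.natDegree_pow, hs1,
        sq]
    have hPlead : (Polynomial.C (Polynomial.C (2⁻¹ * gammaBar p M 1 2 ^ 2)) *
        slopeNonzero p M ^ p).leadingCoeff = Polynomial.C (2⁻¹ * gammaBar p M 1 2 ^ 2 *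
          ((gammaBar p M 1 3)⁻¹ * gammaBar p M 1 2) ^ p) := by
      rw [Polynomial.leadingCoeff_mul, Polynomial.leadingCoeff_C, Polynomial.leadingCoeff_pow, hs2,
        ← Polynomial.C_pow, ← Polynomial.C_mul]
    have hQdeg : (Polynomial.C (Polynomial.C (2⁻¹ * gammaBar p M 1 2)) *
          (Polynomial.C (Polynomial.C (gammaBar p M 2 4)) * Polynomial.X -
            Polynomial.C (Polynomial.C (gammaBar p M 1 4)) * slopeNonzero p M) +
          Polynomial.C (Polynomial.C 2⁻¹ * Polynomial.X ^ 2)).natDegree ≤ p := by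
      refine (Polynomial.natDegree_add_C).trans_le ((Polynomial.natDegree_C_mul_le _ _).trans ?_)
      refine (Polynomial.natDegree_sub_le _ _).trans (max_le ?_ ?_)
      · exact (Polynomial.natDegree_C_mul_le _ _).trans (Polynomial.natDegree_X_le.trans hpp)
      · exact (Polynomial.natDegree_C_mul_le _ _).trans hs1.le
    have h := natDegree_and_leadingCoeff_add (hQdeg.trans_lt (show p < _ by
      rw [hPdeg]
      nlinarith))
    refine ⟨2⁻¹ * gammaBar p M 1 2 ^ 2 * ((gammaBar p M 1 3)⁻¹ * gammaBar p M 1 2) ^ p,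
      mul_ne_zero hne (pow_ne_zero _ hu), ?_⟩
    rw [heq, h.1, h.2]
    exact ⟨hPdeg, hPlead⟩
  · rw [hc1, hc2, mul_pow]
    ring

theorem isSagbiHypersurface_dPoly (hp : 2 < p) (h12 : gammaBar p M 1 2 = 0)
    (h13 : gammaBar p M 1 3 ≠ 0) :
    IsSagbiHypersurface (invariants p M)
      ![X 0, dPoly p M, orbitProd p M (X 1), orbitProd p M (X 2)]
      (X 1 ^ p ^ 2 - C (gammaBar p M 1 3 ^ p ^ 2) * X 2 ^ 2) := by
  classical
  have hpp : 0 < p := by omega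
  obtain ⟨hl1, hc1⟩ := dPoly_lead p M hp h12 h13
  obtain ⟨hy0, hy1, hy2⟩ := orbitProd_X_lead p M (i := 1) (by decide)
  have hrow := rowMap_zero_injective p M h13
  rw [card_orbitFinset_X_one p M h13] at hy0 hy1
  have hodd : Odd p := (Fact.out : p.Prime).odd_of_ne_two (by omega)
  have hT : (X 1 ^ p ^ 2 - C (gammaBar p M 1 3 ^ p ^ 2) * X 2 ^ 2 : MvPolynomial (Fin 4) F) =
      C 1 * X 1 ^ p ^ 2 - C (gammaBar p M 1 3 ^ p ^ 2) * X 2 ^ 2 := by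
    rw [C_1, one_mul]
  rw [hT]
  refine isSagbiHypersurface_vec_of_gammaBar_one_three_ne_zero p M hp h13
    (dPoly_mem_invariants p M hp h12) (orbitProd_mem_invariants p M _)
    (isHomogeneous_dPoly p M hp h12) hy0 hl1 hy1 (hc1 ▸ h13) (hy2 ▸ one_ne_zero) two_pos
    (hodd.pow).coprime_two_left (by omega) ?_ ?_ ?_ (pow_ne_zero _ h13) ?_
  · rw [← X_pow_mul_dPoly p M hp h12, ← mul_assoc, ← pow_add, Nat.add_sub_cancel' hp.le]
  -- With γ₁₂ = 0 the slope has degree at most 1 in Y, so z = Y^2 + slope is monic of degree 2.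
  · have h : slopeNonzero p M = Polynomial.C (Polynomial.C ((gammaBar p M 1 3)⁻¹ *
        gammaBar p M 2 3)) * Polynomial.X +
        Polynomial.C (Polynomial.C (-(gammaBar p M 1 3)⁻¹) * Polynomial.X) := by
      simp only [slopeNonzero, Polynomial.C_mul, Polynomial.C_neg, h12, map_zero, zero_mul,
        zero_add]
      ring
    have h2 := natDegree_and_leadingCoeff_add (P := Polynomial.X ^ 2) (Q := slopeNonzero p M) (by
      rw [h, Polynomial.natDegree_X_pow]
      exact lt_of_le_of_lt Polynomial.natDegree_linear_le one_lt_two)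
    refine ⟨1, one_ne_zero, ?_⟩
    rw [evalNonzero_X_two, h2.1, h2.2, Polynomial.natDegree_X_pow, Polynomial.leadingCoeff_X_pow,
      Polynomial.C_1]
    exact ⟨rfl, rfl⟩
  · have heq : evalNonzero p M (orbitProd p M (X 1)) =
        ∏ c ∈ Finset.univ.image (rowMap p M 0),
          (Polynomial.X + Polynomial.C (Polynomial.C c)) := by
      rw [orbitProd_eq, map_prod, prod_orbitFinset_X_one]
      simp only [map_add, map_mul, evalNonzero_X_zero, evalNonzero_X_one, evalNonzero_C, mul_one]
    refine ⟨1, one_ne_zero, ?_⟩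
    rw [heq, Polynomial.C_1]
    constructor
    · rw [Polynomial.natDegree_prod_of_monic _ _ fun c _ => Polynomial.monic_X_add_C _]
      simp only [Polynomial.natDegree_X_add_C, Finset.sum_const, smul_eq_mul, mul_one]
      rw [Finset.card_image_of_injective _ hrow, Finset.card_univ, card_group]
    · exact Polynomial.monic_prod_of_monic _ _ fun c _ => Polynomial.monic_X_add_C _
  · rw [hc1, hy2, one_mul, one_pow, mul_one]

end NonzeroMinor

/-! ### The case γ₁₃ = 0, γ₁₂ ≠ 0 -/

section ZeroMinor

variable {F : Type*} [Field F] (p : ℕ) [Fact p.Prime] [CharP F p] (M : Matrix (Fin 2) (Fin 2) F)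

/-- Setting `x = 1` and taking `y` and `z - y ^ 2` as coordinates. -/
noncomputable def evalZero : MvPolynomial (Fin 3) F →ₐ[F] Polynomial (Polynomial F) :=
  aeval ![1, Polynomial.C Polynomial.X, Polynomial.C (Polynomial.X ^ 2) + Polynomial.X]

theorem evalZero_X_zero : evalZero (X 0 : MvPolynomial (Fin 3) F) = 1 := by simp [evalZero]

theorem evalZero_X_one :
    evalZero (X 1 : MvPolynomial (Fin 3) F) = Polynomial.C Polynomial.X := by simp [evalZero]

theorem evalZero_X_two : evalZero (X 2 : MvPolynomial (Fin 3) F) =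
    Polynomial.C (Polynomial.X ^ 2) + Polynomial.X := by simp [evalZero]

theorem evalZero_C (a : F) : evalZero (C a) = Polynomial.C (Polynomial.C a) :=
  AlgHom.commutes _ a

theorem evalZero_delta : evalZero (delta F) = -Polynomial.X := by
  simp only [delta, map_sub, map_mul, map_pow, evalZero_X_zero, evalZero_X_one, evalZero_X_two]
  ring

/-- Both coordinates are translated: y, the inner variable, by c₁(g) and w = z - y^2, the outer one,
by c₂(g). -/
theorem evalZero_act (g : G p) (f : MvPolynomial (Fin 3) F) :
    evalZero (act (rep p M g) f) = ((evalZero f).map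
      (Polynomial.compRingHom (Polynomial.X + Polynomial.C (rowMap p M 0 g)))).comp
      (Polynomial.X + Polynomial.C (Polynomial.C (rowMap p M 1 g))) := by
  have hC : ∀ q : Polynomial F, ((Polynomial.C q).map (Polynomial.compRingHom
      (Polynomial.X + Polynomial.C (rowMap p M 0 g)))).comp
      (Polynomial.X + Polynomial.C (Polynomial.C (rowMap p M 1 g))) =
      Polynomial.C (q.comp (Polynomial.X + Polynomial.C (rowMap p M 0 g))) := by
    intro q
    rw [Polynomial.map_C, Polynomial.C_comp, Polynomial.coe_compRingHom_apply]
  have : (evalZero.comp (act (rep p M g))).toRingHom =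
      ((Polynomial.compRingHom (Polynomial.X + Polynomial.C (Polynomial.C (rowMap p M 1 g)))).comp
        (Polynomial.mapRingHom (Polynomial.compRingHom
          (Polynomial.X + Polynomial.C (rowMap p M 0 g))))).comp evalZero.toRingHom := by
    refine MvPolynomial.ringHom_ext (fun a => ?_) fun i => ?_
    · change evalZero (act (rep p M g) (C a)) = ((evalZero (C a)).map _).comp _
      rw [act_C, evalZero_C, hC, Polynomial.C_comp]
    · change evalZero (act (rep p M g) (X i)) = ((evalZero (X i)).map _).comp _
      fin_cases i
      · change evalZero (act (rep p M g) (X 0)) = ((evalZero (X 0)).map _).comp _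
        rw [act_rep_X_zero, evalZero_X_zero, Polynomial.map_one, Polynomial.one_comp]
      · change evalZero (act (rep p M g) (X 1)) = ((evalZero (X 1)).map _).comp _
        rw [act_rep_X_one, map_add, map_mul, evalZero_X_zero, evalZero_X_one, evalZero_C, hC,
          Polynomial.X_comp, mul_one, Polynomial.C_add]
      · change evalZero (act (rep p M g) (X 2)) = ((evalZero (X 2)).map _).comp _
        rw [act_rep_X_two, map_add, map_add, map_mul _ _ (X 1), map_mul _ _ (X 0), evalZero_X_zero,
          evalZero_X_one, evalZero_X_two, evalZero_C, evalZero_C, Polynomial.map_add,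
          Polynomial.add_comp, hC, Polynomial.map_X, Polynomial.X_comp, Polynomial.pow_comp,
          Polynomial.X_comp]
        simp only [map_add, map_mul, map_pow, map_ofNat]
        ring
  exact DFunLike.congr_fun this f

theorem evalZero_f1Bar (hp : 2 < p) (h13 : gammaBar p M 1 3 = 0) :
    evalZero (f1Bar p M) = Polynomial.C (Polynomial.C (gammaBar p M 1 2) * Polynomial.X ^ p +
      Polynomial.C (gammaBar p M 2 3) * Polynomial.X) := by
  simp only [f1Bar_eq p M hp, map_add, map_mul, map_pow, evalZero_X_zero, evalZero_X_one,
    evalZero_C, one_pow, mul_one, h13, map_zero, zero_mul, add_zero]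

theorem evalZero_f124Bar (hp : 2 < p) : evalZero (f124Bar p M) =
    Polynomial.C (Polynomial.C (gammaBar p M 1 2)) * Polynomial.X ^ p -
      Polynomial.C (Polynomial.C (gammaBar p M 1 4)) * Polynomial.X +
      Polynomial.C (Polynomial.C (gammaBar p M 2 4) * Polynomial.X) := by
  have hodd : Odd p := (Fact.out : p.Prime).odd_of_ne_two (by omega)
  simp only [f124Bar_eq p M hp, map_add, map_mul, map_neg, map_pow, evalZero_X_zero,
    evalZero_X_one, evalZero_C, evalZero_delta, one_pow, mul_one]
  rw [hodd.neg_pow (Polynomial.X : Polynomial (Polynomial F))]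
  ring

/-- As γ₁₃ = 0, f₁ does not involve w at x = 1, so the w-degree of h comes from the term γ₁₂ w^p of
f₁₂₄. -/
theorem natDegree_evalZero_hPoly (hp : 2 < p) (h13 : gammaBar p M 1 3 = 0)
    (h12 : gammaBar p M 1 2 ≠ 0) : (evalZero (hPoly p M)).natDegree = p ∧
      (evalZero (hPoly p M)).leadingCoeff = Polynomial.C (2⁻¹ * gammaBar p M 1 2) := by
  have h2 := two_ne_zero_of_charP (F := F) p hp
  have hcc : (Polynomial.C (Polynomial.C (gammaBar p M 1 2)) : Polynomial (Polynomial F)) ≠ 0 :=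
    Polynomial.C_ne_zero.2 (Polynomial.C_ne_zero.2 h12)
  have hinv : (Polynomial.C (Polynomial.C (gammaBar p M 1 2)) *
      Polynomial.C (Polynomial.C (gammaBar p M 1 2)⁻¹) : Polynomial (Polynomial F)) = 1 := by
    rw [← Polynomial.C_mul, ← Polynomial.C_mul, mul_inv_cancel₀ h12]
    simp
  have heq : evalZero (hPoly p M) =
      Polynomial.C (Polynomial.C (2⁻¹ * gammaBar p M 1 2)) * Polynomial.X ^ p +
      (Polynomial.C (Polynomial.C (-(2⁻¹ * gammaBar p M 1 4))) * Polynomial.X +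
        Polynomial.C (Polynomial.C (2⁻¹ * gammaBar p M 2 4) * Polynomial.X +
          Polynomial.C (2⁻¹ * (gammaBar p M 1 2)⁻¹) *
          (Polynomial.C (gammaBar p M 1 2) * Polynomial.X ^ p +
            Polynomial.C (gammaBar p M 2 3) * Polynomial.X) ^ 2)) := by
    refine mul_left_cancel₀ hcc ?_
    have e1 := congrArg evalZero (X_pow_mul_f2Bar p M hp)
    have e2 := congrArg evalZero (gammaBar_mul_hPoly p M hp h13 h12)
    simp only [map_mul, map_add, map_pow, evalZero_X_zero, one_pow, one_mul, mul_one, evalZero_C,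
      evalZero_f1Bar p M hp h13, evalZero_f124Bar p M hp] at e1 e2
    rw [e2, e1]
    simp only [map_mul, map_add, map_pow, map_neg]
    linear_combination -Polynomial.C (Polynomial.C 2⁻¹) *
      (Polynomial.C (Polynomial.C (gammaBar p M 1 2)) * Polynomial.C Polynomial.X ^ p +
        Polynomial.C (Polynomial.C (gammaBar p M 2 3)) * Polynomial.C Polynomial.X) ^ 2 * hinv
  have hc : (Polynomial.C (2⁻¹ * gammaBar p M 1 2) : Polynomial F) ≠ 0 :=
    Polynomial.C_ne_zero.2 (mul_ne_zero (inv_ne_zero h2) h12)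
  have hdeg := Polynomial.natDegree_C_mul_X_pow p _ hc
  rw [heq]
  obtain ⟨h3, h4⟩ := natDegree_and_leadingCoeff_add
    (lt_of_le_of_lt Polynomial.natDegree_linear_le (hdeg.symm ▸ (by omega : 1 < p)))
  exact ⟨h3.trans hdeg, h4.trans (Polynomial.leadingCoeff_C_mul_X_pow _ _)⟩

open Classical in
/-- The value of `N_G(y)` at `x = 1`. -/
noncomputable def normPoly : Polynomial F :=
  ∏ c ∈ Finset.univ.image (rowMap p M 0), (Polynomial.X + Polynomial.C c)

theorem evalZero_orbitProd_X_one : evalZero (orbitProd p M (X 1)) =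
    Polynomial.C (normPoly p M) := by
  rw [orbitProd_eq, map_prod, prod_orbitFinset_X_one, normPoly, map_prod]
  simp only [map_add, map_mul, evalZero_X_zero, evalZero_X_one, evalZero_C, mul_one]

theorem monic_normPoly : (normPoly p M).Monic :=
  Polynomial.monic_prod_of_monic _ _ fun _ _ => Polynomial.monic_X_add_C _

theorem natDegree_normPoly (h12 : gammaBar p M 1 2 ≠ 0) (h13 : gammaBar p M 1 3 = 0) :
    (normPoly p M).natDegree = p := by
  classical
  rw [normPoly, Polynomial.natDegree_prod_of_monic _ _ fun _ _ => Polynomial.monic_X_add_C _]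
  simp only [Polynomial.natDegree_X_add_C, Finset.sum_const, smul_eq_mul, mul_one]
  convert card_image_rowMap p M h12 h13

/-- Two applications of the translation theorem: first over F[y], with the kernel of c₁ translating
w, then to the coefficients, with the values of c₁ translating y. -/
theorem exists_comp_evalZero_hPoly (hp : 2 < p) (h13 : gammaBar p M 1 3 = 0)
    (h12 : gammaBar p M 1 2 ≠ 0) {f : MvPolynomial (Fin 3) F} (hf : f ∈ invariants p M) :
    ∃ r : Polynomial (Polynomial F), evalZero f =
      (r.map (Polynomial.compRingHom (normPoly p M))).comp (evalZero (hPoly p M)) := by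
  classical
  have hpp : p.Prime := Fact.out
  have h2 := two_ne_zero_of_charP (F := F) p hp
  obtain ⟨hBdeg, hBlead⟩ := natDegree_evalZero_hPoly p M hp h13 h12
  have hinv : ∀ h ∈ invariants p M, ∀ g : G p, ((evalZero h).map
      (Polynomial.compRingHom (Polynomial.X + Polynomial.C (rowMap p M 0 g)))).comp
      (Polynomial.X + Polynomial.C (Polynomial.C (rowMap p M 1 g))) = evalZero h := by
    intro h hh g
    rw [← evalZero_act p M g h, hh g]
  have hB := hinv _ (hPoly_mem_invariants p M hp h13 h12)
  set B := evalZero (hPoly p M) with hBdef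
  -- The powers of a nontrivial element g with c₁(g) = 0 fix y and translate w by the p distinct
  -- multiples of c₂(g).
  obtain ⟨q, hq⟩ : ∃ q : Polynomial (Polynomial F), evalZero f = q.comp B := by
    obtain ⟨g, hg, hg0⟩ := exists_rowMap_zero_eq_zero p M h13
    have hg1 : rowMap p M 1 g ≠ 0 := fun h0 => hg (rowMap_injective p M h12
      (by rw [hg0, rowMap_one]) (by rw [h0, rowMap_one]))
    have hpow : ∀ (i : Fin 2) (n : ℕ), rowMap p M i (g ^ n) = n * rowMap p M i g := by
      intro i n
      induction n with
      | zero => rw [pow_zero, rowMap_one]; simp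
      | succ n ih => rw [pow_succ, rowMap_mul, ih]; push_cast; ring
    have htr : ∀ h ∈ invariants p M, ∀ c ∈ (Finset.range p).image
        (fun n => Polynomial.C (rowMap p M 1 (g ^ n))),
        (evalZero h).comp (Polynomial.X + Polynomial.C c) = evalZero h := by
      intro h hh c hc
      obtain ⟨n, -, rfl⟩ := Finset.mem_image.1 hc
      have h3 := hinv h hh (g ^ n)
      rw [hpow 0, hg0, mul_zero, Polynomial.C_0, add_zero] at h3
      have hid : Polynomial.compRingHom (Polynomial.X : Polynomial F) = RingHom.id _ := by
        ext <;> simp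
      rwa [hid, Polynomial.map_id] at h3
    refine exists_eq_comp_of_translation_invariant ?_
      ((Finset.nonempty_range_iff.2 hpp.ne_zero).image _) ?_
      (htr _ (hPoly_mem_invariants p M hp h13 h12)) _ (htr f hf)
    · rw [hBdeg, Finset.card_image_of_injOn, Finset.card_range]
      intro m hm n hn hmn
      have h3 := Polynomial.C_injective hmn
      rw [hpow, hpow] at h3
      have h4 := mul_right_cancel₀ hg1 h3
      exact (CharP.natCast_injOn_Iio F p) (Finset.mem_range.1 hm) (Finset.mem_range.1 hn) h4
    · rw [hBlead]
      exact (mul_ne_zero (inv_ne_zero h2) h12).isUnit.map Polynomial.C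
  have hcoeff : ∀ (j : ℕ) (c : F), c ∈ Finset.univ.image (rowMap p M 0) →
      (q.coeff j).comp (Polynomial.X + Polynomial.C c) = q.coeff j := by
    intro j c hc
    obtain ⟨g, -, rfl⟩ := Finset.mem_image.1 hc
    have h3 := hinv f hf g
    rw [hq, Polynomial.map_comp, Polynomial.comp_assoc, hB g] at h3
    -- Since h is invariant, g acts on q(h) only through the coefficients of q; composition with the
    -- nonconstant h is injective, so the coefficients are invariant.
    have h4 : q.map (Polynomial.compRingHom
        (Polynomial.X + Polynomial.C (rowMap p M 0 g))) = q := by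
      rw [← sub_eq_zero, ← Polynomial.sub_comp, Polynomial.comp_eq_zero_iff] at h3
      rcases h3 with h3 | ⟨-, h3⟩
      · exact sub_eq_zero.1 h3
      · rw [h3, Polynomial.natDegree_C] at hBdeg
        exact absurd hBdeg.symm hpp.ne_zero
    conv_rhs => rw [← h4]
    rw [Polynomial.coeff_map, Polynomial.coe_compRingHom_apply]
  have hnorm : ∀ c ∈ Finset.univ.image (rowMap p M 0),
      (normPoly p M).comp (Polynomial.X + Polynomial.C c) = normPoly p M := by
    intro c hc
    obtain ⟨g, -, rfl⟩ := Finset.mem_image.1 hc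
    have h3 := hinv _ (orbitProd_mem_invariants p M (X 1)) g
    rw [evalZero_orbitProd_X_one, Polynomial.map_C, Polynomial.C_comp] at h3
    exact Polynomial.C_injective h3
  have hlift : ∀ j, ∃ s : Polynomial F, q.coeff j = s.comp (normPoly p M) := by
    intro j
    refine exists_eq_comp_of_translation_invariant (C := Finset.univ.image (rowMap p M 0)) ?_
      (Finset.univ_nonempty.image _) ?_ hnorm _ (hcoeff j)
    · rw [natDegree_normPoly p M h12 h13]
      symm
      convert card_image_rowMap p M h12 h13
    · rw [monic_normPoly p M]
      exact isUnit_one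
  have hmem : q ∈ Polynomial.lifts (Polynomial.compRingHom (normPoly p M)) := by
    rw [Polynomial.lifts_iff_coeff_lifts]
    intro j
    obtain ⟨s, hs⟩ := hlift j
    exact ⟨s, by rw [hs, Polynomial.coe_compRingHom_apply]⟩
  obtain ⟨r, hr⟩ := (Polynomial.mem_lifts _).1 hmem
  exact ⟨r, by rw [hr, hq]⟩

theorem isSagbiHypersurface_hPoly (hp : 2 < p) (h12 : gammaBar p M 1 2 ≠ 0)
    (h13 : gammaBar p M 1 3 = 0) :
    IsSagbiHypersurface (invariants p M)
      ![X 0, orbitProd p M (X 1), hPoly p M, orbitProd p M (X 2)]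
      (C (gammaBar p M 2 3 ^ p) * X 1 ^ (p + 1) - X 2 ^ p) := by
  classical
  have hpp : 0 < p := by omega
  have h2 := two_ne_zero_of_charP (F := F) p hp
  obtain ⟨hl1, hc1⟩ := hPoly_lead p M hp h13 h12
  have h23 := gammaBar_two_three_ne_zero p M h12 h13
  obtain ⟨hy0, hy1, hy2⟩ := orbitProd_X_lead p M (i := 1) (by decide)
  obtain ⟨hz0, hz1, hz2⟩ := orbitProd_X_lead p M (i := 2) (by decide)
  have hcard2 : (orbitFinset p M (X 2)).card = p ^ 2 :=
    card_orbitFinset_X_two p M hp fun g k hgk hgk' => rowMap_injective p M h12 hgk hgk'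
  have hcard1 : (orbitFinset p M (X 1)).card = p := by
    have : orbitFinset p M (X 1) =
        (Finset.univ.image (rowMap p M 0)).image fun c => X 1 + C c * X 0 := by
      rw [orbitFinset, Finset.image_image]
      exact Finset.image_congr fun g _ => act_rep_X_one p M g
    rw [this, Finset.card_image_of_injective]
    · convert card_image_rowMap p M h12 h13
    · intro a b hab
      exact C_injective _ _ (mul_left_injective₀ (X_ne_zero (0 : Fin 3)) (add_left_cancel hab))
  rw [hcard1] at hy0 hy1
  rw [hcard2] at hz0 hz1
  obtain ⟨hBdeg, hBlead⟩ := natDegree_evalZero_hPoly p M hp h13 h12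
  have hcB : 2⁻¹ * gammaBar p M 1 2 ≠ 0 := mul_ne_zero (inv_ne_zero h2) h12
  have hcomp : ∀ r : Polynomial (Polynomial F),
      (r.map (Polynomial.compRingHom (normPoly p M))).comp (evalZero (hPoly p M)) =
      Polynomial.eval₂ (Polynomial.aeval (evalZero (orbitProd p M (X 1)))).toRingHom
        (evalZero (hPoly p M)) r := by
    intro r
    have hC : (Polynomial.aeval (evalZero (orbitProd p M (X 1)))).toRingHom =
        (Polynomial.C : Polynomial F →+* Polynomial (Polynomial F)).comp
          (Polynomial.compRingHom (normPoly p M)) := by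
      rw [evalZero_orbitProd_X_one]
      refine Polynomial.ringHom_ext (fun a => ?_) ?_
      · refine (Polynomial.aeval_C _ a).trans ?_
        simp
      · refine (Polynomial.aeval_X _).trans ?_
        simp
    rw [hC, Polynomial.comp, Polynomial.eval₂_map]
  have hx : algebraMap (MvPolynomial (Fin 3) F) (FractionRing (MvPolynomial (Fin 3) F)) (X 0) ≠ 0 :=
    by simp
  have hexp := fun {f} (hf : f ∈ invariants p M) => exists_comp_evalZero_hPoly p M hp h13 h12 hf
  have hD3 : ∃ r : Polynomial (Polynomial F), ∃ c : F, c ≠ 0 ∧ r.natDegree = p ∧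
      r.leadingCoeff = Polynomial.C c ∧ evalZero (orbitProd p M (X 2)) =
        Polynomial.eval₂ (Polynomial.aeval (evalZero (orbitProd p M (X 1)))).toRingHom
          (evalZero (hPoly p M)) r := by
    obtain ⟨r, hr⟩ := hexp (orbitProd_mem_invariants p M (X 2))
    -- Each of the p^2 conjugates of z is monic of degree 1 in w, and h has w-degree p, so N_G(z)
    -- has degree p in h.
    have hfac : ∀ h ∈ orbitFinset p M (X 2), ∃ s : Polynomial F,
        evalZero h = Polynomial.X + Polynomial.C s := by
      intro h hh
      obtain ⟨g, rfl⟩ := mem_orbitFinset.1 hh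
      refine ⟨Polynomial.X ^ 2 + Polynomial.C (2 * rowMap p M 0 g) * Polynomial.X +
        Polynomial.C (rowMap p M 0 g ^ 2 + rowMap p M 1 g), ?_⟩
      rw [act_rep_X_two, map_add, map_add, map_mul _ _ (X 1), map_mul _ _ (X 0), evalZero_X_zero,
        evalZero_X_one, evalZero_X_two, evalZero_C, evalZero_C]
      simp only [map_add, map_mul, map_pow]
      ring
    have hmonic : ∀ h ∈ orbitFinset p M (X 2), (evalZero h).Monic := by
      intro h hh
      obtain ⟨s, hs⟩ := hfac h hh
      rw [hs]
      exact Polynomial.monic_X_add_C s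
    have h3deg : (evalZero (orbitProd p M (X 2))).natDegree = p * p := by
      rw [orbitProd_eq, map_prod, Polynomial.natDegree_prod_of_monic _ _ hmonic,
        Finset.sum_congr rfl fun h hh => ?_, Finset.sum_const, hcard2, smul_eq_mul, mul_one, sq]
      obtain ⟨s, hs⟩ := hfac h hh
      rw [hs, Polynomial.natDegree_X_add_C]
    have h3lead : (evalZero (orbitProd p M (X 2))).leadingCoeff = 1 := by
      rw [orbitProd_eq, map_prod]
      exact Polynomial.monic_prod_of_monic _ _ hmonic
    rw [hr] at h3deg h3lead
    obtain ⟨hqdeg, hqlead⟩ := natDegree_and_leadingCoeff_of_comp hpp hBdeg h3deg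
    rw [h3lead, hBlead] at hqlead
    -- Substituting the nonconstant N_G(y) is injective, so degree and constancy of the lead
    -- coefficient descend to r.
    have hinj : Function.Injective (Polynomial.compRingHom (normPoly p M)) := by
      rw [injective_iff_map_eq_zero]
      intro s hs
      rw [Polynomial.coe_compRingHom_apply, Polynomial.comp_eq_zero_iff] at hs
      rcases hs with hs | ⟨-, hs⟩
      · exact hs
      · have h3 := natDegree_normPoly p M h12 h13
        rw [hs, Polynomial.natDegree_C] at h3
        exact absurd h3.symm hpp.ne'
    rw [Polynomial.natDegree_map_eq_of_injective hinj] at hqdeg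
    rw [Polynomial.leadingCoeff_map_of_injective hinj] at hqlead
    refine ⟨r, ((2⁻¹ * gammaBar p M 1 2) ^ p)⁻¹, inv_ne_zero (pow_ne_zero _ hcB), hqdeg, ?_,
      by rw [hr, hcomp]⟩
    apply hinj
    rw [Polynomial.coe_compRingHom_apply (Polynomial.C _), Polynomial.C_comp]
    have h4 : (Polynomial.C (2⁻¹ * gammaBar p M 1 2) ^ p : Polynomial F) *
        Polynomial.C ((2⁻¹ * gammaBar p M 1 2) ^ p)⁻¹ = 1 := by
      rw [← Polynomial.C_pow, ← Polynomial.C_mul, mul_inv_cancel₀ (pow_ne_zero _ hcB),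
        Polynomial.C_1]
    linear_combination -Polynomial.C ((2⁻¹ * gammaBar p M 1 2) ^ p)⁻¹ * hqlead -
      Polynomial.compRingHom (normPoly p M) r.leadingCoeff * h4
  have hT : (C (gammaBar p M 2 3 ^ p) * X 1 ^ (p + 1) - X 2 ^ p : MvPolynomial (Fin 4) F) =
      C (gammaBar p M 2 3 ^ p) * X 1 ^ (p + 1) - C 1 * X 2 ^ p := by
    rw [C_1, one_mul]
  rw [hT]
  have hcop : Nat.Coprime p (p + 1) := by simp
  have hcd : gammaBar p M 2 3 ^ p * grevlex.leadingCoeff (orbitProd p M (X 1)) ^ (p + 1) =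
      1 * grevlex.leadingCoeff (hPoly p M) ^ p := by
    rw [hc1, hy2, one_pow, mul_one, one_mul]
  have hhA := hPoly_mem_invariants p M hp h13 h12
  have hyA := orbitProd_mem_invariants p M (X 1)
  have hzA := orbitProd_mem_invariants p M (X 2)
  have hhhom := isHomogeneous_hPoly p M hp h13 h12
  have hh0 : grevlex.leadingCoeff (hPoly p M) ≠ 0 := hc1 ▸ h23
  have hy0' : grevlex.leadingCoeff (orbitProd p M (X 1)) ≠ 0 := hy2 ▸ one_ne_zero
  have hz0' : grevlex.leadingCoeff (orbitProd p M (X 2)) ≠ 0 := hz2 ▸ one_ne_zero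
  have hexp' : ∀ f ∈ invariants p M, ∃ r : Polynomial (Polynomial F), evalZero f =
      Polynomial.eval₂ (Polynomial.aeval (evalZero (orbitProd p M (X 1)))).toRingHom
        (evalZero (hPoly p M)) r := by
    intro f hf
    obtain ⟨r, hr⟩ := hexp hf
    exact ⟨r, by rw [hr, hcomp]⟩
  clear hexp hcomp hBdeg hBlead hcard1 hcard2 hy2 hz2 hc1
  generalize orbitProd p M (X 1) = f at *
  generalize orbitProd p M (X 2) = k at *
  generalize hPoly p M = h at *
  -- The map back to fractions sends y to y/x and w to z/x - (y/x)^2.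
  refine isSagbiHypersurface_of_expansion
    (hasLeadExponents_vec hy1 hl1 hz1 hy0' hh0 hz0' hpp (pow_pos hpp 2) hcop)
    (vec_mem (X_zero_mem_invariants p M) hyA hhA hzA) hy0 hhhom hz0 (by nlinarith)
    (fun f hf m => homogeneousComponent_mem_invariants p M hf m) evalZero
    (Polynomial.aevalTower (Polynomial.aeval
      (algebraMap (MvPolynomial (Fin 3) F) (FractionRing (MvPolynomial (Fin 3) F)) (X 1) /
        algebraMap (MvPolynomial (Fin 3) F) _ (X 0)))
      (algebraMap (MvPolynomial (Fin 3) F) (FractionRing (MvPolynomial (Fin 3) F)) (X 2) /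
        algebraMap (MvPolynomial (Fin 3) F) _ (X 0) -
      (algebraMap (MvPolynomial (Fin 3) F) (FractionRing (MvPolynomial (Fin 3) F)) (X 1) /
        algebraMap (MvPolynomial (Fin 3) F) _ (X 0)) ^ 2)) ?_ hexp' hD3 one_ne_zero hcd
  intro i
  fin_cases i
  · change Polynomial.aevalTower _ _ (evalZero (X 0)) =
      algebraMap (MvPolynomial (Fin 3) F) _ (X 0) / _
    rw [div_self hx, evalZero_X_zero, map_one]
  · change Polynomial.aevalTower _ _ (evalZero (X 1)) = _
    rw [evalZero_X_one, Polynomial.aevalTower_C, Polynomial.aeval_X]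
    rfl
  · change Polynomial.aevalTower _ _ (evalZero (X 2)) = _
    rw [evalZero_X_two, map_add, Polynomial.aevalTower_C, Polynomial.aevalTower_X, map_pow,
      Polynomial.aeval_X, add_sub_cancel]
    rfl

end ZeroMinor

end RankTwo

theorem mainTheorem9 {F : Type*} [Field F] (p : ℕ) [Fact p.Prime] [CharP F p] (hp : 2 < p)
    (M : Matrix (Fin 2) (Fin 2) F) :
    (Function.Injective (rep p M) → M 0 ≠ 0 → gammaBar p M 1 2 ≠ 0 ∨ gammaBar p M 1 3 ≠ 0) ∧
    (gammaBar p M 1 2 ≠ 0 → gammaBar p M 1 3 ≠ 0 →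
      IsSagbiHypersurface (invariants p M)
        ![X 0, f1Bar p M, f2Bar p M, orbitProd p M (X 2)]
        (C (gammaBar p M 1 3 ^ p) * X 1 ^ (p + 2) - C (gammaBar p M 1 2 ^ 2) * X 2 ^ p)) ∧
    (gammaBar p M 1 2 ≠ 0 → gammaBar p M 1 3 = 0 →
      IsSagbiHypersurface (invariants p M)
        ![X 0, orbitProd p M (X 1), hPoly p M, orbitProd p M (X 2)]
        (C (gammaBar p M 2 3 ^ p) * X 1 ^ (p + 1) - X 2 ^ p)) ∧
    (gammaBar p M 1 2 = 0 → gammaBar p M 1 3 ≠ 0 →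
      IsSagbiHypersurface (invariants p M)
        ![X 0, dPoly p M, orbitProd p M (X 1), orbitProd p M (X 2)]
        (X 1 ^ p ^ 2 - C (gammaBar p M 1 3 ^ p ^ 2) * X 2 ^ 2)) :=
  ⟨gammaBar_ne_zero_of_injective p M, isSagbiHypersurface_f1Bar_f2Bar p M hp,
    isSagbiHypersurface_hPoly p M hp, isSagbiHypersurface_dPoly p M hp⟩
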